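/- Let $n\ge 0$ be an integer. For an $n\times n$ matrix $g$ let $[g]_j$ denote its $j\times j$ left upper block. For complex parameters put $\lambda_{n+1}=\sigma_{n+1}=\tau_{n+1}=0$. If $R$ is a complex matrix whose hermitian part $\frac12(R+R^*)$ is positive definite, with eigenvalues $\mu_1,\dots,\mu_m$ (with algebraic multiplicity), put $\ell(R)=\sum_{i}\ln\mu_i$ (principal logarithms; all $\operatorname{Re}\mu_i>0$) and $$\det R^{\{\sigma\|\tau\}}:=(\det R)^{\sigma}\,\overline{(\det R)}^{\,\tau}:=e^{\sigma\ell(R)+\tau\overline{\ell(R)}}.$$ Powers of positive reals are the usual ones. If $g$ is an $m\times m$ quaternionic matrix, $\det g:=\sqrt[4]{\det g_{\mathbb R}}\ge 0$, where $g_{\mathbb R}$ is the operator $v\mapsto gv$ on $\mathbb H^m\cong\mathbb R^{4m}$; $\mathbf j$ is the second quaternionic imaginary unit. $T\gg0$ means that $T$ is hermitian (symmetric, if real) positive definite. Lebesgue measures are normalized as follows: $dT=\prod_{k\le m}dt_{km}$ on real symmetric matrices, $dS=\prod_{k\le m}d(\operatorname{Re}s_{km})\,d(\operatorname{Im}s_{km})$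 on complex symmetric matrices, $dT=\prod_k dt_{kk}\prod_{k<m}d(\operatorname{Re}t_{km})\,d(\operatorname{Im}t_{km})$ on hermitian matrices. Everywhere $1/\Gamma(z)=0$ at the poles $z=0,-1,-2,\dots$ of $\Gamma$. (a) (The space $\mathrm{Sp}(2n,\mathbb R)/\mathrm U(n)$, realized by the complex symmetric matrices $T+iS$ with $T,S$ real, $T\gg0$.) Let $\lambda_k,\sigma_k,\tau_k\in\mathbb C$ for $1\le k\le n$. The integral $$I=\int_{T=T^t\gg0,\ S=S^t}\ \prod_{j=1}^n\frac{\det[T]_j^{\lambda_j-\lambda_{j+1}}}{\det[1+T+iS]_j^{\{\sigma_j-\sigma_{j+1}\|\tau_j-\tau_{j+1}\}}}\ \det T^{-(n+1)}\,dT\,dS$$ over pairs of real $n\times n$ matrices converges absolutely if and only if $\operatorname{Re}\lambda_k>\frac{n+k}2$ and $\operatorname{Re}(\sigma_k+\tau_k-\lambda_k)>\frac{n-k}2$ for all $k=1,\dots,n$, and whenever it does $$I=\prod_{k=1}^n\frac{2^{2-\sigma_k-\tau_k+n-k}\,\pi^k\,\Gamma\bigl(\lambda_k-\frac{n+k}2\bigr)\,\Gamma\bigl(\sigma_k+\tau_k-\lambda_k-\frac{n-k}2\bigr)}{\Gamma\bigl(\sigma_k-\frac{n-k}2\bigr)\,\Gamma\bigl(\tau_k-\frac{n-k}2\bigr)}.$$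 (b) (The space $\mathrm{Sp}(2n,\mathbb C)/\mathrm{Sp}(n)$, realized by the pairs $(T,S)$ of complex $n\times n$ matrices with $T=T^*\gg0$, $S=S^t$.) Let $\lambda_k,\sigma_k\in\mathbb C$ for $1\le k\le n$. The integral $$I'=\int_{T=T^*\gg0,\ S=S^t}\ \prod_{s=1}^n\frac{\det[T]_s^{\lambda_s-\lambda_{s+1}}}{\det[1+T+S\mathbf j]_s^{\sigma_s-\sigma_{s+1}}}\ \det T^{-(2n+1)}\,dT\,dS,$$ in which the denominator is formed with the quaternionic determinant, converges absolutely if and only if $\operatorname{Re}\lambda_k>n+k$ and $\operatorname{Re}(\sigma_k-\lambda_k)>n-k$ for all $k=1,\dots,n$, and whenever it does $$I'=\prod_{k=1}^n 2\,\pi^{2k-1}\,\frac{\Gamma(\lambda_k-(n+k))\,\Gamma(\sigma_k-\lambda_k-(n-k))}{\Gamma(\sigma_k-2(n-k)-1)}.$$ -/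

import Mathlib

open MeasureTheory
open scoped Quaternion ComplexOrder

noncomputable section

/-- The `p × p` left upper block of a square matrix. -/
def leadingBlock {α : Type*} {n : ℕ} (g : Matrix (Fin n) (Fin n) α) (p : ℕ) (hp : p ≤ n) :
    Matrix (Fin p) (Fin p) α :=
  g.submatrix (Fin.castLE hp) (Fin.castLE hp)

/-- For parameters `a 0, …, a (n - 1)`, extended by `a n = 0`, the difference
`a j - a (j + 1)`. -/
def paramDiff {n : ℕ} (a : Fin n → ℂ) (j : Fin n) : ℂ :=
  a j - if h : (j : ℕ) + 1 < n then a ⟨(j : ℕ) + 1, h⟩ else 0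

/-- The sum of the principal logarithms of the eigenvalues, with algebraic multiplicity,
of a complex matrix. -/
def logDet {n : ℕ} (R : Matrix (Fin n) (Fin n) ℂ) : ℂ :=
  (R.charpoly.roots.map Complex.log).sum

/-- `det R ^ {σ‖τ} = (det R) ^ σ * (conj (det R)) ^ τ`, for dissipative `R`: the powers are formed
with the branch `logDet R` of the logarithm of the determinant. -/
def detBipow {n : ℕ} (R : Matrix (Fin n) (Fin n) ℂ) (σ τ : ℂ) : ℂ :=
  Complex.exp (σ * logDet R) * Complex.exp (τ * (starRingEnd ℂ) (logDet R))

/-- The real-linear operator `v ↦ g v` on `ℍ ^ n ≅ ℝ ^ (4 n)` of a quaternionic matrix. -/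
def quatRealification {n : ℕ} (g : Matrix (Fin n) (Fin n) ℍ[ℝ]) :
    (Fin n → ℍ[ℝ]) →ₗ[ℝ] (Fin n → ℍ[ℝ]) where
  toFun v := g.mulVec v
  map_add' := g.mulVec_add
  map_smul' c v := g.mulVec_smul c v

/-- The determinant of a quaternionic matrix: the fourth root of the determinant of its
realification. -/
def quatDet {n : ℕ} (g : Matrix (Fin n) (Fin n) ℍ[ℝ]) : ℝ :=
  (LinearMap.det (quatRealification g)) ^ (1 / 4 : ℝ)

/-- The quaternionic imaginary unit `j`. -/
def quatJ : ℍ[ℝ] := ⟨0, 0, 1, 0⟩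

/-- The quaternionic matrix `T + S j` for complex matrices `T`, `S`. -/
def quatOfPair {n : ℕ} (T S : Matrix (Fin n) (Fin n) ℂ) : Matrix (Fin n) (Fin n) ℍ[ℝ] :=
  Matrix.of fun k m => (T k m : ℍ[ℝ]) + (S k m : ℍ[ℝ]) * quatJ

/-- The complex matrix `T + i S` for real matrices `T`, `S`. -/
def complexOfPair {n : ℕ} (T S : Matrix (Fin n) (Fin n) ℝ) : Matrix (Fin n) (Fin n) ℂ :=
  Matrix.of fun k m => (T k m : ℂ) + Complex.I * (S k m : ℂ)

/-- The symmetric matrix with given entries on and above the diagonal. -/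
def symmOfCoords {α : Type*} {n : ℕ} (x : {p : Fin n × Fin n // p.1 ≤ p.2} → α) :
    Matrix (Fin n) (Fin n) α :=
  Matrix.of fun k m => x ⟨(min k m, max k m), min_le_max⟩

/-- The hermitian matrix with given (real) diagonal entries and given entries above the
diagonal. -/
def hermOfCoords {n : ℕ} (x : (Fin n → ℝ) × ({p : Fin n × Fin n // p.1 < p.2} → ℂ)) :
    Matrix (Fin n) (Fin n) ℂ :=
  Matrix.of fun k m =>
    if h : k < m then x.2 ⟨(k, m), h⟩
    else if h : m < k then (starRingEnd ℂ) (x.2 ⟨(m, k), h⟩)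
    else (x.1 k : ℂ)

theorem symmOfCoords_isSymm {α : Type*} {n : ℕ}
    (x : {p : Fin n × Fin n // p.1 ≤ p.2} → α) : (symmOfCoords x).IsSymm := by
  ext k m
  simp [symmOfCoords, Matrix.transpose_apply, min_comm, max_comm]

theorem hermOfCoords_isHermitian {n : ℕ}
    (x : (Fin n → ℝ) × ({p : Fin n × Fin n // p.1 < p.2} → ℂ)) :
    (hermOfCoords x).IsHermitian := by
  ext k m
  rcases lt_trichotomy k m with h | h | h
  · simp [hermOfCoords, Matrix.conjTranspose_apply, h, h.not_gt]
  · subst h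
    simp [hermOfCoords, Matrix.conjTranspose_apply]
  · simp [hermOfCoords, Matrix.conjTranspose_apply, h, h.not_gt]

instance instMeasurableSpaceSqMatrix {α : Type*} [MeasurableSpace α] {n : ℕ} :
    MeasurableSpace (Matrix (Fin n) (Fin n) α) :=
  inferInstanceAs (MeasurableSpace (Fin n → Fin n → α))

theorem measurable_symmOfCoords {α : Type*} [MeasurableSpace α] {n : ℕ} :
    Measurable (symmOfCoords : ({p : Fin n × Fin n // p.1 ≤ p.2} → α) → _) :=
  measurable_pi_lambda _ fun _ => measurable_pi_lambda _ fun _ => measurable_pi_apply _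

theorem measurable_hermOfCoords {n : ℕ} :
    Measurable (hermOfCoords :
      (Fin n → ℝ) × ({p : Fin n × Fin n // p.1 < p.2} → ℂ) → _) := by
  refine measurable_pi_lambda _ fun k => measurable_pi_lambda _ fun m => ?_
  rcases lt_trichotomy k m with h | h | h
  · simp only [hermOfCoords, Matrix.of_apply, h, dite_true]
    fun_prop
  · subst h
    simp only [hermOfCoords, Matrix.of_apply, lt_irrefl, dite_false]
    fun_prop
  · simp only [hermOfCoords, Matrix.of_apply, h, h.not_gt, dite_true, dite_false]
    exact Complex.continuous_conj.measurable.comp (by fun_prop)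

/-- Lebesgue measure `∏_{k ≤ m} dt_{km}` on the symmetric `n × n` matrices over `𝕜 = ℝ` or `ℂ`,
regarded as a measure on all matrices; over `ℂ`, `dt = d(Re t) d(Im t)`. -/
def symmLebesgue (𝕜 : Type*) [MeasureSpace 𝕜] (n : ℕ) :
    Measure (Matrix (Fin n) (Fin n) 𝕜) :=
  (volume : Measure ({p : Fin n × Fin n // p.1 ≤ p.2} → 𝕜)).map symmOfCoords

/-- Lebesgue measure `∏_k dt_{kk} ∏_{k < m} d(Re t_{km}) d(Im t_{km})` on the hermitian
`n × n` complex matrices, regarded as a measure on all matrices. -/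
def hermLebesgue (n : ℕ) : Measure (Matrix (Fin n) (Fin n) ℂ) :=
  (volume : Measure ((Fin n → ℝ) × ({p : Fin n × Fin n // p.1 < p.2} → ℂ))).map hermOfCoords

/-- Pairs `(T, S)` of real symmetric matrices with `T` positive definite. -/
def realPairs (n : ℕ) : Set (Matrix (Fin n) (Fin n) ℝ × Matrix (Fin n) (Fin n) ℝ) :=
  {p | p.1.PosDef ∧ p.2.IsSymm}

/-- Pairs `(T, S)` of complex matrices with `T` hermitian positive definite and `S` symmetric. -/
def complexPairs (n : ℕ) : Set (Matrix (Fin n) (Fin n) ℂ × Matrix (Fin n) (Fin n) ℂ) :=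
  {p | p.1.PosDef ∧ p.2.IsSymm}

/-- The integrand of the integral over the space of complex symmetric matrices `T + i S`. -/
def realIntegrand {n : ℕ} (lam σ τ : Fin n → ℂ)
    (p : Matrix (Fin n) (Fin n) ℝ × Matrix (Fin n) (Fin n) ℝ) : ℂ :=
  (∏ j : Fin n,
      ((leadingBlock p.1 (j + 1) j.isLt).det : ℂ) ^ paramDiff lam j /
        detBipow (leadingBlock (1 + complexOfPair p.1 p.2) (j + 1) j.isLt)
          (paramDiff σ j) (paramDiff τ j)) *
    (p.1.det : ℂ) ^ (-((n : ℤ) + 1))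

/-- The integrand of the integral over the space of pairs `(T, S)`, `T` hermitian, `S` complex
symmetric. -/
def quatIntegrand {n : ℕ} (lam σ : Fin n → ℂ)
    (p : Matrix (Fin n) (Fin n) ℂ × Matrix (Fin n) (Fin n) ℂ) : ℂ :=
  (∏ s : Fin n,
      (leadingBlock p.1 (s + 1) s.isLt).det ^ paramDiff lam s /
        (quatDet (leadingBlock (1 + quatOfPair p.1 p.2) (s + 1) s.isLt) : ℂ) ^ paramDiff σ s) *
    p.1.det ^ (-(2 * (n : ℤ) + 1))

end

open Matrix

noncomputable section

/-! The proof is an induction on the size that integrates out the last row and column of `T` and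
`S`. Write `T = border A b (star b) c` and `S = border B y y s`; the Lebesgue measures become
products under this bordering. By `posDef_border_iff`, `T` is positive definite exactly when `A` is
and `u = c - b* A⁻¹ b` is positive, and `u` is the last pivot of `T`.

Both cases rest on one computation, made over a field `𝕜` that is `ℝ` or `ℂ` (`pivotForm_eq`). The
last pivot of `1 + T + iS`, respectively `1 + T + Sj`, is `w + i(s - ζ)`, respectively `w + (s -
ζ)j`. Here `w = 1 + u + q`, where `q = pivotForm A B b y` is a nonnegative form in the last columns,
and `ζ` does not involve `c` and `s`. Summation by parts turns the product of powers of leading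
minors into a product of powers of pivots. In the real case this requires that `logDet` be the sum
of the principal logarithms of the pivots (`IsDissipative.logDet_border`, by a homotopy to the
identity). In the quaternionic case the determinant is the product of the norms of the pivots, by an
LDU decomposition.

So the integrand of size `n + 1` is a function of `(A, B)` times `u ^ (a - 1) * g (w, s - ζ)` with a
homogeneous kernel `g`. Integration over `s` gives a constant times `w ^ (-κ)`: Cauchy's beta
integral (`cauchyInt_eq`) in the real case, an elementary radial integral (`integral_quatKernel`) in
the other. Integration over `u`, `b`, `y` is then a beta integral (`lintegral_beta`,
`integral_beta`), equal to `π ^ m Γ(a) Γ(κ - m - a) / Γ(κ)` times the Gaussian determinant factor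
`pairWeight A B` of `q`.

That factor is `(det A * det (1 + A) * det N) ^ (d / 2)`, with `d = dim 𝕜` and `N = schurPair A B`.
The product `det (1 + A) * det N` is the squared modulus of the determinant of `1 + A + iB`, or the
square of that of `1 + A + Bj`. Hence `pairWeight` is itself a power product of the determinants in
the integrand, and what is left is the integrand of size `n` with all parameters shifted by
constants (`realIntegrand_border`, `quatIntegrand_border`).

Convergence needs no separate estimate. The recursion holds for the integral of the norm in `[0, ∞]`
(`PairRecursion.lintegral`), all factors are nonzero, and so the integral is finite exactly when
each factor is (`mul_betaConst_ne_top_iff`). The same recursion for the Bochner integral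
(`PairRecursion.integral`) gives the value. -/

/-- The square matrix obtained from `A` by adding a last column `b`, a last row `b'` and a last
diagonal entry `c`. -/
def border {α : Type*} {n : ℕ} (A : Matrix (Fin n) (Fin n) α) (b b' : Fin n → α) (c : α) :
    Matrix (Fin (n + 1)) (Fin (n + 1)) α :=
  Matrix.of (Fin.snoc (α := fun _ => Fin (n + 1) → α)
    (fun i => Fin.snoc (α := fun _ => α) (A i) (b i)) (Fin.snoc (α := fun _ => α) b' c))

/-! ### Bordered matrices and Schur complements -/

section Border

variable {α : Type*} {n : ℕ} (A A' : Matrix (Fin n) (Fin n) α) (b b' d d' : Fin n → α) (c e : α)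

@[simp] theorem border_castSucc_castSucc (i j : Fin n) :
    border A b b' c i.castSucc j.castSucc = A i j := by simp [border]

@[simp] theorem border_castSucc_last (i : Fin n) :
    border A b b' c i.castSucc (Fin.last n) = b i := by simp [border]

@[simp] theorem border_last_castSucc (j : Fin n) :
    border A b b' c (Fin.last n) j.castSucc = b' j := by simp [border]

@[simp] theorem border_last_last :
    border A b b' c (Fin.last n) (Fin.last n) = c := by simp [border]

theorem eq_border (M : Matrix (Fin (n + 1)) (Fin (n + 1)) α) :
    M = border (M.submatrix Fin.castSucc Fin.castSucc) (fun i => M i.castSucc (Fin.last n))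
      (fun j => M (Fin.last n) j.castSucc) (M (Fin.last n) (Fin.last n)) := by
  ext i j
  refine Fin.lastCases ?_ (fun i => ?_) i <;> refine Fin.lastCases ?_ (fun j => ?_) j <;> simp

theorem border_ext {M : Matrix (Fin (n + 1)) (Fin (n + 1)) α}
    (h₁ : ∀ i j, M (Fin.castSucc i) (Fin.castSucc j) = A i j)
    (h₂ : ∀ i, M (Fin.castSucc i) (Fin.last n) = b i)
    (h₃ : ∀ j, M (Fin.last n) (Fin.castSucc j) = b' j)
    (h₄ : M (Fin.last n) (Fin.last n) = c) : M = border A b b' c := by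
  ext i j
  refine Fin.lastCases ?_ (fun i => ?_) i <;> refine Fin.lastCases ?_ (fun j => ?_) j <;>
    simp [h₁, h₂, h₃, h₄]

theorem leadingBlock_border (p : ℕ) (hp : p ≤ n) :
    leadingBlock (border A b b' c) p (hp.trans n.le_succ) = leadingBlock A p hp := by
  ext i j
  exact border_castSucc_castSucc A b b' c (Fin.castLE hp i) (Fin.castLE hp j)

theorem leadingBlock_self (h : n ≤ n) : leadingBlock A n h = A := rfl

theorem border_map {β : Type*} (f : α → β) :
    (border A b b' c).map f = border (A.map f) (f ∘ b) (f ∘ b') (f c) :=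
  border_ext _ _ _ _ (by simp) (by simp) (by simp) (by simp)

theorem transpose_border : (border A b b' c)ᵀ = border Aᵀ b' b c :=
  border_ext _ _ _ _ (by simp) (by simp) (by simp) (by simp)

theorem conjTranspose_border [Star α] :
    (border A b b' c)ᴴ = border Aᴴ (star b') (star b) (star c) :=
  border_ext _ _ _ _ (by simp) (by simp) (by simp) (by simp)

theorem border_injective {A A' : Matrix (Fin n) (Fin n) α} {b b' d d' : Fin n → α} {c e : α}
    (h : border A b b' c = border A' d d' e) : A = A' ∧ b = d ∧ b' = d' ∧ c = e := by
  refine ⟨?_, ?_, ?_, ?_⟩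
  · ext i j; simpa using congrFun (congrFun h i.castSucc) j.castSucc
  · ext i; simpa using congrFun (congrFun h i.castSucc) (Fin.last n)
  · ext j; simpa using congrFun (congrFun h (Fin.last n)) j.castSucc
  · simpa using congrFun (congrFun h (Fin.last n)) (Fin.last n)

theorem one_add_border [AddMonoidWithOne α] :
    1 + border A b b' c = border (1 + A) b b' (1 + c) := by
  refine border_ext _ _ _ _ (fun i j => ?_) (fun i => ?_) (fun j => ?_) ?_ <;>
    simp [Matrix.one_apply, (Fin.castSucc_lt_last _).ne, (Fin.castSucc_lt_last _).ne']

theorem border_mul [NonUnitalNonAssocSemiring α] :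
    border A b b' c * border A' d d' e =
      border (A * A' + vecMulVec b d') (A *ᵥ d + fun i => b i * e) (b' ᵥ* A' + fun j => c * d' j)
        (b' ⬝ᵥ d + c * e) := by
  refine border_ext _ _ _ _ (fun i j => ?_) (fun i => ?_) (fun j => ?_) ?_ <;>
    simp [Matrix.mul_apply, Fin.sum_univ_castSucc, vecMulVec_apply, mulVec, vecMul, dotProduct]

theorem border_mulVec [NonUnitalNonAssocSemiring α] (x : Fin n → α) (t : α) :
    border A b b' c *ᵥ (Fin.snoc x t : Fin (n + 1) → α) =
      (Fin.snoc (A *ᵥ x + fun i => b i * t) (b' ⬝ᵥ x + c * t) : Fin (n + 1) → α) := by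
  ext i
  refine Fin.lastCases ?_ (fun i => ?_) i <;>
    simp [mulVec, Fin.sum_univ_castSucc, dotProduct]

theorem dotProduct_snoc [NonUnitalNonAssocSemiring α] (x y : Fin n → α) (s t : α) :
    (Fin.snoc x s : Fin (n + 1) → α) ⬝ᵥ (Fin.snoc y t : Fin (n + 1) → α) = x ⬝ᵥ y + s * t := by
  simp [Fin.sum_univ_castSucc, dotProduct]

theorem star_snoc [Star α] (x : Fin n → α) (s : α) :
    star (Fin.snoc x s : Fin (n + 1) → α) = (Fin.snoc (star x) (star s) : Fin (n + 1) → α) := by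
  ext i
  refine Fin.lastCases ?_ (fun i => ?_) i <;> simp

/-- The `LDU` decomposition of a bordered matrix. -/
theorem border_eq_mul_mul [Ring α] {A : Matrix (Fin n) (Fin n) α} {b b' z ζ : Fin n → α}
    (hz : A *ᵥ z = b) (hζ : ζ ᵥ* A = b') :
    border A b b' c =
      border 1 0 ζ 1 * border A 0 0 (c - b' ⬝ᵥ z) * border 1 z 0 1 := by
  subst hz hζ
  rw [border_mul, border_mul]
  congr 1
  · ext; simp
  · ext; simp
  · ext; simp
  · simp

theorem det_border_of_row_eq_zero [CommRing α] (z : Fin n → α) (p : α) :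
    (border A z 0 p).det = A.det * p := by
  rw [det_succ_row _ (Fin.last n), Fin.sum_univ_castSucc]
  have : (border A z 0 p).submatrix Fin.castSucc Fin.castSucc = A := by ext; simp
  simp [this, mul_comm, ← two_mul]

/-- A unipotent right factor clears the last column and leaves a block triangular matrix. The form
with a solution `z` in place of an inverse matrix lets the explicitly constructed solutions below be
inserted. -/
theorem det_border [CommRing α] {A : Matrix (Fin n) (Fin n) α} {b z : Fin n → α}
    (hz : A *ᵥ z = b) : (border A b b' c).det = A.det * (c - b' ⬝ᵥ z) := by
  have h : border A b b' c = border A 0 b' (c - b' ⬝ᵥ z) * border 1 z 0 1 := by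
    subst hz
    rw [border_mul]
    congr 1
    · ext; simp
    · ext; simp
    · ext; simp
    · simp
  rw [h, det_mul, det_border_of_row_eq_zero, ← det_transpose, transpose_border,
    det_border_of_row_eq_zero]
  simp

end Border

/-! ### Positive definiteness and quadratic forms of bordered hermitian matrices -/

section Hermitian

variable {𝕜 : Type*} [RCLike 𝕜] {n : ℕ}

theorem Matrix.PosDef.mulVec_inv_mulVec {A : Matrix (Fin n) (Fin n) 𝕜} (hA : A.PosDef)
    (b : Fin n → 𝕜) : A *ᵥ A⁻¹ *ᵥ b = b := by
  rw [mulVec_mulVec, mul_nonsing_inv _ ((isUnit_iff_isUnit_det A).1 hA.isUnit), one_mulVec]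

/-- The quadratic form `z ↦ z* M z` of a hermitian matrix. -/
def quadForm (M : Matrix (Fin n) (Fin n) 𝕜) (z : Fin n → 𝕜) : ℝ :=
  RCLike.re (star z ⬝ᵥ M *ᵥ z)

theorem ofReal_quadForm {M : Matrix (Fin n) (Fin n) 𝕜} (hM : M.IsHermitian) (z : Fin n → 𝕜) :
    (quadForm M z : 𝕜) = star z ⬝ᵥ M *ᵥ z := by
  rw [quadForm, ← RCLike.conj_eq_iff_re, RCLike.conj_eq_iff_im,
    hM.im_star_dotProduct_mulVec_self]

/-- Completing the square in the first block of variables; what remains in the last variable is the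
pivot. -/
theorem star_dotProduct_border_mulVec {A : Matrix (Fin n) (Fin n) 𝕜} (hA : A.PosDef)
    (b x : Fin n → 𝕜) (c t : 𝕜) :
    star (Fin.snoc x t : Fin (n + 1) → 𝕜) ⬝ᵥ
        border A b (star b) c *ᵥ (Fin.snoc x t : Fin (n + 1) → 𝕜) =
      star (x + t • A⁻¹ *ᵥ b) ⬝ᵥ A *ᵥ (x + t • A⁻¹ *ᵥ b) +
        star t * (c - star b ⬝ᵥ A⁻¹ *ᵥ b) * t := by
  have hz := hA.mulVec_inv_mulVec b
  generalize A⁻¹ *ᵥ b = z at hz ⊢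
  subst hz
  have h1 : ∀ y, star (A *ᵥ z) ⬝ᵥ y = star z ⬝ᵥ A *ᵥ y := fun y => by
    rw [star_mulVec, hA.isHermitian.eq, dotProduct_mulVec]
  rw [border_mulVec, star_snoc, dotProduct_snoc, h1, h1]
  have h2 : (fun i => (A *ᵥ z) i * t) = t • (A *ᵥ z) := by ext; simp [mul_comm]
  simp only [h2, mulVec_add, mulVec_smul, star_add, star_smul, add_dotProduct, dotProduct_add,
    smul_dotProduct, dotProduct_smul, smul_eq_mul]
  ring

theorem posDef_border_iff {A : Matrix (Fin n) (Fin n) 𝕜} {b : Fin n → 𝕜} {c : ℝ} :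
    (border A b (star b) (c : 𝕜)).PosDef ↔ A.PosDef ∧ quadForm A⁻¹ b < c := by
  have hsub : (border A b (star b) (c : 𝕜)).submatrix Fin.castSucc Fin.castSucc = A := by ext; simp
  constructor
  · intro h
    have hA : A.PosDef := by
      have := h.submatrix (e := Fin.castSucc) (Fin.castSucc_injective n)
      rwa [hsub] at this
    refine ⟨hA, ?_⟩
    -- At the vector `(-A⁻¹ b, 1)` the completed square vanishes and the form equals the pivot.
    have h1 := h.dotProduct_mulVec_pos
      (x := (Fin.snoc (-(A⁻¹ *ᵥ b)) 1 : Fin (n + 1) → 𝕜)) (fun h0 => by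
        simpa using congrFun h0 (Fin.last n))
    rw [star_dotProduct_border_mulVec hA, ← ofReal_quadForm hA.inv.isHermitian] at h1
    simp only [one_smul, neg_add_cancel, star_zero, zero_dotProduct, zero_add, star_one, one_mul,
      mul_one] at h1
    rw [← RCLike.ofReal_sub, RCLike.ofReal_pos] at h1
    linarith
  · rintro ⟨hA, h⟩
    rw [posDef_iff_dotProduct_mulVec]
    refine ⟨?_, fun x hx => ?_⟩
    · rw [IsHermitian, conjTranspose_border, hA.isHermitian.eq]
      simp
    · obtain ⟨y, t, rfl⟩ : ∃ (y : Fin n → 𝕜) (t : 𝕜), x = (Fin.snoc y t : Fin (n + 1) → 𝕜) :=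
        ⟨_, _, (Fin.snoc_init_self x).symm⟩
      rw [star_dotProduct_border_mulVec hA, ← ofReal_quadForm hA.inv.isHermitian,
        ← RCLike.ofReal_sub, mul_right_comm]
      by_cases ht : t = 0
      · subst ht
        have hy : y ≠ 0 := by
          rintro rfl
          apply hx
          ext i
          refine Fin.lastCases ?_ (fun i => ?_) i <;> simp
        simpa using hA.dotProduct_mulVec_pos hy
      · refine add_pos_of_nonneg_of_pos (hA.posSemidef.dotProduct_mulVec_nonneg _) ?_
        refine mul_pos ?_ (RCLike.ofReal_pos.2 (by linarith))
        rw [RCLike.star_def, RCLike.conj_mul]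
        exact_mod_cast pow_pos (norm_pos_iff.2 ht) 2

theorem quadForm_border {A : Matrix (Fin n) (Fin n) 𝕜} (hA : A.PosDef)
    (b x : Fin n → 𝕜) (c : ℝ) (t : 𝕜) :
    quadForm (border A b (star b) (c : 𝕜)) (Fin.snoc x t : Fin (n + 1) → 𝕜) =
      quadForm A (x + t • A⁻¹ *ᵥ b) + (c - quadForm A⁻¹ b) * ‖t‖ ^ 2 := by
  rw [quadForm, star_dotProduct_border_mulVec hA, ← ofReal_quadForm hA.inv.isHermitian,
    ← RCLike.ofReal_sub, mul_right_comm, RCLike.star_def, RCLike.conj_mul, map_add]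
  congr 1
  rw [mul_comm]
  norm_cast

theorem det_border_eq {A : Matrix (Fin n) (Fin n) 𝕜} (hA : A.PosDef) (b : Fin n → 𝕜) (c : ℝ) :
    (border A b (star b) (c : 𝕜)).det = A.det * ((c - quadForm A⁻¹ b : ℝ) : 𝕜) := by
  rw [det_border (star b) c (hA.mulVec_inv_mulVec b), RCLike.ofReal_sub,
    ofReal_quadForm hA.inv.isHermitian]

theorem quadForm_nonneg {M : Matrix (Fin n) (Fin n) 𝕜} (hM : M.PosSemidef) (z : Fin n → 𝕜) :
    0 ≤ quadForm M z :=
  (RCLike.nonneg_iff.1 (hM.dotProduct_mulVec_nonneg z)).1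

/-- The real number that is the determinant of a positive definite matrix. -/
def reDet (M : Matrix (Fin n) (Fin n) 𝕜) : ℝ := RCLike.re M.det

theorem ofReal_reDet {M : Matrix (Fin n) (Fin n) 𝕜} (hM : M.PosDef) : (reDet M : 𝕜) = M.det := by
  have := RCLike.pos_iff.1 hM.det_pos
  apply RCLike.ext <;> simp [reDet, this.2]

theorem reDet_pos {M : Matrix (Fin n) (Fin n) 𝕜} (hM : M.PosDef) : 0 < reDet M :=
  (RCLike.pos_iff.1 hM.det_pos).1

theorem reDet_border {A : Matrix (Fin n) (Fin n) 𝕜} (hA : A.PosDef) (b : Fin n → 𝕜) (c : ℝ) :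
    reDet (border A b (star b) (c : 𝕜)) = reDet A * (c - quadForm A⁻¹ b) := by
  rw [reDet, det_border_eq hA, RCLike.re_mul_ofReal, reDet]

end Hermitian

/-! ### The last pivot of `1 + T + S j`, uniformly over `ℝ` and `ℂ` -/

section Pair

variable {𝕜 : Type*} [RCLike 𝕜] {n : ℕ}

theorem posDef_one_add {A : Matrix (Fin n) (Fin n) 𝕜} (hA : A.PosDef) : (1 + A).PosDef :=
  PosDef.one.add hA

theorem posDef_add_mul_self {A : Matrix (Fin n) (Fin n) 𝕜} (hA : A.PosDef) :
    (A + A * A).PosDef := by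
  refine hA.add_posSemidef ?_
  have := posSemidef_conjTranspose_mul_self A
  rwa [hA.isHermitian.eq] at this

theorem self_add_mul_self_eq (A : Matrix (Fin n) (Fin n) 𝕜) : A + A * A = A * (1 + A) := by
  rw [mul_add, mul_one]

/-- The partial fraction `1/(x(1+x)) = 1/x - 1/(1+x)`. It turns the difference of `b* A⁻¹ b`, coming
from the pivot of `T`, and `b* (1 + A)⁻¹ b`, coming from the pivot of `1 + T + S j`, into one
positive definite form. -/
theorem inv_add_mul_self {A : Matrix (Fin n) (Fin n) 𝕜} (hA : A.PosDef) :
    (A + A * A)⁻¹ = A⁻¹ - (1 + A)⁻¹ := by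
  have h1 := (isUnit_iff_isUnit_det A).1 hA.isUnit
  have h2 := (isUnit_iff_isUnit_det (1 + A)).1 (posDef_one_add hA).isUnit
  refine inv_eq_left_inv ?_
  have h3 : A⁻¹ * A = 1 := nonsing_inv_mul _ h1
  have h4 : (1 + A)⁻¹ * (1 + A) = 1 := nonsing_inv_mul _ h2
  have h5 : A * (1 + A) = (1 + A) * A := by rw [mul_add, add_mul, mul_one, one_mul]
  rw [sub_mul, self_add_mul_self_eq, ← mul_assoc, h3, one_mul, h5, ← mul_assoc, h4, one_mul,
    add_sub_cancel_right]

theorem quadForm_sub (M M' : Matrix (Fin n) (Fin n) 𝕜) (z : Fin n → 𝕜) :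
    quadForm (M - M') z = quadForm M z - quadForm M' z := by
  simp [quadForm, sub_mulVec, dotProduct_sub]

/-- For `C = 1 + A`, the hermitian matrix `C + B (conj C)⁻¹ B*`. -/
def schurPair (A B : Matrix (Fin n) (Fin n) 𝕜) : Matrix (Fin n) (Fin n) 𝕜 :=
  (1 + A) + B * ((1 + A)ᵀ)⁻¹ * Bᴴ

/-- For `C = 1 + A`, the vector `B (conj C)⁻¹ (conj b)`. -/
def shiftVec (A B : Matrix (Fin n) (Fin n) 𝕜) (b : Fin n → 𝕜) : Fin n → 𝕜 :=
  B *ᵥ ((1 + A)ᵀ)⁻¹ *ᵥ star b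

/-- The second component of the solution `z₁ + z₂ j` of `(1 + A + B j) (z₁ + z₂ j) = b + y j`. -/
def solSnd (A B : Matrix (Fin n) (Fin n) 𝕜) (b y : Fin n → 𝕜) : Fin n → 𝕜 :=
  (schurPair A B)⁻¹ *ᵥ (y - shiftVec A B b)

/-- The first component of the solution `z₁ + z₂ j` of `(1 + A + B j) (z₁ + z₂ j) = b + y j`. -/
def solFst (A B : Matrix (Fin n) (Fin n) 𝕜) (b y : Fin n → 𝕜) : Fin n → 𝕜 :=
  (1 + A)⁻¹ *ᵥ (b + B *ᵥ star (solSnd A B b y))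

/-- The shift of the last diagonal entry of `S` in the last pivot of `1 + T + S j`. -/
def pivotShift (A B : Matrix (Fin n) (Fin n) 𝕜) (b y : Fin n → 𝕜) : 𝕜 :=
  star b ⬝ᵥ solSnd A B b y + y ⬝ᵥ star (solFst A B b y)

/-- The positive definite form in the last columns of `T` and `S` that enters the last pivot of
`1 + T + S j`. -/
def pivotForm (A B : Matrix (Fin n) (Fin n) 𝕜) (b y : Fin n → 𝕜) : ℝ :=
  quadForm (A + A * A)⁻¹ b + quadForm (schurPair A B)⁻¹ (y - shiftVec A B b)

theorem posDef_schurPair {A : Matrix (Fin n) (Fin n) 𝕜} (hA : A.PosDef)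
    (B : Matrix (Fin n) (Fin n) 𝕜) : (schurPair A B).PosDef :=
  (posDef_one_add hA).add_posSemidef
    ((posDef_one_add hA).transpose.inv.posSemidef.mul_mul_conjTranspose_same B)

theorem pivotForm_nonneg {A : Matrix (Fin n) (Fin n) 𝕜} (hA : A.PosDef)
    (B : Matrix (Fin n) (Fin n) 𝕜) (b y : Fin n → 𝕜) : 0 ≤ pivotForm A B b y :=
  add_nonneg (quadForm_nonneg (posDef_add_mul_self hA).inv.posSemidef _)
    (quadForm_nonneg (posDef_schurPair hA B).inv.posSemidef _)

theorem mulVec_solFst {A : Matrix (Fin n) (Fin n) 𝕜} (hA : A.PosDef)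
    (B : Matrix (Fin n) (Fin n) 𝕜) (b y : Fin n → 𝕜) :
    (1 + A) *ᵥ solFst A B b y = b + B *ᵥ star (solSnd A B b y) :=
  (posDef_one_add hA).mulVec_inv_mulVec _

theorem star_mulVec_of_isHermitian {C : Matrix (Fin n) (Fin n) 𝕜} (hC : C.IsHermitian)
    (v : Fin n → 𝕜) : star (C *ᵥ v) = Cᵀ *ᵥ star v := by
  rw [star_mulVec, hC.eq, mulVec_transpose]

theorem star_mulVec_of_isSymm {B : Matrix (Fin n) (Fin n) 𝕜} (hB : B.IsSymm)
    (v : Fin n → 𝕜) : star (B *ᵥ v) = Bᴴ *ᵥ star v := by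
  have h : Bᴴᵀ = Bᴴ := by ext i j; simp [conjTranspose_apply, hB.apply]
  rw [star_mulVec, ← mulVec_transpose, h]

theorem star_solFst {A B : Matrix (Fin n) (Fin n) 𝕜} (hA : A.PosDef) (hB : B.IsSymm)
    (b y : Fin n → 𝕜) :
    star (solFst A B b y) = ((1 + A)ᵀ)⁻¹ *ᵥ (star b + Bᴴ *ᵥ solSnd A B b y) := by
  rw [solFst, star_mulVec_of_isHermitian (posDef_one_add hA).inv.isHermitian,
    transpose_nonsing_inv, star_add, star_mulVec_of_isSymm hB, star_star]

theorem mulVec_solSnd {A : Matrix (Fin n) (Fin n) 𝕜} (hA : A.PosDef)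
    (B : Matrix (Fin n) (Fin n) 𝕜) (b y : Fin n → 𝕜) :
    schurPair A B *ᵥ solSnd A B b y = y - shiftVec A B b :=
  (posDef_schurPair hA B).mulVec_inv_mulVec _

/-- Together with `mulVec_solFst` this is the system `(1 + A + B j) (z₁ + z₂ j) = b + y j` split
into components. Eliminating `z₁` leaves an equation for `z₂` whose matrix is the Schur complement
`schurPair A B`; the symmetry of `B` makes its conjugate equal to `Bᴴ`. -/
theorem mulVec_solSnd_add {A B : Matrix (Fin n) (Fin n) 𝕜} (hA : A.PosDef) (hB : B.IsSymm)
    (b y : Fin n → 𝕜) :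
    (1 + A) *ᵥ solSnd A B b y + B *ᵥ star (solFst A B b y) = y := by
  have h := mulVec_solSnd hA B b y
  rw [schurPair, add_mulVec, ← mulVec_mulVec, ← mulVec_mulVec, shiftVec] at h
  rw [star_solFst hA hB, mulVec_add, mulVec_add]
  linear_combination (exp := 1) h

/-- The cross terms in `b` and `z₂` combine with the part linear in `y` into the pairing of `y -
shiftVec A B b` with `z₂`, which is the form of `N⁻¹` at this vector, `N = schurPair A B`. So the
first component of the pivot is `1 + u` plus a nonnegative quantity, where `u` is the pivot of `T`.
-/
theorem pivotForm_eq {A B : Matrix (Fin n) (Fin n) 𝕜} (hA : A.PosDef) (hB : B.IsSymm)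
    (b y : Fin n → 𝕜) (c : ℝ) :
    ((1 + (c - quadForm A⁻¹ b) + pivotForm A B b y : ℝ) : 𝕜) =
      1 + c - (star b ⬝ᵥ solFst A B b y - y ⬝ᵥ star (solSnd A B b y)) := by
  have hC := posDef_one_add hA
  have hN := posDef_schurPair hA B
  have h1 : star b ⬝ᵥ solFst A B b y = star b ⬝ᵥ (1 + A)⁻¹ *ᵥ b +
      star b ⬝ᵥ (1 + A)⁻¹ *ᵥ B *ᵥ star (solSnd A B b y) := by
    rw [solFst, mulVec_add, dotProduct_add]
  have h2 : shiftVec A B b ⬝ᵥ star (solSnd A B b y) =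
      star b ⬝ᵥ (1 + A)⁻¹ *ᵥ B *ᵥ star (solSnd A B b y) := by
    rw [shiftVec, ← vecMul_transpose, ← dotProduct_mulVec, hB.eq, ← vecMul_transpose,
      ← dotProduct_mulVec, ← transpose_nonsing_inv, transpose_transpose]
  have h3 : (y - shiftVec A B b) ⬝ᵥ star (solSnd A B b y) =
      (quadForm (schurPair A B)⁻¹ (y - shiftVec A B b) : 𝕜) := by
    rw [ofReal_quadForm hN.inv.isHermitian, solSnd, dotProduct_comm, star_mulVec,
      hN.inv.isHermitian.eq, dotProduct_mulVec]
  rw [sub_dotProduct, h2] at h3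
  rw [pivotForm, inv_add_mul_self hA, quadForm_sub, h1]
  have h4 := ofReal_quadForm hC.inv.isHermitian b
  push_cast
  linear_combination -h4 - h3

end Pair

/-! ### Gamma integrals with values in `[0, ∞]` -/

section Gamma

open Set Real ENNReal

theorem lintegral_ofReal_eq_top {α : Type*} [MeasurableSpace α] {μ : Measure α} {f : α → ℝ}
    (hm : AEStronglyMeasurable f μ) (h0 : 0 ≤ᵐ[μ] f) (hf : ¬ Integrable f μ) :
    ∫⁻ x, ENNReal.ofReal (f x) ∂μ = ∞ := by
  by_contra h
  exact hf ⟨hm, (hasFiniteIntegral_iff_ofReal h0).2 (lt_top_iff_ne_top.2 h)⟩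

/-- No power is integrable both at zero and at infinity. This settles the beta integral when `κ ≤
0`. -/
theorem lintegral_Ioi_rpow (s : ℝ) : ∫⁻ x in Ioi (0 : ℝ), ENNReal.ofReal (x ^ s) = ∞ :=
  lintegral_ofReal_eq_top (by fun_prop)
    (ae_restrict_of_forall_mem measurableSet_Ioi fun _ hx => rpow_nonneg (le_of_lt hx) _)
    (not_integrableOn_Ioi_rpow s)

theorem integrableOn_rpow_mul_exp {a r : ℝ} (ha : 0 < a) (hr : 0 < r) :
    IntegrableOn (fun x => x ^ (a - 1) * exp (-(r * x))) (Ioi 0) := by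
  refine Integrable.of_integral_ne_zero ?_
  rw [integral_rpow_mul_exp_neg_mul_Ioi ha hr]
  have := Gamma_pos_of_pos ha
  positivity

theorem lintegral_rpow_mul_exp {a r : ℝ} (ha : 0 < a) (hr : 0 < r) :
    ∫⁻ x in Ioi (0 : ℝ), ENNReal.ofReal (x ^ (a - 1) * exp (-(r * x))) =
      ENNReal.ofReal (Gamma a * r ^ (-a)) := by
  rw [← ofReal_integral_eq_lintegral_ofReal (integrableOn_rpow_mul_exp ha hr),
    integral_rpow_mul_exp_neg_mul_Ioi ha hr, one_div, inv_rpow hr.le, rpow_neg hr.le, mul_comm]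
  exact ae_restrict_of_forall_mem measurableSet_Ioi fun x hx =>
    mul_nonneg (rpow_nonneg (le_of_lt hx) _) (exp_pos _).le

theorem lintegral_rpow_mul_exp_of_nonpos {a r : ℝ} (ha : a ≤ 0) (hr : 0 < r) :
    ∫⁻ x in Ioi (0 : ℝ), ENNReal.ofReal (x ^ (a - 1) * exp (-(r * x))) = ∞ := by
  have h1 : ∫⁻ x in Ioo (0 : ℝ) 1, ENNReal.ofReal (x ^ (a - 1)) = ∞ := by
    refine lintegral_ofReal_eq_top (by fun_prop)
      (ae_restrict_of_forall_mem measurableSet_Ioo fun x hx => rpow_nonneg hx.1.le _) ?_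
    rw [← IntegrableOn, intervalIntegral.integrableOn_Ioo_rpow_iff one_pos]
    linarith
  rw [eq_top_iff]
  calc ∞ = ∫⁻ x in Ioo (0 : ℝ) 1, ENNReal.ofReal (exp (-r)) * ENNReal.ofReal (x ^ (a - 1)) := by
        rw [lintegral_const_mul _ (by fun_prop), h1, ENNReal.mul_top]
        simpa using exp_pos (-r)
    _ ≤ ∫⁻ x in Ioo (0 : ℝ) 1, ENNReal.ofReal (x ^ (a - 1) * exp (-(r * x))) := by
        refine setLIntegral_mono (by fun_prop) fun x hx => ?_
        rw [← ENNReal.ofReal_mul (exp_pos _).le, mul_comm]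
        refine ENNReal.ofReal_le_ofReal ?_
        have := rpow_nonneg hx.1.le (a - 1)
        gcongr
        nlinarith [hx.2]
    _ ≤ _ := lintegral_mono_set fun x hx => hx.1

end Gamma

/-! ### The beta integral `∫ u ^ (a - 1) (1 + u + q(v)) ^ (-κ)` -/

section Mixed

open Set Real ENNReal

variable {V : Type*} [MeasurableSpace V] {μ : Measure V}

/-- The value of the beta-type integral `∫ u ^ (a - 1) (1 + u + q(v)) ^ (-κ) du dv`, for a
quadratic form `q` in `2 m` variables, up to the determinant of `q`. -/
def betaConst (a κ m : ℝ) : ℝ≥0∞ :=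
  if 0 < a ∧ 0 < κ - m - a then ENNReal.ofReal (π ^ m * Gamma a * Gamma (κ - m - a) / Gamma κ)
  else ∞

theorem betaConst_lt_top_iff {a κ m : ℝ} : betaConst a κ m < ∞ ↔ 0 < a ∧ 0 < κ - m - a := by
  unfold betaConst
  split_ifs with h
  · exact iff_of_true ENNReal.ofReal_lt_top h
  · exact iff_of_false (lt_irrefl _) h

theorem betaConst_ne_zero {a κ m : ℝ} (hm : 0 ≤ m) : betaConst a κ m ≠ 0 := by
  unfold betaConst
  split_ifs with h
  · have h1 := Gamma_pos_of_pos h.1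
    have h2 := Gamma_pos_of_pos h.2
    have h3 := Gamma_pos_of_pos (show 0 < κ by linarith)
    have : 0 < π ^ m * Gamma a * Gamma (κ - m - a) / Gamma κ := by positivity
    simpa using this
  · simp

theorem ae_restrict_prod_pos :
    ∀ᵐ p ∂(μ.prod (volume.restrict (Ioi (0 : ℝ)))), 0 < p.2 :=
  Measure.quasiMeasurePreserving_snd.ae (ae_restrict_mem measurableSet_Ioi)

variable {q : V → ℝ} {m D : ℝ}

/-- The beta integral after a Gamma integral has been inserted for the power of `1 + u + q`. For
fixed `x` the variables `u` and `v` separate into a Gamma and a Gaussian integral, and the remaining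
power of `x` gives the last Gamma factor. All that is used of `q` besides measurability is its
Gaussian integral. -/
theorem lintegral_mixed (hq : Measurable q)
    (hgauss : ∀ t : ℝ, 0 < t →
      ∫⁻ v, ENNReal.ofReal (exp (-(t * q v))) ∂μ = ENNReal.ofReal ((π / t) ^ m * D))
    (hD : 0 < D) (a κ : ℝ) :
    ∫⁻ x in Ioi (0 : ℝ), ∫⁻ p, ENNReal.ofReal (p.2 ^ (a - 1) * exp (-(x * p.2))) *
        ENNReal.ofReal (exp (-(x * q p.1))) * ENNReal.ofReal (x ^ (κ - 1) * exp (-x))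
        ∂(μ.prod (volume.restrict (Ioi (0 : ℝ)))) =
      if 0 < a ∧ 0 < κ - m - a then
        ENNReal.ofReal (D * (π ^ m * Gamma a * Gamma (κ - m - a))) else ∞ := by
  have h1 : ∀ x ∈ Ioi (0 : ℝ), ∫⁻ p, ENNReal.ofReal (p.2 ^ (a - 1) * exp (-(x * p.2))) *
        ENNReal.ofReal (exp (-(x * q p.1))) * ENNReal.ofReal (x ^ (κ - 1) * exp (-x))
        ∂(μ.prod (volume.restrict (Ioi (0 : ℝ)))) =
      (∫⁻ u in Ioi (0 : ℝ), ENNReal.ofReal (u ^ (a - 1) * exp (-(x * u)))) *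
        ENNReal.ofReal (π ^ m * D * (x ^ (κ - m - 1) * exp (-x))) := by
    intro x (hx : 0 < x)
    rw [lintegral_mul_const _ (by fun_prop)]
    simp_rw [mul_comm (ENNReal.ofReal (_ * _)) (ENNReal.ofReal (exp (-(x * q _))))]
    rw [lintegral_prod_mul (f := fun v => ENNReal.ofReal (exp (-(x * q v))))
      (g := fun u => ENNReal.ofReal (u ^ (a - 1) * exp (-(x * u)))) (by fun_prop) (by fun_prop),
      hgauss x hx, mul_comm (ENNReal.ofReal _),
      mul_assoc, ← ENNReal.ofReal_mul (by positivity)]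
    congr 2
    rw [div_rpow pi_pos.le hx.le, show κ - m - 1 = (κ - 1) - m by ring, rpow_sub hx _ m]
    ring
  rw [setLIntegral_congr_fun measurableSet_Ioi h1]
  by_cases ha : 0 < a
  · have h2 : ∀ x ∈ Ioi (0 : ℝ),
        (∫⁻ u in Ioi (0 : ℝ), ENNReal.ofReal (u ^ (a - 1) * exp (-(x * u)))) *
        ENNReal.ofReal (π ^ m * D * (x ^ (κ - m - 1) * exp (-x))) =
        ENNReal.ofReal (π ^ m * D * Gamma a) *
          ENNReal.ofReal (x ^ (κ - m - a - 1) * exp (-(1 * x))) := by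
      intro x (hx : 0 < x)
      have hG := Gamma_pos_of_pos ha
      rw [lintegral_rpow_mul_exp ha hx, ← ENNReal.ofReal_mul (by positivity),
        ← ENNReal.ofReal_mul (by positivity)]
      congr 1
      rw [show κ - m - a - 1 = (κ - m - 1) + (-a) by ring, rpow_add hx, one_mul]
      ring
    have hG := Gamma_pos_of_pos ha
    rw [setLIntegral_congr_fun measurableSet_Ioi h2, lintegral_const_mul _ (by fun_prop)]
    by_cases hb : 0 < κ - m - a
    · rw [if_pos ⟨ha, hb⟩, lintegral_rpow_mul_exp hb one_pos,
        ← ENNReal.ofReal_mul (by positivity), Real.one_rpow]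
      congr 1
      ring
    · rw [if_neg (fun h => hb h.2), lintegral_rpow_mul_exp_of_nonpos (not_lt.1 hb) one_pos,
        ENNReal.mul_top]
      simp only [ne_eq, ofReal_eq_zero, not_le]
      positivity
  · rw [if_neg (fun h => ha h.1)]
    have h2 : ∀ x ∈ Ioi (0 : ℝ),
        (∫⁻ u in Ioi (0 : ℝ), ENNReal.ofReal (u ^ (a - 1) * exp (-(x * u)))) *
        ENNReal.ofReal (π ^ m * D * (x ^ (κ - m - 1) * exp (-x))) = ∞ := by
      intro x (hx : 0 < x)
      rw [lintegral_rpow_mul_exp_of_nonpos (not_lt.1 ha) hx, ENNReal.top_mul]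
      simp only [ne_eq, ofReal_eq_zero, not_le]
      positivity
    rw [setLIntegral_congr_fun measurableSet_Ioi h2]
    simp

variable [SFinite μ]

theorem lintegral_beta (hq : Measurable q) (hq0 : ∀ v, 0 ≤ q v)
    (hgauss : ∀ t : ℝ, 0 < t →
      ∫⁻ v, ENNReal.ofReal (exp (-(t * q v))) ∂μ = ENNReal.ofReal ((π / t) ^ m * D))
    (hD : 0 < D) (hm : 0 ≤ m) (a κ : ℝ) :
    ∫⁻ p, ENNReal.ofReal (p.2 ^ (a - 1)) * ENNReal.ofReal ((1 + p.2 + q p.1) ^ (-κ))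
        ∂(μ.prod (volume.restrict (Ioi (0 : ℝ)))) = ENNReal.ofReal D * betaConst a κ m := by
  by_cases hκ : 0 < κ
  · have hG := Gamma_pos_of_pos hκ
    have h1 : ∫⁻ p, ENNReal.ofReal (p.2 ^ (a - 1)) * ENNReal.ofReal ((1 + p.2 + q p.1) ^ (-κ))
        ∂(μ.prod (volume.restrict (Ioi (0 : ℝ)))) =
        ∫⁻ p, (∫⁻ x in Ioi (0 : ℝ), ENNReal.ofReal (Gamma κ)⁻¹ *
          (ENNReal.ofReal (p.2 ^ (a - 1) * exp (-(x * p.2))) *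
          ENNReal.ofReal (exp (-(x * q p.1))) * ENNReal.ofReal (x ^ (κ - 1) * exp (-x))))
          ∂(μ.prod (volume.restrict (Ioi (0 : ℝ)))) := by
      refine lintegral_congr_ae ?_
      filter_upwards [ae_restrict_prod_pos] with p hp
      have hw : 0 < 1 + p.2 + q p.1 := by linarith [hq0 p.1]
      have h2 : ∀ x ∈ Ioi (0 : ℝ), ENNReal.ofReal (Gamma κ)⁻¹ *
          (ENNReal.ofReal (p.2 ^ (a - 1) * exp (-(x * p.2))) *
          ENNReal.ofReal (exp (-(x * q p.1))) * ENNReal.ofReal (x ^ (κ - 1) * exp (-x))) =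
          ENNReal.ofReal ((Gamma κ)⁻¹ * p.2 ^ (a - 1)) *
            ENNReal.ofReal (x ^ (κ - 1) * exp (-((1 + p.2 + q p.1) * x))) := by
        intro x (hx : 0 < x)
        rw [← ENNReal.ofReal_mul (by positivity), ← ENNReal.ofReal_mul (by positivity),
          ← ENNReal.ofReal_mul (by positivity), ← ENNReal.ofReal_mul (by positivity)]
        congr 1
        rw [show -((1 + p.2 + q p.1) * x) = -(x * p.2) + -(x * q p.1) + -x by ring, exp_add,
          exp_add]
        ring
      rw [setLIntegral_congr_fun measurableSet_Ioi h2, lintegral_const_mul _ (by fun_prop),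
        lintegral_rpow_mul_exp hκ hw, ← ENNReal.ofReal_mul (by positivity),
        ← ENNReal.ofReal_mul (by positivity)]
      congr 1
      field_simp
    rw [h1, lintegral_lintegral_swap]
    · rw [lintegral_congr fun x => lintegral_const_mul _ (by fun_prop),
        lintegral_const_mul' _ _ (by simp), lintegral_mixed hq hgauss hD]
      unfold betaConst
      split_ifs with h
      · rw [← ENNReal.ofReal_mul (by positivity), ← ENNReal.ofReal_mul hD.le]
        congr 1
        ring
      · rw [ENNReal.mul_top (by simpa using hG), ENNReal.mul_top (by simpa using hD)]
    · fun_prop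
  -- For `κ ≤ 0` the power of `1 + u + q` is at least `1`, and the divergence of `∫ u ^ (a - 1) du`
  -- suffices. The Gaussian hypothesis ensures that `μ` is nonzero.
  · have h1 : betaConst a κ m = ∞ := by
      unfold betaConst
      rw [if_neg]
      intro h
      linarith [h.1, h.2]
    have hμ : μ ≠ 0 := by
      rintro rfl
      have := hgauss 1 one_pos
      rw [lintegral_zero_measure, eq_comm, ENNReal.ofReal_eq_zero] at this
      have : 0 < (π / 1) ^ m * D := by positivity
      linarith
    rw [h1, ENNReal.mul_top (by simpa using hD), eq_top_iff]
    calc ∞ = ∫⁻ p, (1 : V → ℝ≥0∞) p.1 * ENNReal.ofReal (p.2 ^ (a - 1))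
          ∂(μ.prod (volume.restrict (Ioi (0 : ℝ)))) := by
          rw [lintegral_prod_mul (f := 1) (g := fun u : ℝ => ENNReal.ofReal (u ^ (a - 1)))
            aemeasurable_const (by fun_prop), lintegral_Ioi_rpow, ENNReal.mul_top]
          simpa using hμ
      _ ≤ _ := by
          refine lintegral_mono_ae ?_
          filter_upwards [ae_restrict_prod_pos] with p hp
          rw [mul_comm]
          gcongr
          rw [Pi.one_apply, ← ENNReal.ofReal_one]
          exact ENNReal.ofReal_le_ofReal
            (one_le_rpow (by linarith [hq0 p.1]) (by linarith))

/-- The computation of `lintegral_beta` with complex exponents; `lintegral_mixed` at the real parts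
of the exponents supplies the absolute integrability that Fubini's theorem needs. -/
theorem integral_beta (hq : Measurable q) (hq0 : ∀ v, 0 ≤ q v)
    (hgauss : ∀ t : ℝ, 0 < t →
      ∫⁻ v, ENNReal.ofReal (exp (-(t * q v))) ∂μ = ENNReal.ofReal ((π / t) ^ m * D))
    (hD : 0 < D) (hm : 0 ≤ m) {a κ : ℂ} (ha : 0 < a.re) (hb : 0 < κ.re - m - a.re) :
    ∫ p, ((p.2 : ℝ) : ℂ) ^ (a - 1) * ((1 + p.2 + q p.1 : ℝ) : ℂ) ^ (-κ)
        ∂(μ.prod (volume.restrict (Ioi (0 : ℝ)))) =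
      D * ((π : ℂ) ^ (m : ℂ) * Complex.Gamma a * Complex.Gamma (κ - m - a) / Complex.Gamma κ) := by
  have hκ : 0 < κ.re := by linarith
  have hG : Complex.Gamma κ ≠ 0 := Complex.Gamma_ne_zero_of_re_pos hκ
  let F : (V × ℝ) → ℝ → ℂ := fun p x =>
    (Complex.exp (-(x * q p.1 : ℝ)) * ((p.2 : ℂ) ^ (a - 1) * Complex.exp (-(x * p.2)))) *
      ((x : ℂ) ^ (κ - 1) * Complex.exp (-x))
  have hF : Integrable (Function.uncurry F)
      ((μ.prod (volume.restrict (Ioi (0 : ℝ)))).prod (volume.restrict (Ioi (0 : ℝ)))) := by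
    have hmeas : Measurable (Function.uncurry F) := by
      unfold F Function.uncurry; fun_prop
    refine ⟨hmeas.aestronglyMeasurable, ?_⟩
    rw [HasFiniteIntegral, lintegral_prod_symm _ (by fun_prop)]
    have := lintegral_mixed hq hgauss hD a.re κ.re
    rw [if_pos ⟨ha, hb⟩] at this
    refine lt_of_eq_of_lt ?_ (this ▸ ENNReal.ofReal_lt_top)
    refine setLIntegral_congr_fun measurableSet_Ioi fun x (hx : 0 < x) => lintegral_congr_ae ?_
    filter_upwards [ae_restrict_prod_pos] with p hp
    rw [← ENNReal.ofReal_mul (by positivity), ← ENNReal.ofReal_mul (by positivity),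
      ← ofReal_norm]
    congr 1
    simp only [Function.uncurry, F, norm_mul, Complex.norm_exp,
      Complex.norm_cpow_eq_rpow_re_of_pos hp, Complex.norm_cpow_eq_rpow_re_of_pos hx]
    norm_cast
    simp only [Complex.sub_re, Complex.one_re]
    ring
  have h1 : ∀ᵐ p ∂(μ.prod (volume.restrict (Ioi (0 : ℝ)))),
      ((p.2 : ℝ) : ℂ) ^ (a - 1) * ((1 + p.2 + q p.1 : ℝ) : ℂ) ^ (-κ) =
        (Complex.Gamma κ)⁻¹ * ∫ x in Ioi (0 : ℝ), F p x := by
    filter_upwards [ae_restrict_prod_pos] with p hp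
    have hw : 0 < 1 + p.2 + q p.1 := by linarith [hq0 p.1]
    have h2 : ∀ x : ℝ, F p x = (p.2 : ℂ) ^ (a - 1) *
        ((x : ℂ) ^ (κ - 1) * Complex.exp (-(((1 + p.2 + q p.1 : ℝ) : ℂ) * x))) := by
      intro x
      simp only [F]
      rw [show -(((1 + p.2 + q p.1 : ℝ) : ℂ) * x) =
        -((x * q p.1 : ℝ) : ℂ) + -(x * p.2) + -x by push_cast; ring, Complex.exp_add,
        Complex.exp_add]
      ring
    simp_rw [h2]
    rw [integral_const_mul, Complex.integral_cpow_mul_exp_neg_mul_Ioi hκ (by simpa using hw),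
      one_div, Complex.inv_cpow _ _ (by
        rw [Complex.arg_ofReal_of_nonneg hw.le]; exact pi_pos.ne), ← Complex.cpow_neg]
    field_simp
  rw [integral_congr_ae h1, integral_const_mul, integral_integral_swap hF]
  have h3 : ∀ x ∈ Ioi (0 : ℝ), ∫ p, F p x ∂(μ.prod (volume.restrict (Ioi (0 : ℝ)))) =
      (D * (π : ℂ) ^ (m : ℂ) * Complex.Gamma a) *
        ((x : ℂ) ^ (κ - m - a - 1) * Complex.exp (-((1 : ℝ) * x))) := by
    intro x (hx : 0 < x)
    have hx' : (x : ℂ) ≠ 0 := by exact_mod_cast hx.ne'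
    have h4 : ∫ v, Complex.exp (-(x * q v : ℝ)) ∂μ = ((π / x) ^ m * D : ℝ) := by
      have h5 : ∫ v, exp (-(x * q v)) ∂μ = (π / x) ^ m * D := by
        rw [integral_eq_lintegral_of_nonneg_ae (Filter.Eventually.of_forall fun v => (exp_pos _).le)
          (by fun_prop), hgauss x hx, ENNReal.toReal_ofReal (by positivity)]
      rw [← h5, ← integral_complex_ofReal]
      push_cast
      rfl
    simp only [F]
    rw [integral_mul_const, integral_prod_mul (fun v => Complex.exp (-(x * q v : ℝ)))
      (fun u : ℝ => (u : ℂ) ^ (a - 1) * Complex.exp (-(x * u))), h4,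
      Complex.integral_cpow_mul_exp_neg_mul_Ioi ha (by simpa using hx), one_div,
      Complex.inv_cpow _ _ (by
        rw [Complex.arg_ofReal_of_nonneg hx.le]; exact pi_pos.ne),
      div_rpow pi_pos.le hx.le]
    push_cast
    rw [Complex.ofReal_cpow pi_pos.le, Complex.ofReal_cpow hx.le,
      show κ - m - a - 1 = (κ - 1) - m - a by ring, Complex.cpow_sub _ a hx',
      Complex.cpow_sub _ (m : ℂ) hx', one_mul]
    field_simp
  rw [setIntegral_congr_fun measurableSet_Ioi h3, integral_const_mul,
    Complex.integral_cpow_mul_exp_neg_mul_Ioi (by simpa using hb) (by simp)]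
  simp
  ring

end Mixed

/-! ### Integrating out the last rows and columns, in abstract form -/

section Step

open Set Real ENNReal

variable {V E X : Type*} [MeasurableSpace V] [MeasurableSpace E] [MeasurableSpace X]

/-- The dependence of the integrand on the last rows and columns of the two matrices: `c` and `s`
are the last diagonal entries and `v` collects the remaining entries. -/
def pivotFun [Sub E] (a : ℂ) (g : ℝ × E → ℂ) (β q : V → ℝ) (ζ : V → E) (p : V × (ℝ × E)) : ℂ :=
  if β p.1 < p.2.1 then
    ((p.2.1 - β p.1 : ℝ) : ℂ) ^ (a - 1) * g (1 + (p.2.1 - β p.1) + q p.1, p.2.2 - ζ p.1)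
  else 0

variable [AddGroup E] [MeasurableSub₂ E]

theorem measurable_pivotFun {a : ℂ} {g : ℝ × E → ℂ} {β q : X → V → ℝ} {ζ : X → V → E}
    (hg : Measurable g) (hβ : Measurable (Function.uncurry β))
    (hq : Measurable (Function.uncurry q)) (hζ : Measurable (Function.uncurry ζ)) :
    Measurable fun p : X × (V × (ℝ × E)) => pivotFun a g (β p.1) (q p.1) (ζ p.1) p.2 := by
  have h1 : Measurable fun p : X × (V × (ℝ × E)) => β p.1 p.2.1 :=
    hβ.comp (measurable_fst.prodMk (measurable_fst.comp measurable_snd))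
  have h2 : Measurable fun p : X × (V × (ℝ × E)) => q p.1 p.2.1 :=
    hq.comp (measurable_fst.prodMk (measurable_fst.comp measurable_snd))
  have h3 : Measurable fun p : X × (V × (ℝ × E)) => ζ p.1 p.2.1 :=
    hζ.comp (measurable_fst.prodMk (measurable_fst.comp measurable_snd))
  unfold pivotFun
  refine Measurable.ite (measurableSet_lt h1 (by fun_prop)) ?_ measurable_const
  fun_prop

/-- The integrand after separation of the last rows and columns. -/
def stepFun (f : X → ℂ) (D : X → ℝ) (a : ℂ) (g : ℝ × E → ℂ) (β q : X → V → ℝ) (ζ : X → V → E)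
    (p : X × (V × (ℝ × E))) : ℂ :=
  f p.1 * (D p.1 : ℂ)⁻¹ * pivotFun a g (β p.1) (q p.1) (ζ p.1) p.2

theorem measurable_stepFun {f : X → ℂ} {D : X → ℝ} {a : ℂ} {g : ℝ × E → ℂ} {β q : X → V → ℝ}
    {ζ : X → V → E} (hf : Measurable f) (hD : Measurable D) (hg : Measurable g)
    (hβ : Measurable (Function.uncurry β)) (hq : Measurable (Function.uncurry q))
    (hζ : Measurable (Function.uncurry ζ)) : Measurable (stepFun f D a g β q ζ) := by
  have := measurable_pivotFun (a := a) hg hβ hq hζ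
  unfold stepFun
  fun_prop

variable {μ : Measure V} [SFinite μ] {ν : Measure E} [SFinite ν]
  {a κ : ℂ} {g : ℝ × E → ℂ} {β q : V → ℝ} {ζ : V → E} {K : ℝ≥0∞} {Kc : ℂ} {m D : ℝ}

theorem measurable_pivotFun' (hg : Measurable g) (hβ : Measurable β) (hq : Measurable q)
    (hζ : Measurable ζ) : Measurable (pivotFun a g β q ζ) :=
  (measurable_pivotFun (X := Unit) (β := fun _ => β) (q := fun _ => q) (ζ := fun _ => ζ) hg
    (hβ.comp measurable_snd) (hq.comp measurable_snd) (hζ.comp measurable_snd)).comp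
    (measurable_const (a := ())|>.prodMk measurable_id)

variable [MeasurableAdd E] [ν.IsAddRightInvariant]

/-- Translation invariance removes `ζ` from the kernel and turns `c` into the pivot `u = c - β`; the
kernel then integrates to a multiple of a power of `1 + u + q`, and the beta integral remains. -/
theorem lintegral_pivotFun (hg : Measurable g) (hβ : Measurable β) (hq : Measurable q)
    (hζ : Measurable ζ) (hq0 : ∀ v, 0 ≤ q v)
    (hgauss : ∀ t : ℝ, 0 < t →
      ∫⁻ v, ENNReal.ofReal (exp (-(t * q v))) ∂μ = ENNReal.ofReal ((π / t) ^ m * D))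
    (hD : 0 < D) (hm : 0 ≤ m)
    (hK : ∀ w : ℝ, 0 < w → ∫⁻ s, ‖g (w, s)‖ₑ ∂ν = K * ENNReal.ofReal (w ^ (-κ.re))) :
    ∫⁻ p, ‖pivotFun a g β q ζ p‖ₑ ∂(μ.prod (volume.prod ν)) =
      ENNReal.ofReal D * (K * betaConst a.re κ.re m) := by
  have hmeas := measurable_pivotFun' (a := a) hg hβ hq hζ
  rw [lintegral_prod _ (by fun_prop)]
  have h1 : ∀ v, ∫⁻ p, ‖pivotFun a g β q ζ (v, p)‖ₑ ∂(volume.prod ν) =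
      ∫⁻ u in Ioi (0 : ℝ), K * (ENNReal.ofReal (u ^ (a.re - 1)) *
        ENNReal.ofReal ((1 + u + q v) ^ (-κ.re))) := by
    intro v
    rw [lintegral_prod _ (by fun_prop)]
    let H : ℝ → ℝ≥0∞ := (Ioi (0 : ℝ)).indicator fun u => K * (ENNReal.ofReal (u ^ (a.re - 1)) *
        ENNReal.ofReal ((1 + u + q v) ^ (-κ.re)))
    have h2 : ∀ c : ℝ, ∫⁻ s, ‖pivotFun a g β q ζ (v, (c, s))‖ₑ ∂ν = H (c - β v) := by
      intro c
      by_cases hc : β v < c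
      · have hu : 0 < c - β v := sub_pos.2 hc
        simp only [H, pivotFun, if_pos hc, enorm_mul]
        rw [indicator_of_mem (mem_Ioi.2 hu), lintegral_const_mul' _ _ (by simp),
          lintegral_sub_right_eq_self (fun s => ‖g (1 + (c - β v) + q v, s)‖ₑ),
          hK _ (by linarith [hq0 v]), ← ofReal_norm (_ ^ _),
          Complex.norm_cpow_eq_rpow_re_of_pos hu, Complex.sub_re, Complex.one_re]
        ring
      · simp only [H, pivotFun, if_neg hc]
        rw [indicator_of_notMem (by simpa using hc)]
        simp
    rw [lintegral_congr h2, lintegral_sub_right_eq_self, lintegral_indicator measurableSet_Ioi]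
  rw [lintegral_congr h1, mul_left_comm, ← lintegral_beta hq hq0 hgauss hD hm,
    lintegral_prod _ (by fun_prop), lintegral_congr fun v => lintegral_const_mul _ (by fun_prop),
    lintegral_const_mul]
  exact Measurable.lintegral_prod_right'
    (f := fun p : V × ℝ => ENNReal.ofReal (p.2 ^ (a.re - 1)) *
      ENNReal.ofReal ((1 + p.2 + q p.1) ^ (-κ.re))) (by fun_prop)

theorem integral_pivotFun (hg : Measurable g) (hβ : Measurable β) (hq : Measurable q)
    (hζ : Measurable ζ) (hq0 : ∀ v, 0 ≤ q v)
    (hgauss : ∀ t : ℝ, 0 < t →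
      ∫⁻ v, ENNReal.ofReal (exp (-(t * q v))) ∂μ = ENNReal.ofReal ((π / t) ^ m * D))
    (hD : 0 < D) (hm : 0 ≤ m)
    (hK : ∀ w : ℝ, 0 < w → ∫⁻ s, ‖g (w, s)‖ₑ ∂ν = K * ENNReal.ofReal (w ^ (-κ.re)))
    (hK' : K ≠ ∞) (ha : 0 < a.re) (hb : 0 < κ.re - m - a.re)
    (hKc : ∀ w : ℝ, 0 < w → ∫ s, g (w, s) ∂ν = Kc * (w : ℂ) ^ (-κ)) :
    ∫ p, pivotFun a g β q ζ p ∂(μ.prod (volume.prod ν)) =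
      D * (Kc * ((π : ℂ) ^ (m : ℂ) * Complex.Gamma a * Complex.Gamma (κ - m - a) /
        Complex.Gamma κ)) := by
  have hmeas := measurable_pivotFun' (a := a) hg hβ hq hζ
  have hint : Integrable (pivotFun a g β q ζ) (μ.prod (volume.prod ν)) := by
    refine ⟨hmeas.aestronglyMeasurable, ?_⟩
    rw [HasFiniteIntegral, lintegral_pivotFun hg hβ hq hζ hq0 hgauss hD hm hK]
    exact ENNReal.mul_lt_top ENNReal.ofReal_lt_top
      (ENNReal.mul_lt_top hK'.lt_top (betaConst_lt_top_iff.2 ⟨ha, hb⟩))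
  rw [integral_prod _ hint]
  have h1 : ∀ᵐ v ∂μ, ∫ p, pivotFun a g β q ζ (v, p) ∂(volume.prod ν) =
      ∫ u in Ioi (0 : ℝ), Kc * ((u : ℂ) ^ (a - 1) * ((1 + u + q v : ℝ) : ℂ) ^ (-κ)) := by
    filter_upwards [hint.prod_right_ae] with v hv
    rw [integral_prod _ hv]
    let H : ℝ → ℂ := (Ioi (0 : ℝ)).indicator fun u =>
      Kc * ((u : ℂ) ^ (a - 1) * ((1 + u + q v : ℝ) : ℂ) ^ (-κ))
    have h2 : ∀ c : ℝ, ∫ s, pivotFun a g β q ζ (v, (c, s)) ∂ν = H (c - β v) := by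
      intro c
      by_cases hc : β v < c
      · have hu : 0 < c - β v := sub_pos.2 hc
        simp only [H, pivotFun, if_pos hc]
        rw [indicator_of_mem (mem_Ioi.2 hu), integral_const_mul,
          integral_sub_right_eq_self (fun s => g (1 + (c - β v) + q v, s)),
          hKc _ (by linarith [hq0 v])]
        ring
      · simp only [H, pivotFun, if_neg hc]
        rw [indicator_of_notMem (by simpa using hc)]
        simp
    rw [integral_congr_ae (Filter.Eventually.of_forall h2), integral_sub_right_eq_self,
      integral_indicator measurableSet_Ioi]
  rw [integral_congr_ae h1, mul_left_comm, ← integral_beta hq hq0 hgauss hD hm ha hb,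
    integral_prod]
  · simp_rw [integral_const_mul]
  · refine ⟨Measurable.aestronglyMeasurable (by fun_prop), ?_⟩
    rw [HasFiniteIntegral]
    refine lt_of_eq_of_lt ?_ (ENNReal.mul_lt_top (ENNReal.ofReal_lt_top (r := D))
      (betaConst_lt_top_iff.2 ⟨ha, hb⟩))
    rw [← lintegral_beta hq hq0 hgauss hD hm]
    refine lintegral_congr_ae ?_
    filter_upwards [ae_restrict_prod_pos] with p hp
    have hw : 0 < 1 + p.2 + q p.1 := by linarith [hq0 p.1]
    rw [enorm_mul, ← ofReal_norm (_ ^ _), ← ofReal_norm (_ ^ _),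
      Complex.norm_cpow_eq_rpow_re_of_pos hp, Complex.norm_cpow_eq_rpow_re_of_pos hw]
    simp

section Outer

variable {ρ : Measure X} {f : X → ℂ} {D : X → ℝ} {β q : X → V → ℝ} {ζ : X → V → E}

/-- The inner integral is `D x` times a constant that does not depend on `x`, and the prefactor `(D
x)⁻¹` cancels it. The hypotheses on `q` and `D` are required only where `f` is nonzero, since they
are available only for positive definite `A` and symmetric `B`. -/
theorem lintegral_stepFun (hf : Measurable f) (hD : Measurable D) (hg : Measurable g)
    (hβ : Measurable (Function.uncurry β)) (hq : Measurable (Function.uncurry q))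
    (hζ : Measurable (Function.uncurry ζ))
    (hq0 : ∀ x, f x ≠ 0 → ∀ v, 0 ≤ q x v) (hD0 : ∀ x, f x ≠ 0 → 0 < D x)
    (hgauss : ∀ x, f x ≠ 0 → ∀ t : ℝ, 0 < t →
      ∫⁻ v, ENNReal.ofReal (exp (-(t * q x v))) ∂μ = ENNReal.ofReal ((π / t) ^ m * D x))
    (hm : 0 ≤ m)
    (hK : ∀ w : ℝ, 0 < w → ∫⁻ s, ‖g (w, s)‖ₑ ∂ν = K * ENNReal.ofReal (w ^ (-κ.re))) :
    ∫⁻ p, ‖stepFun f D a g β q ζ p‖ₑ ∂(ρ.prod (μ.prod (volume.prod ν))) =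
      (∫⁻ x, ‖f x‖ₑ ∂ρ) * (K * betaConst a.re κ.re m) := by
  have hmeas := measurable_stepFun (a := a) hf hD hg hβ hq hζ
  rw [lintegral_prod _ (by fun_prop), ← lintegral_mul_const _ (by fun_prop)]
  refine lintegral_congr fun x => ?_
  simp only [stepFun, enorm_mul]
  rw [lintegral_const_mul' _ _ (by finiteness)]
  by_cases hx : f x = 0
  · simp [hx]
  · have hDx := hD0 x hx
    rw [lintegral_pivotFun hg hβ.of_uncurry_left hq.of_uncurry_left
      hζ.of_uncurry_left (hq0 x hx) (hgauss x hx) hDx hm hK, ← mul_assoc,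
      mul_assoc ‖f x‖ₑ]
    have : ‖((D x : ℂ))⁻¹‖ₑ * ENNReal.ofReal (D x) = 1 := by
      rw [← ofReal_norm, ← ENNReal.ofReal_mul (norm_nonneg _), norm_inv, Complex.norm_real,
        Real.norm_of_nonneg hDx.le, inv_mul_cancel₀ hDx.ne', ENNReal.ofReal_one]
    rw [this, mul_one]

theorem integral_stepFun [SFinite ρ] (hf : Measurable f) (hD : Measurable D) (hg : Measurable g)
    (hβ : Measurable (Function.uncurry β)) (hq : Measurable (Function.uncurry q))
    (hζ : Measurable (Function.uncurry ζ))
    (hq0 : ∀ x, f x ≠ 0 → ∀ v, 0 ≤ q x v) (hD0 : ∀ x, f x ≠ 0 → 0 < D x)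
    (hgauss : ∀ x, f x ≠ 0 → ∀ t : ℝ, 0 < t →
      ∫⁻ v, ENNReal.ofReal (exp (-(t * q x v))) ∂μ = ENNReal.ofReal ((π / t) ^ m * D x))
    (hm : 0 ≤ m)
    (hK : ∀ w : ℝ, 0 < w → ∫⁻ s, ‖g (w, s)‖ₑ ∂ν = K * ENNReal.ofReal (w ^ (-κ.re)))
    (hK' : K ≠ ∞) (ha : 0 < a.re) (hb : 0 < κ.re - m - a.re)
    (hKc : ∀ w : ℝ, 0 < w → ∫ s, g (w, s) ∂ν = Kc * (w : ℂ) ^ (-κ))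
    (hfi : ∫⁻ x, ‖f x‖ₑ ∂ρ ≠ ∞) :
    ∫ p, stepFun f D a g β q ζ p ∂(ρ.prod (μ.prod (volume.prod ν))) =
      (∫ x, f x ∂ρ) * (Kc * ((π : ℂ) ^ (m : ℂ) * Complex.Gamma a * Complex.Gamma (κ - m - a) /
        Complex.Gamma κ)) := by
  have hmeas := measurable_stepFun (a := a) hf hD hg hβ hq hζ
  rw [integral_prod, ← integral_mul_const]
  · refine integral_congr_ae (Filter.Eventually.of_forall fun x => ?_)
    simp only [stepFun]
    rw [integral_const_mul]
    by_cases hx : f x = 0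
    · simp [hx]
    · have hDx : (D x : ℂ) ≠ 0 := by exact_mod_cast (hD0 x hx).ne'
      rw [integral_pivotFun hg hβ.of_uncurry_left
        hq.of_uncurry_left hζ.of_uncurry_left (hq0 x hx)
        (hgauss x hx) (hD0 x hx) hm hK hK' ha hb hKc]
      field_simp
  · refine ⟨hmeas.aestronglyMeasurable, ?_⟩
    rw [HasFiniteIntegral, lintegral_stepFun hf hD hg hβ hq hζ hq0 hD0 hgauss hm hK]
    exact ENNReal.mul_lt_top hfi.lt_top
      (ENNReal.mul_lt_top hK'.lt_top (betaConst_lt_top_iff.2 ⟨ha, hb⟩))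

end Outer

end Step

/-! ### Gaussian integrals of quadratic forms -/

section Gaussian

open Set Real ENNReal

theorem measurePreserving_snoc {α : Type*} [MeasureSpace α] [SigmaFinite (volume : Measure α)]
    (n : ℕ) :
    MeasurePreserving (fun p : α × (Fin n → α) => (Fin.snoc p.2 p.1 : Fin (n + 1) → α)) := by
  convert (volume_preserving_piFinSuccAbove (fun _ : Fin (n + 1) => α) (Fin.last n)).symm using 1
  ext p i
  simp [MeasurableEquiv.piFinSuccAbove, Fin.insertNthEquiv, Fin.insertNth_last']

/-- The Gaussian integral over the field `𝕜` of real or complex numbers has its usual value. -/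
class GaussianVolume (𝕜 : Type*) [RCLike 𝕜] [MeasureSpace 𝕜] : Prop where
  lintegral_exp_neg : ∀ u : ℝ, 0 < u → ∫⁻ z : 𝕜, ENNReal.ofReal (exp (-(u * ‖z‖ ^ 2))) =
    ENNReal.ofReal ((π / u) ^ ((Module.finrank ℝ 𝕜 : ℝ) / 2))

theorem lintegral_exp_neg_mul_norm_sq {F : Type*} [NormedAddCommGroup F] [InnerProductSpace ℝ F]
    [FiniteDimensional ℝ F] [MeasurableSpace F] [BorelSpace F] {u : ℝ} (hu : 0 < u) :
    ∫⁻ z : F, ENNReal.ofReal (exp (-(u * ‖z‖ ^ 2))) =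
      ENNReal.ofReal ((π / u) ^ ((Module.finrank ℝ F : ℝ) / 2)) := by
  have h := GaussianFourier.integral_rexp_neg_mul_sq_norm (V := F) hu
  simp_rw [neg_mul] at h
  rw [← h, ofReal_integral_eq_lintegral_ofReal _
    (Filter.Eventually.of_forall fun _ => (exp_pos _).le)]
  refine Integrable.of_integral_ne_zero ?_
  rw [h]
  positivity

instance : GaussianVolume ℝ := ⟨fun _ hu => lintegral_exp_neg_mul_norm_sq hu⟩

instance : GaussianVolume ℂ := ⟨fun _ hu => lintegral_exp_neg_mul_norm_sq hu⟩

variable {𝕜 : Type*} [RCLike 𝕜]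

theorem continuous_quadForm {n : ℕ} (M : Matrix (Fin n) (Fin n) 𝕜) : Continuous (quadForm M) := by
  unfold quadForm
  exact RCLike.continuous_re.comp
    (continuous_star.dotProduct (continuous_const.matrix_mulVec continuous_id))

theorem reDet_inv {n : ℕ} {M : Matrix (Fin n) (Fin n) 𝕜} (hM : M.PosDef) :
    reDet M⁻¹ = (reDet M)⁻¹ := by
  have h := ofReal_reDet hM
  rw [reDet, det_nonsing_inv, Ring.inverse_eq_inv', ← h, ← RCLike.ofReal_inv, RCLike.ofReal_re]

theorem reDet_mul {n : ℕ} {M M' : Matrix (Fin n) (Fin n) 𝕜} (hM : M.PosDef) (hM' : M'.PosDef) :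
    reDet (M * M') = reDet M * reDet M' := by
  rw [reDet, det_mul, ← ofReal_reDet hM, ← ofReal_reDet hM', ← RCLike.ofReal_mul, RCLike.ofReal_re]

/-- The Jacobian-type factor by which the parameters are shifted when the last rows and columns
are integrated out. -/
def pairWeight {n : ℕ} (A B : Matrix (Fin n) (Fin n) 𝕜) : ℝ :=
  (reDet A * reDet (1 + A) * reDet (schurPair A B)) ^ ((Module.finrank ℝ 𝕜 : ℝ) / 2)

theorem pairWeight_pos {n : ℕ} {A : Matrix (Fin n) (Fin n) 𝕜} (hA : A.PosDef)
    (B : Matrix (Fin n) (Fin n) 𝕜) : 0 < pairWeight A B :=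
  rpow_pos_of_pos (mul_pos (mul_pos (reDet_pos hA) (reDet_pos (posDef_one_add hA)))
    (reDet_pos (posDef_schurPair hA B))) _

variable [MeasureSpace 𝕜] [BorelSpace 𝕜] [SigmaFinite (volume : Measure 𝕜)]

variable [GaussianVolume 𝕜] [(volume : Measure 𝕜).IsAddHaarMeasure]

/-- Induction by completing the square: translation removes the coupling with the last variable,
which contributes a one-variable Gaussian with the last pivot as coefficient. The determinant is the
product of the pivots. -/
theorem lintegral_exp_quadForm {n : ℕ} {M : Matrix (Fin n) (Fin n) 𝕜} (hM : M.PosDef) {t : ℝ}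
    (ht : 0 < t) :
    ∫⁻ z, ENNReal.ofReal (exp (-(t * quadForm M z))) =
      ENNReal.ofReal ((π / t) ^ ((Module.finrank ℝ 𝕜 : ℝ) / 2 * n) *
        (reDet M) ^ (-((Module.finrank ℝ 𝕜 : ℝ) / 2))) := by
  induction n with
  | zero =>
    rw [lintegral_unique]
    simp [quadForm, reDet, volume_pi]
  | succ n ih =>
    obtain ⟨A, b, c, rfl⟩ : ∃ (A : Matrix (Fin n) (Fin n) 𝕜) (b : Fin n → 𝕜) (c : ℝ),
        M = border A b (star b) (c : 𝕜) := by
      refine ⟨M.submatrix Fin.castSucc Fin.castSucc, fun i => M i.castSucc (Fin.last n),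
        RCLike.re (M (Fin.last n) (Fin.last n)), ?_⟩
      refine border_ext _ _ _ _ (fun _ _ => rfl) (fun _ => rfl) (fun j => ?_) ?_
      · exact (hM.isHermitian.apply _ _).symm
      · exact (hM.isHermitian.coe_re_apply_self _).symm
    obtain ⟨hA, hc⟩ := posDef_border_iff.1 hM
    have hu : 0 < c - quadForm A⁻¹ b := sub_pos.2 hc
    have hcont := continuous_quadForm (border A b (star b) (c : 𝕜))
    have hq := fun M : Matrix (Fin n) (Fin n) 𝕜 => (continuous_quadForm M).measurable
    rw [← (measurePreserving_snoc n).lintegral_comp (by fun_prop)]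
    simp_rw [quadForm_border hA]
    rw [Measure.volume_eq_prod, lintegral_prod _ (by fun_prop)]
    have h1 : ∀ s : 𝕜, ∫⁻ x, ENNReal.ofReal (exp (-(t * (quadForm A (x + s • A⁻¹ *ᵥ b) +
        (c - quadForm A⁻¹ b) * ‖s‖ ^ 2)))) =
        ENNReal.ofReal ((π / t) ^ ((Module.finrank ℝ 𝕜 : ℝ) / 2 * n) *
        (reDet A) ^ (-((Module.finrank ℝ 𝕜 : ℝ) / 2))) *
          ENNReal.ofReal (exp (-((t * (c - quadForm A⁻¹ b)) * ‖s‖ ^ 2))) := by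
      intro s
      rw [← ih hA, ← lintegral_mul_const _ (by fun_prop)]
      conv_rhs => rw [← lintegral_add_right_eq_self _ (s • A⁻¹ *ᵥ b)]
      refine lintegral_congr fun x => ?_
      rw [← ENNReal.ofReal_mul (exp_pos _).le, ← exp_add]
      ring_nf
    have hd := reDet_pos hA
    rw [lintegral_congr h1, lintegral_const_mul _ (by fun_prop),
      GaussianVolume.lintegral_exp_neg _ (mul_pos ht hu),
      ← ENNReal.ofReal_mul (by positivity), reDet_border hA]
    congr 1
    rw [← div_div, div_rpow (by positivity) hu.le, mul_rpow hd.le hu.le, rpow_neg hu.le,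
      Nat.cast_add_one, mul_add, mul_one, rpow_add (by positivity)]
    field_simp

/-- For fixed `b`, translation of `y` by `shiftVec A B b` makes the form centred. The two Gaussian
factors belong to the inverses of `schurPair A B` and of `A (1 + A)`, hence the positive exponent in
`pairWeight`. -/
theorem lintegral_exp_pivotForm {n : ℕ} {A : Matrix (Fin n) (Fin n) 𝕜} (hA : A.PosDef)
    (B : Matrix (Fin n) (Fin n) 𝕜) {t : ℝ} (ht : 0 < t) :
    ∫⁻ v : (Fin n → 𝕜) × (Fin n → 𝕜), ENNReal.ofReal (exp (-(t * pivotForm A B v.1 v.2))) =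
      ENNReal.ofReal ((π / t) ^ ((Module.finrank ℝ 𝕜 : ℝ) * n) * pairWeight A B) := by
  have hN := posDef_schurPair hA B
  have hAA := posDef_add_mul_self hA
  have hq := fun M : Matrix (Fin n) (Fin n) 𝕜 => (continuous_quadForm M).measurable
  have hs : Continuous (shiftVec A B) := by
    unfold shiftVec
    exact continuous_const.matrix_mulVec (continuous_const.matrix_mulVec continuous_star)
  have hs' := hs.measurable
  have h0 : Measurable fun v : (Fin n → 𝕜) × (Fin n → 𝕜) => pivotForm A B v.1 v.2 := by
    unfold pivotForm; fun_prop
  rw [Measure.volume_eq_prod, lintegral_prod _ (by fun_prop)]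
  have h1 : ∀ b : Fin n → 𝕜, ∫⁻ y, ENNReal.ofReal (exp (-(t * pivotForm A B b y))) =
      ENNReal.ofReal (exp (-(t * quadForm (A + A * A)⁻¹ b))) *
        ENNReal.ofReal ((π / t) ^ ((Module.finrank ℝ 𝕜 : ℝ) / 2 * n) *
        (reDet (schurPair A B)⁻¹) ^ (-((Module.finrank ℝ 𝕜 : ℝ) / 2))) := by
    intro b
    rw [← lintegral_exp_quadForm hN.inv ht, ← lintegral_const_mul _ (by fun_prop)]
    conv_rhs => rw [← lintegral_sub_right_eq_self _ (shiftVec A B b)]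
    refine lintegral_congr fun y => ?_
    rw [← ENNReal.ofReal_mul (exp_pos _).le, ← exp_add, pivotForm]
    ring_nf
  have hd1 := reDet_pos hA
  have hd2 := reDet_pos (posDef_one_add hA)
  have hd3 := reDet_pos hN
  have hd4 := reDet_pos hN.inv
  rw [lintegral_congr h1, lintegral_mul_const _ (by fun_prop), lintegral_exp_quadForm hAA.inv ht,
    reDet_inv hAA, reDet_inv hN,
    ← ENNReal.ofReal_mul (by rw [← reDet_inv hAA]; have := reDet_pos hAA.inv; positivity), self_add_mul_self_eq,
    reDet_mul hA (posDef_one_add hA), pairWeight]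
  congr 1
  rw [inv_rpow (by positivity), inv_rpow (by positivity), rpow_neg (by positivity),
    rpow_neg (by positivity), inv_inv, inv_inv, mul_rpow (z := _ / 2) (by positivity) hd3.le,
    show (Module.finrank ℝ 𝕜 : ℝ) * n = (Module.finrank ℝ 𝕜 : ℝ) / 2 * n +
      (Module.finrank ℝ 𝕜 : ℝ) / 2 * n by ring, rpow_add (by positivity)]
  ring

end Gaussian

/-! ### Homogeneous kernels and the quaternionic kernel -/

section Kernel

open Set Real ENNReal

theorem lintegral_comp_inv_smul {E : Type*} [NormedAddCommGroup E] [NormedSpace ℝ E]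
    [MeasurableSpace E] [BorelSpace E] [FiniteDimensional ℝ E] (ν : Measure E)
    [ν.IsAddHaarMeasure] {h : E → ℝ≥0∞} (hh : Measurable h) {w : ℝ} (hw : 0 < w) :
    ∫⁻ s, h (w⁻¹ • s) ∂ν = ENNReal.ofReal (w ^ (Module.finrank ℝ E : ℝ)) * ∫⁻ s, h s ∂ν := by
  have := Measure.map_addHaar_smul ν (inv_ne_zero hw.ne')
  rw [← lintegral_map hh (measurable_const_smul _), this, lintegral_smul_measure, smul_eq_mul]
  congr 2
  rw [inv_pow, inv_inv, abs_of_pos (by positivity), Real.rpow_natCast]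

/-- The integral of the norm of a homogeneous kernel. -/
theorem lintegral_kernel {E : Type*} [NormedAddCommGroup E] [NormedSpace ℝ E]
    [MeasurableSpace E] [BorelSpace E] [FiniteDimensional ℝ E] (ν : Measure E)
    [ν.IsAddHaarMeasure] {g : ℝ × E → ℂ} (hg : Measurable g) {r : ℂ}
    (hom : ∀ w : ℝ, 0 < w → ∀ s, g (w, s) = (w : ℂ) ^ (-r) * g (1, w⁻¹ • s)) {w : ℝ}
    (hw : 0 < w) :
    ∫⁻ s, ‖g (w, s)‖ₑ ∂ν = (∫⁻ s, ‖g (1, s)‖ₑ ∂ν) *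
      ENNReal.ofReal (w ^ (-(r - (Module.finrank ℝ E : ℂ)).re)) := by
  simp_rw [hom w hw, enorm_mul]
  rw [lintegral_const_mul _ (by fun_prop),
    lintegral_comp_inv_smul (h := fun s => ‖g (1, s)‖ₑ) ν (by fun_prop) hw, ← mul_assoc, mul_comm]
  congr 1
  rw [← ofReal_norm, Complex.norm_cpow_eq_rpow_re_of_pos hw, ← ENNReal.ofReal_mul (by positivity),
    ← rpow_add hw]
  congr 2
  simp
  ring

theorem lintegral_enorm_ne_zero {E : Type*} [MeasurableSpace E] (ν : Measure E) (hν : ν ≠ 0)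
    {g : E → ℂ} (hg : Measurable g) (h0 : ∀ s, g s ≠ 0) : ∫⁻ s, ‖g s‖ₑ ∂ν ≠ 0 := by
  rw [Ne, lintegral_eq_zero_iff (by fun_prop)]
  intro h
  have : ∀ᵐ s ∂ν, False := h.mono fun s hs => h0 s (by simpa using hs)
  rw [ae_iff] at this
  simp at this
  exact hν this

/-- The kernel `|w + s j| ^ (-σ)`. -/
def quatKernel (σ : ℂ) (p : ℝ × ℂ) : ℂ := ((p.1 ^ 2 + ‖p.2‖ ^ 2 : ℝ) : ℂ) ^ (-σ / 2)

theorem measurable_quatKernel (σ : ℂ) : Measurable (quatKernel σ) := by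
  unfold quatKernel
  fun_prop

theorem norm_quatKernel_one (σ s : ℂ) :
    ‖quatKernel σ (1, s)‖ = (1 + ‖s‖ ^ 2) ^ (-σ.re / 2) := by
  rw [quatKernel, Complex.norm_cpow_eq_rpow_re_of_pos (by positivity)]
  simp

theorem quatKernel_ne_zero (σ s : ℂ) : quatKernel σ (1, s) ≠ 0 := by
  rw [← norm_pos_iff, norm_quatKernel_one]
  positivity

theorem sq_cpow_half {w : ℝ} (hw : 0 < w) (r : ℂ) : ((w ^ 2 : ℝ) : ℂ) ^ (r / 2) = (w : ℂ) ^ r := by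
  have hw' : (w : ℂ) ≠ 0 := by exact_mod_cast hw.ne'
  have hw2 : ((w ^ 2 : ℝ) : ℂ) ≠ 0 := by exact_mod_cast (pow_pos hw 2).ne'
  rw [Complex.cpow_def_of_ne_zero hw', Complex.cpow_def_of_ne_zero hw2, ← Complex.ofReal_log hw.le,
    ← Complex.ofReal_log (by positivity), Real.log_pow]
  congr 1
  push_cast
  ring

theorem quatKernel_hom (σ : ℂ) (w : ℝ) (hw : 0 < w) (s : ℂ) :
    quatKernel σ (w, s) = (w : ℂ) ^ (-σ) * quatKernel σ (1, w⁻¹ • s) := by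
  rw [quatKernel, quatKernel, ← sq_cpow_half hw,
    ← Complex.mul_cpow_ofReal_nonneg (by positivity) (by positivity), ← Complex.ofReal_mul]
  congr 2
  simp only [norm_smul, norm_inv, norm_of_nonneg hw.le]
  field_simp

theorem lintegral_quatKernel_ne_top {σ : ℂ} (hσ : 2 < σ.re) :
    ∫⁻ s, ‖quatKernel σ (1, s)‖ₑ ≠ ∞ := by
  have h := integrable_rpow_neg_one_add_norm_sq (E := ℂ) (μ := volume) (r := σ.re)
    (by simpa using hσ)
  simp_rw [← norm_quatKernel_one] at h
  simp_rw [← ofReal_norm]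
  exact (h.lintegral_lt_top).ne

/-- Polar coordinates reduce to the radial integral of `y (w² + y²) ^ (-σ/2)`, which becomes a pure
power after substituting `w² + y²`. -/
theorem integral_quatKernel {σ : ℂ} (hσ : 2 < σ.re) {w : ℝ} (hw : 0 < w) :
    ∫ s, quatKernel σ (w, s) = 2 * π / (σ - 2) * (w : ℂ) ^ (-(σ - 2)) := by
  have hσ' : σ - 2 ≠ 0 := fun h => by
    have := congrArg Complex.re h
    simp at this
    linarith
  have h1 := integral_fun_norm_addHaar (volume : Measure ℂ)
    (fun y : ℝ => ((w ^ 2 + y ^ 2 : ℝ) : ℂ) ^ (-σ / 2))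
  -- The substitution of `y ^ 2` for the variable, whose Jacobian `2 y` matches the radial weight up
  -- to the factor `2`.
  have h2 := integral_comp_rpow_Ioi_of_pos (g := fun y : ℝ => ((w ^ 2 + y : ℝ) : ℂ) ^ (-σ / 2))
    two_pos
  have h3 : ∫ y in Ioi (0 : ℝ), ((w ^ 2 + y : ℝ) : ℂ) ^ (-σ / 2) =
      2 / (σ - 2) * (w : ℂ) ^ (-(σ - 2)) := by
    have h4 := integral_Ioi_cpow_of_lt (a := -σ / 2) (c := w ^ 2)
      (by simp; linarith) (by positivity)
    have h5 := (measurePreserving_add_left (volume : Measure ℝ) (w ^ 2)).setIntegral_preimage_emb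
      (measurableEmbedding_addLeft (w ^ 2)) (fun t : ℝ => (t : ℂ) ^ (-σ / 2)) (Ioi (w ^ 2))
    rw [h4] at h5
    have h6 : (fun x => w ^ 2 + x) ⁻¹' Ioi (w ^ 2) = Ioi 0 := by ext; simp
    rw [h6] at h5
    rw [h5, show -σ / 2 + 1 = (-(σ - 2)) / 2 by ring, sq_cpow_half hw]
    field_simp
  rw [h3] at h2
  rw [show (fun s => quatKernel σ (w, s)) = fun s : ℂ => ((w ^ 2 + ‖s‖ ^ 2 : ℝ) : ℂ) ^ (-σ / 2)
    from rfl, h1]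
  have h7 : ∫ y in Ioi (0 : ℝ), y ^ (Module.finrank ℝ ℂ - 1) •
      ((w ^ 2 + y ^ 2 : ℝ) : ℂ) ^ (-σ / 2) = 2⁻¹ * (2 / (σ - 2) * (w : ℂ) ^ (-(σ - 2))) := by
    rw [← h2, ← integral_const_mul]
    refine setIntegral_congr_fun measurableSet_Ioi fun y hy => ?_
    norm_num
    ring
  rw [h7]
  simp [Measure.real, Complex.volume_ball]
  ring

end Kernel

/-! ### Cauchy's beta integral -/

section CauchyBeta

open Set Real Filter Topology FourierTransform

/-- The kernel `(w + i s) ^ (-σ) (w - i s) ^ (-τ)`. -/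
def cauchyKernel (σ τ : ℂ) (p : ℝ × ℝ) : ℂ :=
  (p.1 + Complex.I * p.2) ^ (-σ) * (p.1 - Complex.I * p.2) ^ (-τ)

theorem measurable_cauchyKernel (σ τ : ℂ) : Measurable (cauchyKernel σ τ) := by
  unfold cauchyKernel
  fun_prop

theorem Complex.ofReal_mul_cpow {w : ℝ} (hw : 0 < w) {z : ℂ} (hz : z ≠ 0) (r : ℂ) :
    ((w : ℂ) * z) ^ r = (w : ℂ) ^ r * z ^ r := by
  have hw' : (w : ℂ) ≠ 0 := by exact_mod_cast hw.ne'
  rw [Complex.cpow_def_of_ne_zero (mul_ne_zero hw' hz), Complex.log_ofReal_mul hw hz,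
    Complex.cpow_def_of_ne_zero hw', Complex.cpow_def_of_ne_zero hz, ← Complex.exp_add,
    Complex.ofReal_log hw.le]
  ring_nf

theorem one_add_I_mul_ne_zero (s : ℝ) : 1 + Complex.I * s ≠ 0 := fun h => by
  simpa using congrArg Complex.re h

theorem one_sub_I_mul_ne_zero (s : ℝ) : 1 - Complex.I * s ≠ 0 := fun h => by
  simpa using congrArg Complex.re h

theorem cauchyKernel_one (σ τ : ℂ) (s : ℝ) :
    cauchyKernel σ τ (1, s) = (1 + Complex.I * s) ^ (-σ) * (1 - Complex.I * s) ^ (-τ) := by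
  simp [cauchyKernel]

theorem cauchyKernel_ne_zero (σ τ : ℂ) (s : ℝ) : cauchyKernel σ τ (1, s) ≠ 0 := by
  rw [cauchyKernel_one]
  refine mul_ne_zero ?_ ?_ <;>
    simp [Complex.cpow_eq_zero_iff, one_add_I_mul_ne_zero, one_sub_I_mul_ne_zero]

theorem cauchyKernel_hom (σ τ : ℂ) (w : ℝ) (hw : 0 < w) (s : ℝ) :
    cauchyKernel σ τ (w, s) = (w : ℂ) ^ (-(σ + τ)) * cauchyKernel σ τ (1, w⁻¹ • s) := by
  have hw' : (w : ℂ) ≠ 0 := by exact_mod_cast hw.ne'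
  have h1 : (w : ℂ) + Complex.I * s = w * (1 + Complex.I * (w⁻¹ • s : ℝ)) := by
    push_cast [smul_eq_mul]
    field_simp
  have h2 : (w : ℂ) - Complex.I * s = w * (1 - Complex.I * (w⁻¹ • s : ℝ)) := by
    push_cast [smul_eq_mul]
    field_simp
  rw [cauchyKernel_one, cauchyKernel, h1, h2, Complex.ofReal_mul_cpow hw (one_add_I_mul_ne_zero _),
    Complex.ofReal_mul_cpow hw (one_sub_I_mul_ne_zero _), neg_add, Complex.cpow_add _ _ hw']
  ring

theorem norm_one_add_I_mul (s : ℝ) : ‖1 + Complex.I * s‖ = (1 + ‖s‖ ^ 2) ^ (1 / 2 : ℝ) := by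
  rw [Complex.norm_def, ← sqrt_eq_rpow]
  simp [Complex.normSq_apply, sq]

theorem norm_one_sub_I_mul (s : ℝ) : ‖1 - Complex.I * s‖ = (1 + ‖s‖ ^ 2) ^ (1 / 2 : ℝ) := by
  rw [Complex.norm_def, ← sqrt_eq_rpow]
  simp [Complex.normSq_apply, sq]

/-- The argument of a complex number is bounded by `π`, so an imaginary part of the exponent costs
only a constant factor. -/
theorem norm_cpow_le_mul_exp {z : ℂ} (hz : z ≠ 0) (r : ℂ) :
    ‖z ^ r‖ ≤ ‖z‖ ^ r.re * exp (π * |r.im|) := by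
  rw [Complex.norm_cpow_of_ne_zero hz, div_eq_mul_inv, ← exp_neg]
  gcongr
  calc -(z.arg * r.im) ≤ |z.arg * r.im| := neg_le_abs _
    _ = |z.arg| * |r.im| := abs_mul _ _
    _ ≤ π * |r.im| := by gcongr; exact Complex.abs_arg_le_pi z

theorem norm_cauchyKernel_one_le (σ τ : ℂ) (s : ℝ) :
    ‖cauchyKernel σ τ (1, s)‖ ≤
      exp (π * |σ.im|) * exp (π * |τ.im|) * (1 + ‖s‖ ^ 2) ^ (-(σ + τ).re / 2) := by
  have h1 := norm_cpow_le_mul_exp (one_add_I_mul_ne_zero s) (-σ)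
  have h2 := norm_cpow_le_mul_exp (one_sub_I_mul_ne_zero s) (-τ)
  rw [norm_one_add_I_mul, ← rpow_mul (by positivity)] at h1
  rw [norm_one_sub_I_mul, ← rpow_mul (by positivity)] at h2
  rw [cauchyKernel_one, norm_mul]
  refine (mul_le_mul h1 h2 (norm_nonneg _) (by positivity)).trans_eq ?_
  rw [show -(σ + τ).re / 2 = 1 / 2 * (-σ).re + 1 / 2 * (-τ).re by simp; ring,
    rpow_add (by positivity)]
  simp only [Complex.neg_im, abs_neg]
  ring

theorem integrable_cauchyKernel {σ τ : ℂ} (h : 1 < (σ + τ).re) :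
    Integrable fun s => cauchyKernel σ τ (1, s) := by
  have h1 := (integrable_rpow_neg_one_add_norm_sq (E := ℝ) (μ := volume) (r := (σ + τ).re)
    (by simpa using h)).const_mul (exp (π * |σ.im|) * exp (π * |τ.im|))
  refine h1.mono' ?_ (Eventually.of_forall fun s => norm_cauchyKernel_one_le σ τ s)
  exact ((measurable_cauchyKernel σ τ).comp measurable_prodMk_left).aestronglyMeasurable

theorem tendsto_cauchyKernel {σ τ : ℂ} (h : 0 < (σ + τ).re) {l : Filter ℝ}
    (hl : Tendsto (fun s : ℝ => ‖s‖) l atTop) :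
    Tendsto (fun s => cauchyKernel σ τ (1, s)) l (𝓝 0) := by
  refine squeeze_zero_norm (norm_cauchyKernel_one_le σ τ) ?_
  rw [← mul_zero (exp (π * |σ.im|) * exp (π * |τ.im|))]
  refine Tendsto.const_mul _ ?_
  rw [neg_div]
  refine (tendsto_rpow_neg_atTop (half_pos h)).comp ?_
  exact tendsto_atTop_add_const_left _ _ ((tendsto_pow_atTop two_ne_zero).comp hl)

/-- Cauchy's integral `∫ (1 + i s) ^ (-σ) (1 - i s) ^ (-τ) ds`. -/
def cauchyInt (σ τ : ℂ) : ℂ := ∫ s : ℝ, cauchyKernel σ τ (1, s)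

theorem cauchyKernel_add_one_left (σ τ : ℂ) (s : ℝ) :
    cauchyKernel σ τ (1, s) = (1 + Complex.I * s) * cauchyKernel (σ + 1) τ (1, s) := by
  have h := one_add_I_mul_ne_zero s
  rw [cauchyKernel_one, cauchyKernel_one, show -σ = -(σ + 1) + 1 by ring, Complex.cpow_add _ _ h,
    Complex.cpow_one]
  ring

theorem cauchyKernel_add_one_right (σ τ : ℂ) (s : ℝ) :
    cauchyKernel σ τ (1, s) = (1 - Complex.I * s) * cauchyKernel σ (τ + 1) (1, s) := by
  have h := one_sub_I_mul_ne_zero s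
  rw [cauchyKernel_one, cauchyKernel_one, show -τ = -(τ + 1) + 1 by ring, Complex.cpow_add _ _ h,
    Complex.cpow_one]
  ring

/-- Integrates `(1 + i s) + (1 - i s) = 2` against the kernel with both exponents raised. -/
theorem cauchyInt_add (σ τ : ℂ) (h : 0 < (σ + τ).re) :
    cauchyInt (σ + 1) τ + cauchyInt σ (τ + 1) = 2 * cauchyInt (σ + 1) (τ + 1) := by
  have h1 : 1 < (σ + 1 + τ).re := by simp at h ⊢; linarith
  have h2 : 1 < (σ + (τ + 1)).re := by simp at h ⊢; linarith
  unfold cauchyInt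
  rw [← integral_add (integrable_cauchyKernel h1) (integrable_cauchyKernel h2),
    ← integral_const_mul]
  refine integral_congr_ae (Eventually.of_forall fun s => ?_)
  simp only
  rw [cauchyKernel_add_one_right (σ + 1) τ, cauchyKernel_add_one_left σ (τ + 1)]
  ring

theorem hasDerivAt_cauchyKernel (σ τ : ℂ) (s : ℝ) :
    HasDerivAt (fun s : ℝ => cauchyKernel σ τ (1, s))
      (-Complex.I * σ * cauchyKernel (σ + 1) τ (1, s) +
        Complex.I * τ * cauchyKernel σ (τ + 1) (1, s)) s := by
  have h0 : HasDerivAt (fun s : ℝ => (s : ℂ)) 1 s := Complex.ofRealCLM.hasDerivAt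
  have h1 : HasDerivAt (fun s : ℝ => 1 + Complex.I * (s : ℂ)) (Complex.I * 1) s :=
    (h0.const_mul _).const_add _
  have h2 : HasDerivAt (fun s : ℝ => 1 - Complex.I * (s : ℂ)) (-(Complex.I * 1)) s :=
    (h0.const_mul _).const_sub _
  have h3 : HasDerivAt (fun s : ℝ => (1 + Complex.I * (s : ℂ)) ^ (-σ))
      (-σ * (1 + Complex.I * s) ^ (-σ - 1) * (Complex.I * 1)) s := by
    have hz : HasDerivAt (fun z : ℂ => z ^ (-σ)) (-σ * (1 + Complex.I * s) ^ (-σ - 1))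
        (1 + Complex.I * s) := (Complex.hasStrictDerivAt_cpow_const (Or.inl (by simp))).hasDerivAt
    exact hz.comp s h1
  have h4 : HasDerivAt (fun s : ℝ => (1 - Complex.I * (s : ℂ)) ^ (-τ))
      (-τ * (1 - Complex.I * s) ^ (-τ - 1) * (-(Complex.I * 1))) s := by
    have hz : HasDerivAt (fun z : ℂ => z ^ (-τ)) (-τ * (1 - Complex.I * s) ^ (-τ - 1))
        (1 - Complex.I * s) := (Complex.hasStrictDerivAt_cpow_const (Or.inl (by simp))).hasDerivAt
    exact hz.comp s h2
  have h5 := h3.mul h4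
  simp only [cauchyKernel_one]
  refine h5.congr_deriv ?_
  rw [show -σ - 1 = -(σ + 1) by ring, show -τ - 1 = -(τ + 1) by ring]
  ring

/-- The derivative of the kernel has integral zero, because the kernel vanishes at both ends. -/
theorem mul_cauchyInt (σ τ : ℂ) (h : 0 < (σ + τ).re) :
    σ * cauchyInt (σ + 1) τ = τ * cauchyInt σ (τ + 1) := by
  have h1 : 1 < (σ + 1 + τ).re := by simp at h ⊢; linarith
  have h2 : 1 < (σ + (τ + 1)).re := by simp at h ⊢; linarith
  have h3 := (integrable_cauchyKernel h1).const_mul (-Complex.I * σ)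
  have h4 := (integrable_cauchyKernel h2).const_mul (Complex.I * τ)
  have h5 := integral_of_hasDerivAt_of_tendsto (hasDerivAt_cauchyKernel σ τ) (h3.add h4)
    (tendsto_cauchyKernel h tendsto_abs_atBot_atTop)
    (tendsto_cauchyKernel h tendsto_norm_atTop_atTop)
  rw [integral_add h3 h4, integral_const_mul, integral_const_mul] at h5
  rw [cauchyInt, cauchyInt]
  have := congrArg (fun z => Complex.I * z) h5
  linear_combination this + (σ * (∫ s, cauchyKernel (σ + 1) τ (1, s)) -
    τ * ∫ s, cauchyKernel σ (τ + 1) (1, s)) * Complex.I_mul_I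

/-- The two relations `cauchyInt_add` and `mul_cauchyInt`, taken at `σ - 1`, determine `cauchyInt σ
τ` from the integral with `τ` raised by one. Iterating such relations moves the exponents into the
region where the Fourier argument applies. -/
theorem cauchyInt_eq_add_one_right (σ τ : ℂ) (h : 1 < (σ + τ).re) :
    (σ + τ - 1) * cauchyInt σ τ = 2 * τ * cauchyInt σ (τ + 1) := by
  have h0 : 0 < (σ - 1 + τ).re := by simp at h ⊢; linarith
  have h1 := cauchyInt_add (σ - 1) τ h0
  have h2 := mul_cauchyInt (σ - 1) τ h0
  rw [sub_add_cancel] at h1 h2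
  linear_combination h2 + τ * h1

theorem cauchyInt_eq_add_one_left (σ τ : ℂ) (h : 1 < (σ + τ).re) :
    (σ + τ - 1) * cauchyInt σ τ = 2 * σ * cauchyInt (σ + 1) τ := by
  have h0 : 0 < (σ + (τ - 1)).re := by simp at h ⊢; linarith
  have h1 := cauchyInt_add σ (τ - 1) h0
  have h2 := mul_cauchyInt σ (τ - 1) h0
  rw [sub_add_cancel] at h1 h2
  linear_combination σ * h1 - h2

/-- The value of Cauchy's integral. -/
def cauchyVal (σ τ : ℂ) : ℂ :=
  (2 : ℂ) ^ (2 - σ - τ) * π * Complex.Gamma (σ + τ - 1) / (Complex.Gamma σ * Complex.Gamma τ)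

theorem cauchyVal_comm (σ τ : ℂ) : cauchyVal σ τ = cauchyVal τ σ := by
  unfold cauchyVal
  rw [add_comm σ τ, mul_comm (Complex.Gamma σ), show 2 - σ - τ = 2 - τ - σ by ring]

theorem cauchyVal_eq_add_one_right (σ τ : ℂ) (h : 1 < (σ + τ).re) :
    (σ + τ - 1) * cauchyVal σ τ = 2 * τ * cauchyVal σ (τ + 1) := by
  -- The functional equation is used for `1/Γ`, where it holds also at the poles of `Γ`.
  have h1 := Complex.one_div_Gamma_eq_self_mul_one_div_Gamma_add_one τ
  have h0 : σ + τ - 1 ≠ 0 := fun h0 => by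
    have := congrArg Complex.re h0
    simp at this h
    linarith
  have h2 := Complex.Gamma_add_one (σ + τ - 1) h0
  have h3 : (2 : ℂ) ^ (2 - σ - τ) = 2 ^ (2 - σ - (τ + 1)) * 2 := by
    rw [show 2 - σ - τ = (2 - σ - (τ + 1)) + 1 by ring, Complex.cpow_add _ _ two_ne_zero,
      Complex.cpow_one]
  unfold cauchyVal
  rw [show σ + (τ + 1) - 1 = σ + τ - 1 + 1 by ring, h2, h3, div_eq_mul_inv, div_eq_mul_inv,
    mul_inv, mul_inv]
  rw [h1]
  ring

theorem cauchyVal_eq_add_one_left (σ τ : ℂ) (h : 1 < (σ + τ).re) :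
    (σ + τ - 1) * cauchyVal σ τ = 2 * σ * cauchyVal (σ + 1) τ := by
  rw [cauchyVal_comm σ τ, cauchyVal_comm (σ + 1) τ, add_comm σ τ,
    cauchyVal_eq_add_one_right τ σ (by rwa [add_comm])]

/-- The density `x ^ (σ - 1) e ^ (-x)` on the positive half-line, extended by zero. -/
def gammaDensity (σ : ℂ) (x : ℝ) : ℂ := ((max x 0 : ℝ) : ℂ) ^ (σ - 1) * Complex.exp (-x)

theorem gammaDensity_of_pos (σ : ℂ) {x : ℝ} (hx : 0 < x) :
    gammaDensity σ x = (x : ℂ) ^ (σ - 1) * Complex.exp (-x) := by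
  rw [gammaDensity, max_eq_left hx.le]

theorem gammaDensity_eq_indicator {σ : ℂ} (hσ : 1 < σ.re) :
    gammaDensity σ = (Ioi 0).indicator fun x : ℝ => (x : ℂ) ^ (σ - 1) * Complex.exp (-x) := by
  ext x
  by_cases hx : 0 < x
  · rw [indicator_of_mem (mem_Ioi.2 hx), gammaDensity_of_pos σ hx]
  -- For `x ≤ 0` the density is a power of zero, and it vanishes only because the exponent is
  -- nonzero.
  · have h0 : σ - 1 ≠ 0 := fun h0 => by
      have := congrArg Complex.re h0
      simp at this
      linarith
    rw [indicator_of_notMem (by simpa using hx), gammaDensity, max_eq_right (not_lt.1 hx),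
      Complex.ofReal_zero, Complex.zero_cpow h0, zero_mul]

theorem continuous_gammaDensity {σ : ℂ} (hσ : 1 < σ.re) : Continuous (gammaDensity σ) := by
  unfold gammaDensity
  refine Continuous.mul ?_ (by fun_prop)
  exact (Complex.continuous_ofReal_cpow_const (by simpa using hσ)).comp
    (continuous_id.max continuous_const)

theorem integrable_gammaDensity {σ : ℂ} (hσ : 1 < σ.re) : Integrable (gammaDensity σ) := by
  rw [gammaDensity_eq_indicator hσ, integrable_indicator_iff measurableSet_Ioi]
  refine (Complex.GammaIntegral_convergent (s := σ) (by linarith)).congr_fun (fun x _ => ?_)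
    measurableSet_Ioi
  push_cast
  ring

theorem integral_gammaDensity_mul {σ : ℂ} (hσ : 1 < σ.re) (f : ℝ → ℂ) :
    ∫ x, gammaDensity σ x * f x =
      ∫ x in Ioi (0 : ℝ), (x : ℂ) ^ (σ - 1) * Complex.exp (-x) * f x := by
  rw [gammaDensity_eq_indicator hσ, ← integral_indicator measurableSet_Ioi]
  congr 1
  ext x
  by_cases hx : 0 < x <;> simp [indicator, hx]

theorem mul_gammaDensity {σ : ℂ} (hσ : 1 < σ.re) (x : ℝ) :
    (x : ℂ) * gammaDensity σ x = gammaDensity (σ + 1) x := by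
  rw [gammaDensity_eq_indicator hσ, gammaDensity_eq_indicator (by simp; linarith)]
  by_cases hx : 0 < x
  · have hx' : (x : ℂ) ≠ 0 := by exact_mod_cast hx.ne'
    rw [indicator_of_mem (mem_Ioi.2 hx), indicator_of_mem (mem_Ioi.2 hx),
      show σ + 1 - 1 = (σ - 1) + 1 by ring, Complex.cpow_add _ _ hx', Complex.cpow_one]
    ring
  · rw [indicator_of_notMem (by simpa using hx), indicator_of_notMem (by simpa using hx), mul_zero]

theorem fourier_gammaDensity_eq_integral {σ : ℂ} (hσ : 1 < σ.re) (ξ : ℝ) :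
    𝓕 (gammaDensity σ) ξ = ∫ x in Ioi (0 : ℝ), gammaDensity σ x *
      Complex.exp (-(2 * π * Complex.I * ξ) * x) := by
  rw [Real.fourier_real_eq_integral_exp_smul]
  simp_rw [smul_eq_mul, mul_comm _ (gammaDensity σ _)]
  rw [integral_gammaDensity_mul hσ]
  refine setIntegral_congr_fun measurableSet_Ioi fun x hx => ?_
  simp only [gammaDensity_of_pos σ hx]
  congr 2
  push_cast
  ring

theorem integrableOn_gammaDensity_mul_exp {σ : ℂ} (hσ : 1 < σ.re) (ξ : ℝ) :
    IntegrableOn (fun x : ℝ => gammaDensity σ x * Complex.exp (-(2 * π * Complex.I * ξ) * x))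
      (Ioi 0) := by
  refine (integrable_gammaDensity hσ).integrableOn.mul_bdd (c := 1)
    (Continuous.aestronglyMeasurable (by fun_prop)) (Eventually.of_forall fun x => ?_)
  rw [Complex.norm_exp]
  simp

theorem tendsto_gammaDensity_mul_exp (σ : ℂ) (ξ : ℝ) :
    Tendsto (fun x : ℝ => gammaDensity σ x * Complex.exp (-(2 * π * Complex.I * ξ) * x))
      atTop (𝓝 0) := by
  have h := tendsto_rpow_mul_exp_neg_mul_atTop_nhds_zero (σ.re - 1) 1 one_pos
  refine squeeze_zero_norm' ?_ h
  filter_upwards [eventually_gt_atTop 0] with x hx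
  rw [gammaDensity_of_pos σ hx, norm_mul, norm_mul, Complex.norm_cpow_eq_rpow_re_of_pos hx,
    Complex.norm_exp, Complex.norm_exp]
  simp

/-- Integration by parts: the derivative of `x ^ σ e ^ (-x) e ^ (-2πiξx)` integrates to zero over
the half-line. -/
theorem fourier_gammaDensity_add_one {σ : ℂ} (hσ : 1 < σ.re) (ξ : ℝ) :
    (1 + Complex.I * (2 * π * ξ : ℝ)) * 𝓕 (gammaDensity (σ + 1)) ξ =
      σ * 𝓕 (gammaDensity σ) ξ := by
  have hσ' : 1 < (σ + 1).re := by simp; linarith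
  have hσ0 : σ ≠ 0 := by rintro rfl; simp at hσ; linarith
  have h1 := (integrableOn_gammaDensity_mul_exp hσ ξ).const_mul σ
  have h2 := (integrableOn_gammaDensity_mul_exp hσ' ξ).const_mul
    (1 + Complex.I * (2 * π * ξ : ℝ))
  have h3 := integral_Ioi_of_hasDerivAt_of_tendsto (a := 0)
    (f := fun x : ℝ => gammaDensity (σ + 1) x * Complex.exp (-(2 * π * Complex.I * ξ) * x))
    (((continuous_gammaDensity hσ').mul (by fun_prop)).continuousWithinAt)
    (fun x hx => ?_) (h1.sub h2) (tendsto_gammaDensity_mul_exp (σ + 1) ξ)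
  · rw [integral_sub' h1 h2, integral_const_mul, integral_const_mul,
      ← fourier_gammaDensity_eq_integral hσ, ← fourier_gammaDensity_eq_integral hσ',
      ← mul_gammaDensity hσ] at h3
    simp only [Complex.ofReal_zero, zero_mul, sub_zero] at h3
    linear_combination -h3
  · have hx0 : 0 < x := hx
    have h0 : HasDerivAt (fun s : ℝ => (s : ℂ)) 1 x := Complex.ofRealCLM.hasDerivAt
    have h4 : HasDerivAt (fun x : ℝ => (x : ℂ) ^ σ) (σ * (x : ℂ) ^ (σ - 1)) x :=
      hasDerivAt_ofReal_cpow_const hx0.ne' hσ0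
    have h5 : HasDerivAt (fun x : ℝ => Complex.exp (-(x : ℂ))) (Complex.exp (-x) * -1) x :=
      h0.neg.cexp
    have h6 : HasDerivAt (fun x : ℝ => Complex.exp (-(2 * π * Complex.I * ξ) * x))
        (Complex.exp (-(2 * π * Complex.I * ξ) * x) * (-(2 * π * Complex.I * ξ) * 1)) x :=
      (h0.const_mul _).cexp
    have h7 := (h4.mul h5).mul h6
    refine (h7.congr_of_eventuallyEq ?_).congr_deriv ?_
    · filter_upwards [eventually_gt_nhds hx0] with y hy
      simp only [gammaDensity_of_pos _ hy, add_sub_cancel_right, Pi.mul_apply]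
    · simp only [Pi.sub_apply, Pi.mul_apply, gammaDensity_of_pos _ hx0, add_sub_cancel_right]
      push_cast
      ring

/-- Differentiation under the integral raises `σ` by one, and `fourier_gammaDensity_add_one` lowers
it again. This is a first order linear equation saying that the transform times `(1 + 2πiξ) ^ σ` is
constant; its value at `0` is the Gamma integral. -/
theorem fourier_gammaDensity {σ : ℂ} (hσ : 1 < σ.re) (ξ : ℝ) :
    𝓕 (gammaDensity σ) ξ = Complex.Gamma σ * cauchyKernel σ 0 (1, 2 * π * ξ) := by
  have hσ' : 1 < (σ + 1).re := by simp; linarith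
  have hne : ∀ ξ : ℝ, 1 + Complex.I * (2 * π * ξ : ℝ) ≠ 0 := fun ξ => one_add_I_mul_ne_zero _
  have h1 : ∀ ξ : ℝ, HasDerivAt (𝓕 (gammaDensity σ))
      (-2 * π * Complex.I * 𝓕 (gammaDensity (σ + 1)) ξ) ξ := by
    intro ξ
    have hx : (fun x : ℝ => x • gammaDensity σ x) = gammaDensity (σ + 1) := by
      ext x
      rw [Complex.real_smul, mul_gammaDensity hσ]
    have h := Real.hasDerivAt_fourier (integrable_gammaDensity hσ)
      (by rw [hx]; exact integrable_gammaDensity hσ') ξ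
    refine h.congr_deriv ?_
    have hx' : (fun x : ℝ => (-2 * π * Complex.I * x) • gammaDensity σ x) =
        fun x => (-2 * π * Complex.I) • gammaDensity (σ + 1) x := by
      ext x
      rw [smul_eq_mul, mul_assoc, mul_gammaDensity hσ, smul_eq_mul]
    rw [hx', Real.fourier_real_eq_integral_exp_smul, Real.fourier_real_eq_integral_exp_smul,
      ← integral_const_mul]
    refine integral_congr_ae (Eventually.of_forall fun x => ?_)
    simp only [smul_eq_mul]
    ring
  have h2 : ∀ ξ : ℝ, HasDerivAt
      (fun ξ => 𝓕 (gammaDensity σ) ξ * (1 + Complex.I * (2 * π * ξ : ℝ)) ^ σ) 0 ξ := by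
    intro ξ
    have h0 : HasDerivAt (fun ξ : ℝ => 1 + Complex.I * ((2 * π * ξ : ℝ) : ℂ))
        (Complex.I * (2 * π)) ξ := by
      have : HasDerivAt (fun ξ : ℝ => ((2 * π * ξ : ℝ) : ℂ)) ((2 * π * 1 : ℝ) : ℂ) ξ :=
        ((hasDerivAt_id ξ).const_mul (2 * π)).ofReal_comp
      refine ((this.const_mul Complex.I).const_add 1).congr_deriv ?_
      push_cast
      ring
    have hz : HasDerivAt (fun z : ℂ => z ^ σ) (σ * (1 + Complex.I * (2 * π * ξ : ℝ)) ^ (σ - 1))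
        (1 + Complex.I * (2 * π * ξ : ℝ)) :=
      (Complex.hasStrictDerivAt_cpow_const (Or.inl (by simp [-Complex.ofReal_mul]))).hasDerivAt
    refine ((h1 ξ).mul (hz.comp ξ h0)).congr_deriv ?_
    have h3 := fourier_gammaDensity_add_one hσ ξ
    rw [Function.comp_apply, Complex.cpow_sub _ _ (hne ξ), Complex.cpow_one]
    have h4 := hne ξ
    generalize (1 + Complex.I * ((2 * π * ξ : ℝ) : ℂ)) = z at h3 h4 ⊢
    field_simp
    linear_combination (-2 * π * Complex.I * z ^ σ) * h3
  have h3 := is_const_of_deriv_eq_zero (fun ξ => (h2 ξ).differentiableAt) (fun ξ => (h2 ξ).deriv)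
    ξ 0
  have h4 : 𝓕 (gammaDensity σ) 0 = Complex.Gamma σ := by
    rw [fourier_gammaDensity_eq_integral hσ, Complex.Gamma_eq_integral (by linarith),
      Complex.GammaIntegral]
    refine setIntegral_congr_fun measurableSet_Ioi fun x hx => ?_
    simp only [gammaDensity_of_pos σ hx]
    simp [mul_comm]
  rw [h4] at h3
  simp only [mul_zero, Complex.ofReal_zero, add_zero, Complex.one_cpow, mul_one] at h3
  rw [cauchyKernel_one, Complex.cpow_neg, ← h3, neg_zero, Complex.cpow_zero, mul_one, mul_assoc,
    mul_inv_cancel₀, mul_one]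
  simp [Complex.cpow_eq_zero_iff, -Complex.ofReal_mul, hne]

theorem integrable_fourier_gammaDensity {σ : ℂ} (hσ : 1 < σ.re) :
    Integrable (𝓕 (gammaDensity σ)) := by
  have h := (integrable_cauchyKernel (σ := σ) (τ := 0) (by simpa using hσ)).comp_mul_left'
    (R := 2 * π) (by positivity)
  refine (h.const_mul (Complex.Gamma σ)).congr (Eventually.of_forall fun ξ => ?_)
  rw [fourier_gammaDensity hσ]

/-- Up to Gamma factors the two halves of the kernel are the Fourier transform and the inverse
Fourier transform of two Gamma densities. Moving the transform from one factor to the other and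
using Fourier inversion gives the integral of the product of the densities, a Gamma integral with
rate `2`. The real parts exceed `1` so that the densities are continuous and their transforms
integrable. -/
theorem cauchyInt_eq_of_large {σ τ : ℂ} (hσ : 1 < σ.re) (hτ : 1 < τ.re) :
    cauchyInt σ τ = cauchyVal σ τ := by
  have hGσ := Complex.Gamma_ne_zero_of_re_pos (show 0 < σ.re by linarith)
  have hGτ := Complex.Gamma_ne_zero_of_re_pos (show 0 < τ.re by linarith)
  have h1 : ∀ ξ : ℝ, 𝓕⁻ (gammaDensity τ) ξ =
      Complex.Gamma τ * (1 - Complex.I * (2 * π * ξ : ℝ)) ^ (-τ) := by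
    intro ξ
    rw [Real.fourierInv_eq_fourier_neg, fourier_gammaDensity hτ, cauchyKernel_one]
    simp [sub_eq_add_neg]
  have h2 : Integrable (𝓕⁻ (gammaDensity τ)) := by
    have := (integrable_fourier_gammaDensity hτ).comp_neg
    exact this.congr (Eventually.of_forall fun ξ => (Real.fourierInv_eq_fourier_neg _ _).symm)
  have h3 := VectorFourier.integral_fourierIntegral_smul_eq_flip (e := Real.fourierChar)
    (L := innerₗ ℝ) (μ := volume) (ν := volume) (f := gammaDensity σ) (g := 𝓕⁻ (gammaDensity τ))
    Real.continuous_fourierChar continuous_inner (integrable_gammaDensity hσ) h2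
  rw [flip_innerₗ] at h3
  change ∫ ξ, 𝓕 (gammaDensity σ) ξ • 𝓕⁻ (gammaDensity τ) ξ =
    ∫ x, gammaDensity σ x • 𝓕 (𝓕⁻ (gammaDensity τ)) x at h3
  rw [(continuous_gammaDensity hτ).fourier_fourierInv_eq (integrable_gammaDensity hτ)
    (integrable_fourier_gammaDensity hτ)] at h3
  have h4 : ∀ ξ : ℝ, 𝓕 (gammaDensity σ) ξ • 𝓕⁻ (gammaDensity τ) ξ =
      Complex.Gamma σ * Complex.Gamma τ * cauchyKernel σ τ (1, 2 * π * ξ) := by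
    intro ξ
    rw [h1, fourier_gammaDensity hσ, cauchyKernel_one, cauchyKernel_one, smul_eq_mul]
    simp
    ring
  have h5 : ∀ x ∈ Ioi (0 : ℝ), (x : ℂ) ^ (σ - 1) * Complex.exp (-x) * gammaDensity τ x =
      (x : ℂ) ^ (σ + τ - 1 - 1) * Complex.exp (-((2 : ℝ) * x)) := by
    intro x (hx : 0 < x)
    have hx' : (x : ℂ) ≠ 0 := by exact_mod_cast hx.ne'
    rw [gammaDensity_of_pos τ hx, show σ + τ - 1 - 1 = (σ - 1) + (τ - 1) by ring,
      Complex.cpow_add _ _ hx', show -(((2 : ℝ) : ℂ) * x) = -x + -x by push_cast; ring,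
      Complex.exp_add]
    ring
  simp_rw [h4, smul_eq_mul] at h3
  rw [integral_const_mul, Measure.integral_comp_mul_left (fun s => cauchyKernel σ τ (1, s)),
    ← cauchyInt, integral_gammaDensity_mul hσ, setIntegral_congr_fun measurableSet_Ioi h5,
    Complex.integral_cpow_mul_exp_neg_mul_Ioi (by simp; linarith) (by simp)] at h3
  have h6 : (1 / ((2 : ℝ) : ℂ)) ^ (σ + τ - 1) * 2 = (2 : ℂ) ^ (2 - σ - τ) := by
    rw [one_div, Complex.inv_cpow _ _ (by
      rw [Complex.arg_ofReal_of_nonneg (by norm_num)]; exact pi_pos.ne), ← Complex.cpow_neg,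
      show 2 - σ - τ = -(σ + τ - 1) + 1 by ring, Complex.cpow_add _ _ two_ne_zero,
      Complex.cpow_one]
    simp
  have hπ : (π : ℂ) ≠ 0 := by exact_mod_cast pi_pos.ne'
  rw [abs_of_pos (by positivity), Complex.real_smul] at h3
  push_cast at h3 h6
  rw [cauchyVal, ← h6]
  field_simp at h3 ⊢
  linear_combination h3

theorem cauchyInt_eq {σ τ : ℂ} (h : 1 < (σ + τ).re) : cauchyInt σ τ = cauchyVal σ τ := by
  have h0 : ∀ σ τ : ℂ, 1 < (σ + τ).re → σ + τ - 1 ≠ 0 := fun σ τ h h0 => by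
    have := congrArg Complex.re h0
    simp at this h
    linarith
  -- Each induction step raises both exponents by one, first `σ` and then `τ`. Integral and closed
  -- form satisfy the same relations, whose left coefficient `σ + τ - 1` has positive real part
  -- throughout.
  have key : ∀ (N : ℕ) (σ τ : ℂ), 1 < (σ + τ).re → 1 < σ.re + N → 1 < τ.re + N →
      cauchyInt σ τ = cauchyVal σ τ := by
    intro N
    induction N with
    | zero =>
      intro σ τ _ h1 h2
      exact cauchyInt_eq_of_large (by simpa using h1) (by simpa using h2)
    | succ N ih =>
      intro σ τ h h1 h2
      push_cast at h1 h2
      have h3 : 1 < (σ + 1 + τ).re := by simp at h ⊢; linarith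
      have h4 : 1 < (σ + 1 + (τ + 1)).re := by simp at h ⊢; linarith
      have h5 := ih (σ + 1) (τ + 1) h4 (by simp; linarith) (by simp; linarith)
      have h6 : cauchyInt (σ + 1) τ = cauchyVal (σ + 1) τ := by
        refine mul_left_cancel₀ (h0 _ _ h3) ?_
        rw [cauchyInt_eq_add_one_right _ _ h3, cauchyVal_eq_add_one_right _ _ h3, h5]
      refine mul_left_cancel₀ (h0 _ _ h) ?_
      rw [cauchyInt_eq_add_one_left _ _ h, cauchyVal_eq_add_one_left _ _ h, h6]
  obtain ⟨N₁, hN₁⟩ := exists_nat_gt (1 - σ.re)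
  obtain ⟨N₂, hN₂⟩ := exists_nat_gt (1 - τ.re)
  refine key (max N₁ N₂) σ τ h ?_ ?_
  · have : (N₁ : ℝ) ≤ (max N₁ N₂ : ℕ) := by exact_mod_cast le_max_left _ _
    linarith
  · have : (N₂ : ℝ) ≤ (max N₁ N₂ : ℕ) := by exact_mod_cast le_max_right _ _
    linarith

theorem integral_cauchyKernel {σ τ : ℂ} (h : 1 < (σ + τ).re) {w : ℝ} (hw : 0 < w) :
    ∫ s, cauchyKernel σ τ (w, s) = cauchyVal σ τ * (w : ℂ) ^ (-(σ + τ - 1)) := by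
  have hw' : (w : ℂ) ≠ 0 := by exact_mod_cast hw.ne'
  simp_rw [cauchyKernel_hom σ τ w hw]
  rw [integral_const_mul, Measure.integral_comp_smul volume (fun s => cauchyKernel σ τ (1, s)),
    ← cauchyInt, cauchyInt_eq h, show -(σ + τ - 1) = -(σ + τ) + 1 by ring,
    Complex.cpow_add _ _ hw', Complex.cpow_one]
  simp [abs_of_pos hw]
  ring

theorem lintegral_cauchyKernel_ne_top {σ τ : ℂ} (h : 1 < (σ + τ).re) :
    ∫⁻ s, ‖cauchyKernel σ τ (1, s)‖ₑ ≠ ⊤ :=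
  (integrable_cauchyKernel h).2.ne

end CauchyBeta

/-! ### From powers of leading minors to powers of pivots -/

section PivotExp

/-- Summation by parts for the parameter differences. -/
theorem sum_paramDiff_mul {n : ℕ} (a : Fin n → ℂ) (l : ℕ → ℂ) (h0 : l 0 = 0) :
    ∑ j : Fin n, paramDiff a j * l (j + 1) = ∑ j : Fin n, a j * (l (j + 1) - l j) := by
  -- The extension by zero is the convention that the parameter with index `n + 1` vanishes; it
  -- kills the upper boundary term.
  let A : ℕ → ℂ := fun k => if h : k < n then a ⟨k, h⟩ else 0
  have h1 : ∀ j : Fin n, paramDiff a j = A j - A (j + 1) := fun j => by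
    simp [paramDiff, A]
  have h2 : ∀ j : Fin n, a j = A j := fun j => by simp [A]
  simp_rw [h1, h2]
  rw [← sub_eq_zero, ← Finset.sum_sub_distrib,
    Fin.sum_univ_eq_sum_range (fun j => (A j - A (j + 1)) * l (j + 1) - A j * (l (j + 1) - l j)) n]
  have h3 := Finset.sum_range_sub' (fun j => A j * l j) n
  rw [h0, mul_zero, show A n = 0 by simp [A], zero_mul, sub_zero] at h3
  rw [← h3]
  exact Finset.sum_congr rfl fun j _ => by ring

/-- The product of powers of pivots, in terms of the logarithms `l p` and `m p` of the leading
principal minors. -/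
def pivotExp {n : ℕ} (lam σ τ : Fin n → ℂ) (l m : ℕ → ℂ) : ℂ :=
  Complex.exp (∑ j : Fin n, (lam j * (l (j + 1) - l j) - σ j * (m (j + 1) - m j) -
    τ j * (starRingEnd ℂ) (m (j + 1) - m j)))

theorem pivotExp_ne_zero {n : ℕ} (lam σ τ : Fin n → ℂ) (l m : ℕ → ℂ) :
    pivotExp lam σ τ l m ≠ 0 := Complex.exp_ne_zero _

theorem pivotExp_eq_exp_paramDiff {n : ℕ} (lam σ τ : Fin n → ℂ) {l m : ℕ → ℂ} (hl : l 0 = 0)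
    (hm : m 0 = 0) :
    pivotExp lam σ τ l m = Complex.exp (∑ j : Fin n, (paramDiff lam j * l (j + 1) -
      paramDiff σ j * m (j + 1) - paramDiff τ j * (starRingEnd ℂ) (m (j + 1)))) := by
  have h := sum_paramDiff_mul τ (fun p => (starRingEnd ℂ) (m p)) (by simp [hm])
  simp only [pivotExp, Finset.sum_sub_distrib, map_sub]
  rw [sum_paramDiff_mul lam l hl, sum_paramDiff_mul σ m hm, h]

theorem pivotExp_succ {n : ℕ} (lam σ τ : Fin (n + 1) → ℂ) {l m l' m' : ℕ → ℂ}
    (hl : ∀ p ≤ n, l' p = l p) (hm : ∀ p ≤ n, m' p = m p) :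
    pivotExp lam σ τ l' m' =
      pivotExp (fun j : Fin n => lam j.castSucc) (fun j => σ j.castSucc) (fun j => τ j.castSucc)
        l m * Complex.exp (lam (Fin.last n) * (l' (n + 1) - l n) -
          σ (Fin.last n) * (m' (n + 1) - m n) -
          τ (Fin.last n) * (starRingEnd ℂ) (m' (n + 1) - m n)) := by
  rw [pivotExp, pivotExp, ← Complex.exp_add, Fin.sum_univ_castSucc]
  congr 2
  · refine Finset.sum_congr rfl fun j _ => ?_
    simp only [Fin.val_castSucc]
    rw [hl _ j.isLt, hl _ j.isLt.le, hm _ j.isLt, hm _ j.isLt.le]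
  · rw [Fin.val_last, hl _ le_rfl, hm _ le_rfl]

/-- The logarithms of the pivots telescope, so a common shift of the parameters multiplies by powers
of the full determinants. This absorbs the invariant density `det T ^ (-(n + 1))` or `det T ^ (-(2 n
+ 1))`, and later `pairWeight`, into the parameters. -/
theorem pivotExp_shift {n : ℕ} (lam σ τ : Fin n → ℂ) {l m : ℕ → ℂ} (hl : l 0 = 0)
    (hm : m 0 = 0) (c d e : ℂ) :
    pivotExp (fun j => lam j + c) (fun j => σ j + d) (fun j => τ j + e) l m =
      pivotExp lam σ τ l m *
        Complex.exp (c * l n - d * m n - e * (starRingEnd ℂ) (m n)) := by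
  rw [pivotExp, pivotExp, ← Complex.exp_add]
  congr 1
  have h : ∀ k : ℕ → ℂ, k 0 = 0 → ∑ j : Fin n, (k (j + 1) - k j) = k n := fun k hk => by
    rw [Fin.sum_univ_eq_sum_range (fun j => k (j + 1) - k j) n, Finset.sum_range_sub, hk, sub_zero]
  have h1 := h l hl
  have h2 := h m hm
  have h3 := h (fun p => (starRingEnd ℂ) (m p)) (by simp [hm])
  rw [← h3, ← h1, ← h2, Finset.mul_sum, Finset.mul_sum, Finset.mul_sum, ← Finset.sum_sub_distrib,
    ← Finset.sum_sub_distrib, ← Finset.sum_add_distrib]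
  refine Finset.sum_congr rfl fun j _ => ?_
  simp only [map_sub]
  ring

end PivotExp

/-! ### The branch of `log det` on dissipative matrices -/

section LogDet

/-- Makes `logDet` explicit along the segment from the identity to `M`: the eigenvalues move along
segments with fixed multiplicities, so its continuity needs no perturbation theory of roots. -/
theorem roots_charpoly_add_smul {n : ℕ} (M : Matrix (Fin n) (Fin n) ℂ) (a b : ℂ) :
    (a • (1 : Matrix (Fin n) (Fin n) ℂ) + b • M).charpoly.roots =
      M.charpoly.roots.map fun μ => a + b * μ := by
  have hcard : M.charpoly.roots.card = n := by
    rw [← (IsAlgClosed.splits M.charpoly).natDegree_eq_card_roots, charpoly_natDegree_eq_dim,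
      Fintype.card_fin]
  have hM : ∀ x : ℂ, (scalar (Fin n) x - M).det = (M.charpoly.roots.map fun μ => x - μ).prod := by
    intro x
    rw [← eval_charpoly]
    conv_lhs => rw [(IsAlgClosed.splits M.charpoly).eq_prod_roots_of_monic M.charpoly_monic]
    rw [Polynomial.eval_multiset_prod, Multiset.map_map]
    simp
  suffices h : (a • (1 : Matrix (Fin n) (Fin n) ℂ) + b • M).charpoly =
      ((M.charpoly.roots.map fun μ => a + b * μ).map fun ν => Polynomial.X - Polynomial.C ν).prod by
    rw [h, Polynomial.roots_multiset_prod_X_sub_C]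
  refine Polynomial.funext fun x => ?_
  rw [eval_charpoly, Polynomial.eval_multiset_prod, Multiset.map_map, Multiset.map_map]
  simp only [Function.comp_apply, Polynomial.eval_sub, Polynomial.eval_X, Polynomial.eval_C]
  by_cases hb : b = 0
  · subst hb
    have h1 : scalar (Fin n) x - (a • (1 : Matrix (Fin n) (Fin n) ℂ) + (0 : ℂ) • M) =
        (x - a) • (1 : Matrix (Fin n) (Fin n) ℂ) := by
      rw [scalar_apply, ← smul_one_eq_diagonal, sub_smul]
      simp
    rw [h1, det_smul, det_one]
    simp [hcard]
  · have h1 : scalar (Fin n) x - (a • (1 : Matrix (Fin n) (Fin n) ℂ) + b • M) =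
        b • (scalar (Fin n) ((x - a) / b) - M) := by
      rw [scalar_apply, scalar_apply, ← smul_one_eq_diagonal, ← smul_one_eq_diagonal, smul_sub,
        smul_smul, mul_div_cancel₀ _ hb, sub_smul]
      abel
    rw [h1, det_smul, hM, Fintype.card_fin]
    have h2 : b ^ n = (M.charpoly.roots.map fun _ => b).prod := by simp [hcard]
    rw [h2, ← Multiset.prod_map_mul]
    congr 1
    refine Multiset.map_congr rfl fun μ _ => ?_
    field_simp
    ring

/-- A complex matrix with positive definite hermitian part. -/
def IsDissipative {n : ℕ} (R : Matrix (Fin n) (Fin n) ℂ) : Prop :=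
  ∀ x : Fin n → ℂ, x ≠ 0 → 0 < (star x ⬝ᵥ R *ᵥ x).re

theorem star_dotProduct_self_re_pos {n : ℕ} {x : Fin n → ℂ} (hx : x ≠ 0) :
    0 < (star x ⬝ᵥ x).re := by
  have h := (PosDef.one (n := Fin n) (R := ℂ)).dotProduct_mulVec_pos hx
  rw [one_mulVec] at h
  exact (Complex.pos_iff.1 h).1

theorem IsDissipative.re_root_pos {n : ℕ} {R : Matrix (Fin n) (Fin n) ℂ} (hR : IsDissipative R)
    {μ : ℂ} (hμ : μ ∈ R.charpoly.roots) : 0 < μ.re := by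
  have h1 : (scalar (Fin n) μ - R).det = 0 := by
    rw [← eval_charpoly]
    exact (Polynomial.mem_roots'.1 hμ).2
  obtain ⟨v, hv, h2⟩ := exists_mulVec_eq_zero_iff.2 h1
  rw [sub_mulVec, sub_eq_zero, scalar_apply, ← smul_one_eq_diagonal, smul_mulVec, one_mulVec] at h2
  have h3 := hR v hv
  have h4 := star_dotProduct_self_re_pos hv
  have h5 : (star v ⬝ᵥ v).im = 0 := by
    have := (PosSemidef.one (n := Fin n) (R := ℂ)).dotProduct_mulVec_nonneg v
    rw [one_mulVec] at this
    exact (Complex.nonneg_iff.1 this).2.symm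
  rw [← h2, dotProduct_smul, smul_eq_mul, Complex.mul_re, h5, mul_zero, sub_zero] at h3
  exact pos_of_mul_pos_left h3 h4.le

theorem IsDissipative.exp_logDet {n : ℕ} {R : Matrix (Fin n) (Fin n) ℂ} (hR : IsDissipative R) :
    Complex.exp (logDet R) = R.det := by
  rw [logDet, Complex.exp_multiset_sum, Multiset.map_map, det_eq_prod_roots_charpoly]
  congr 1
  conv_rhs => rw [← Multiset.map_id R.charpoly.roots]
  refine Multiset.map_congr rfl fun μ hμ => ?_
  rw [Function.comp_apply, Complex.exp_log, id]
  rintro rfl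
  simpa using hR.re_root_pos hμ

theorem IsDissipative.det_ne_zero {n : ℕ} {R : Matrix (Fin n) (Fin n) ℂ} (hR : IsDissipative R) :
    R.det ≠ 0 := by
  rw [← hR.exp_logDet]
  exact Complex.exp_ne_zero _

theorem IsDissipative.segment {n : ℕ} {R : Matrix (Fin n) (Fin n) ℂ} (hR : IsDissipative R)
    {t : ℝ} (ht : t ∈ Set.Icc (0 : ℝ) 1) :
    IsDissipative (((1 - t : ℝ) : ℂ) • (1 : Matrix (Fin n) (Fin n) ℂ) + (t : ℂ) • R) := by
  intro x hx
  have h1 := hR x hx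
  have h2 := star_dotProduct_self_re_pos hx
  rw [add_mulVec, smul_mulVec, smul_mulVec, one_mulVec, dotProduct_add, dotProduct_smul,
    dotProduct_smul, smul_eq_mul, smul_eq_mul, Complex.add_re, Complex.re_ofReal_mul,
    Complex.re_ofReal_mul]
  rcases ht.1.eq_or_lt with h | h
  · rw [← h]; simpa using h2
  · have := mul_nonneg (sub_nonneg.2 ht.2) h2.le
    have := mul_pos h h1
    linarith

theorem IsDissipative.of_border {n : ℕ} {P : Matrix (Fin n) (Fin n) ℂ} {q q' : Fin n → ℂ} {r : ℂ}
    (hR : IsDissipative (border P q q' r)) : IsDissipative P := by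
  intro x hx
  have h := hR (Fin.snoc x 0 : Fin (n + 1) → ℂ) (fun h0 => hx (by
    ext i
    simpa using congrFun h0 i.castSucc))
  rw [star_snoc, border_mulVec, dotProduct_snoc] at h
  simpa using h

/-- The vector `(-P⁻¹ q, 1)` is mapped to a vector with only its last entry nonzero, which is the
pivot; the sesquilinear form at this vector is therefore the pivot. -/
theorem IsDissipative.re_pivot_pos {n : ℕ} {P : Matrix (Fin n) (Fin n) ℂ} {q q' : Fin n → ℂ}
    {r : ℂ} (hR : IsDissipative (border P q q' r)) :
    0 < ((border P q q' r).det / P.det).re := by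
  have hP := hR.of_border.det_ne_zero
  have hz : P *ᵥ P⁻¹ *ᵥ q = q := by
    rw [mulVec_mulVec, mul_nonsing_inv _ (isUnit_iff_ne_zero.2 hP), one_mulVec]
  generalize P⁻¹ *ᵥ q = z at hz
  have h := hR (Fin.snoc (-z) 1 : Fin (n + 1) → ℂ) (fun h0 => by
    simpa using congrFun h0 (Fin.last n))
  rw [star_snoc, border_mulVec, dotProduct_snoc] at h
  rw [det_border q' r hz, mul_div_cancel_left₀ _ hP]
  have h1 : P *ᵥ (-z) + (fun i => q i * 1) = 0 := by
    ext i
    simp [mulVec_neg, hz]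
  rw [h1] at h
  simpa [sub_eq_add_neg, add_comm] using h

theorem logDet_add_smul {n : ℕ} (M : Matrix (Fin n) (Fin n) ℂ) (a b : ℂ) :
    logDet (a • (1 : Matrix (Fin n) (Fin n) ℂ) + b • M) =
      (M.charpoly.roots.map fun μ => Complex.log (a + b * μ)).sum := by
  rw [logDet, roots_charpoly_add_smul, Multiset.map_map]
  rfl

theorem IsDissipative.continuous_logDet_segment {n : ℕ} {R : Matrix (Fin n) (Fin n) ℂ}
    (hR : IsDissipative R) :
    Continuous fun t : unitInterval =>
      logDet (((1 - t : ℝ) : ℂ) • (1 : Matrix (Fin n) (Fin n) ℂ) + ((t : ℝ) : ℂ) • R) := by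
  simp_rw [logDet_add_smul]
  refine continuous_multiset_sum _ fun μ hμ => ?_
  refine Continuous.clog (by fun_prop) fun t => Or.inl ?_
  have h := hR.re_root_pos hμ
  rw [Complex.add_re, Complex.ofReal_re, Complex.re_ofReal_mul]
  rcases t.2.1.eq_or_lt with h0 | h0
  · rw [← h0]; simp
  · have := mul_pos h0 h
    linarith [t.2.2]

/-- The function takes values in the discrete set `2πi ℤ`, so it is constant on the connected
interval. -/
theorem eq_zero_of_exp_eq_one {h : unitInterval → ℂ} (hc : Continuous h)
    (hexp : ∀ t, Complex.exp (h t) = 1) (h0 : h 0 = 0) : h 1 = 0 := by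
  have h1 : ∀ t, ∃ k : ℤ, h t = k * (2 * Real.pi * Complex.I) := fun t =>
    Complex.exp_eq_one_iff.1 (hexp t)
  choose k hk using h1
  have h2 : ∀ t, ((k t : ℤ) : ℝ) = (h t).im / (2 * Real.pi) := by
    intro t
    rw [hk t]
    have : (2 * Real.pi) ≠ 0 := by positivity
    simp
  have h3 : Continuous k := by
    rw [Int.isClosedEmbedding_coe_real.isEmbedding.continuous_iff]
    have : ((↑) : ℤ → ℝ) ∘ k = fun t => (h t).im / (2 * Real.pi) := funext h2
    rw [this]
    fun_prop
  have h4 : k 1 = k 0 := PreconnectedSpace.constant inferInstance h3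
  rw [hk 1, h4, ← hk 0, h0]

theorem smul_one_add_smul_border {n : ℕ} (P : Matrix (Fin n) (Fin n) ℂ) (q q' : Fin n → ℂ)
    (r a b : ℂ) :
    a • (1 : Matrix (Fin (n + 1)) (Fin (n + 1)) ℂ) + b • border P q q' r =
      border (a • 1 + b • P) (b • q) (b • q') (a + b * r) := by
  refine border_ext _ _ _ _ (fun i j => ?_) (fun i => ?_) (fun j => ?_) ?_ <;>
    simp [Matrix.one_apply, (Fin.castSucc_lt_last _).ne, (Fin.castSucc_lt_last _).ne']

/-- The branch `logDet` is the sum of the principal logarithms of the pivots. -/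
theorem IsDissipative.logDet_border {n : ℕ} {P : Matrix (Fin n) (Fin n) ℂ} {q q' : Fin n → ℂ}
    {r : ℂ} (hR : IsDissipative (border P q q' r)) :
    logDet (border P q q' r) =
      logDet P + Complex.log ((border P q q' r).det / P.det) := by
  have hP := hR.of_border
  -- Both sides are deformed along the segment from the identity. Dissipativity keeps eigenvalues
  -- and pivots in the right half-plane, so their principal logarithms stay continuous, and the
  -- difference of the two sides is a multiple of `2πi` that vanishes at the start.
  let Rt : unitInterval → Matrix (Fin (n + 1)) (Fin (n + 1)) ℂ := fun t =>
    ((1 - t : ℝ) : ℂ) • 1 + ((t : ℝ) : ℂ) • border P q q' r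
  let Pt : unitInterval → Matrix (Fin n) (Fin n) ℂ := fun t =>
    ((1 - t : ℝ) : ℂ) • 1 + ((t : ℝ) : ℂ) • P
  have hRt : ∀ t, IsDissipative (Rt t) := fun t => hR.segment t.2
  have hPt : ∀ t, IsDissipative (Pt t) := fun t => hP.segment t.2
  have hre : ∀ t, 0 < ((Rt t).det / (Pt t).det).re := fun t => by
    have := hRt t
    simp only [Rt, smul_one_add_smul_border] at this ⊢
    exact this.re_pivot_pos
  have hcR : Continuous Rt := by fun_prop
  have hcP : Continuous Pt := by fun_prop
  have hc : Continuous fun t => logDet (Rt t) - logDet (Pt t) -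
      Complex.log ((Rt t).det / (Pt t).det) := by
    refine (hR.continuous_logDet_segment.sub hP.continuous_logDet_segment).sub ?_
    exact (hcR.matrix_det.div hcP.matrix_det fun t => (hPt t).det_ne_zero).clog
      fun t => Or.inl (hre t)
  have h := eq_zero_of_exp_eq_one hc (fun t => by
    rw [Complex.exp_sub, Complex.exp_sub, (hRt t).exp_logDet, (hPt t).exp_logDet, Complex.exp_log,
      div_self]
    all_goals exact div_ne_zero (hRt t).det_ne_zero (hPt t).det_ne_zero) (by
    simp only [Rt, Pt, logDet_add_smul]
    simp)
  have h1 : Rt 1 = border P q q' r := by simp [Rt]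
  have h2 : Pt 1 = P := by simp [Pt]
  rw [h1, h2] at h
  linear_combination h

end LogDet

/-! ### The integrand for `T + i S` and its recursion -/

section RealCase

open scoped MatrixOrder Norms.L2Operator

variable {n : ℕ}

theorem complexOfPair_eq (T S : Matrix (Fin n) (Fin n) ℝ) :
    complexOfPair T S = T.map Complex.ofRealHom + Complex.I • S.map Complex.ofRealHom := by
  ext i j
  simp [complexOfPair]

theorem one_add_complexOfPair (T S : Matrix (Fin n) (Fin n) ℝ) :
    1 + complexOfPair T S = complexOfPair (1 + T) S := by
  ext i j
  by_cases h : i = j <;> simp [complexOfPair, Matrix.one_apply, h, add_assoc]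

theorem leadingBlock_one_add_complexOfPair (T S : Matrix (Fin n) (Fin n) ℝ) (p : ℕ) (hp : p ≤ n) :
    leadingBlock (1 + complexOfPair T S) p hp =
      1 + complexOfPair (leadingBlock T p hp) (leadingBlock S p hp) := by
  ext i j
  simp [complexOfPair, leadingBlock, Matrix.one_apply]

theorem complexOfPair_border (A B : Matrix (Fin n) (Fin n) ℝ) (b b' y y' : Fin n → ℝ) (c s : ℝ) :
    complexOfPair (border A b b' c) (border B y y' s) =
      border (complexOfPair A B) (fun i => b i + Complex.I * y i)
        (fun i => b' i + Complex.I * y' i) (c + Complex.I * s) :=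
  border_ext _ _ _ _ (by simp [complexOfPair]) (by simp [complexOfPair]) (by simp [complexOfPair])
    (by simp [complexOfPair])

theorem Matrix.PosDef.leadingBlock {𝕜 : Type*} [RCLike 𝕜] {T : Matrix (Fin n) (Fin n) 𝕜}
    (hT : T.PosDef) (p : ℕ) (hp : p ≤ n) : (leadingBlock T p hp).PosDef :=
  hT.submatrix (Fin.castLE_injective hp)

theorem leadingBlock_isSymm {α : Type*} {S : Matrix (Fin n) (Fin n) α} (hS : S.IsSymm) (p : ℕ)
    (hp : p ≤ n) : (leadingBlock S p hp).IsSymm :=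
  hS.submatrix _

/-- For real symmetric `S` the term `i S` has a purely imaginary sesquilinear form, and the form of
`T` is nonnegative on complex vectors as well by a factorization `T = Lᴴ L`. -/
theorem isDissipative_one_add_complexOfPair {T S : Matrix (Fin n) (Fin n) ℝ} (hT : T.PosDef)
    (hS : S.IsSymm) : IsDissipative (1 + complexOfPair T S) := by
  intro x hx
  have h1 := star_dotProduct_self_re_pos hx
  have h2 : 0 ≤ (star x ⬝ᵥ T.map Complex.ofRealHom *ᵥ x).re := by
    obtain ⟨L, hL⟩ := CStarAlgebra.nonneg_iff_eq_star_mul_self.mp hT.posSemidef.nonneg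
    rw [star_eq_conjTranspose] at hL
    subst hL
    have h4 : (Lᴴ * L).map Complex.ofRealHom =
        (L.map Complex.ofRealHom)ᴴ * L.map Complex.ofRealHom := by
      rw [Matrix.map_mul]
      congr 1
      ext i j
      simp [conjTranspose_apply]
    rw [h4]
    exact (Complex.nonneg_iff.1
      ((posSemidef_conjTranspose_mul_self _).dotProduct_mulVec_nonneg x)).1
  have h3 : (star x ⬝ᵥ S.map Complex.ofRealHom *ᵥ x).im = 0 := by
    have hH : (S.map Complex.ofRealHom).IsHermitian := by
      ext i j
      simp [conjTranspose_apply, hS.apply]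
    exact hH.im_star_dotProduct_mulVec_self x
  rw [complexOfPair_eq, add_mulVec, add_mulVec, one_mulVec, smul_mulVec, dotProduct_add,
    dotProduct_add, dotProduct_smul, smul_eq_mul, Complex.add_re, Complex.add_re, Complex.I_mul_re,
    h3]
  linarith

/-- The logarithms of the leading principal minors of a positive definite matrix. -/
def logMinor {𝕜 : Type*} [RCLike 𝕜] (T : Matrix (Fin n) (Fin n) 𝕜) (p : ℕ) : ℂ :=
  if h : p ≤ n then (Real.log (reDet (leadingBlock T p h)) : ℂ) else 0

theorem logMinor_zero {𝕜 : Type*} [RCLike 𝕜] (T : Matrix (Fin n) (Fin n) 𝕜) :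
    logMinor T 0 = 0 := by
  simp [logMinor, reDet]

theorem logMinor_self {𝕜 : Type*} [RCLike 𝕜] (T : Matrix (Fin n) (Fin n) 𝕜) :
    logMinor T n = Real.log (reDet T) := by
  rw [logMinor, dif_pos le_rfl, leadingBlock_self]

theorem logMinor_border {𝕜 : Type*} [RCLike 𝕜] (A : Matrix (Fin n) (Fin n) 𝕜) (b b' : Fin n → 𝕜)
    (c : 𝕜) {p : ℕ} (hp : p ≤ n) : logMinor (border A b b' c) p = logMinor A p := by
  rw [logMinor, logMinor, dif_pos hp, dif_pos (hp.trans n.le_succ), leadingBlock_border _ _ _ _ p hp]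

theorem logMinor_border_last {𝕜 : Type*} [RCLike 𝕜] {A : Matrix (Fin n) (Fin n) 𝕜} (hA : A.PosDef)
    (b : Fin n → 𝕜) {c : ℝ} (hc : quadForm A⁻¹ b < c) :
    logMinor (border A b (star b) (c : 𝕜)) (n + 1) - logMinor A n =
      Real.log (c - quadForm A⁻¹ b) := by
  rw [logMinor_self, logMinor_self, reDet_border hA,
    Real.log_mul (reDet_pos hA).ne' (sub_pos.2 hc).ne']
  push_cast
  ring

/-- The branches of the logarithms of the leading principal minors of `1 + T + i S`. -/
def logDetMinor (T S : Matrix (Fin n) (Fin n) ℝ) (p : ℕ) : ℂ :=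
  if h : p ≤ n then logDet (1 + complexOfPair (leadingBlock T p h) (leadingBlock S p h)) else 0

theorem logDetMinor_zero (T S : Matrix (Fin n) (Fin n) ℝ) : logDetMinor T S 0 = 0 := by
  simp [logDetMinor, logDet]

theorem logDetMinor_self (T S : Matrix (Fin n) (Fin n) ℝ) :
    logDetMinor T S n = logDet (1 + complexOfPair T S) := by
  rw [logDetMinor, dif_pos le_rfl, leadingBlock_self, leadingBlock_self]

theorem logDetMinor_border (A B : Matrix (Fin n) (Fin n) ℝ) (b b' y y' : Fin n → ℝ) (c s : ℝ)
    {p : ℕ} (hp : p ≤ n) :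
    logDetMinor (border A b b' c) (border B y y' s) p = logDetMinor A B p := by
  rw [logDetMinor, logDetMinor, dif_pos hp, dif_pos (hp.trans n.le_succ),
    leadingBlock_border _ _ _ _ p hp, leadingBlock_border _ _ _ _ p hp]

theorem ofReal_cpow_eq_exp {x : ℝ} (hx : 0 < x) (r : ℂ) :
    (x : ℂ) ^ r = Complex.exp (r * Real.log x) := by
  rw [Complex.cpow_def_of_ne_zero (by exact_mod_cast hx.ne'), Complex.ofReal_log hx.le, mul_comm]

theorem ofReal_zpow_eq_exp {x : ℝ} (hx : 0 < x) (k : ℤ) :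
    (x : ℂ) ^ k = Complex.exp (k * Real.log x) := by
  rw [← Complex.cpow_intCast, ofReal_cpow_eq_exp hx]

theorem realIntegrand_eq_pivotExp (lam σ τ : Fin n → ℂ) {T : Matrix (Fin n) (Fin n) ℝ}
    (hT : T.PosDef) (S : Matrix (Fin n) (Fin n) ℝ) :
    realIntegrand lam σ τ (T, S) =
      pivotExp (fun j => lam j + -((n : ℂ) + 1)) σ τ (logMinor T) (logDetMinor T S) := by
  have h := pivotExp_shift lam σ τ (logMinor_zero T) (logDetMinor_zero T S) (-((n : ℂ) + 1)) 0 0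
  simp only [add_zero] at h
  rw [h, pivotExp_eq_exp_paramDiff _ _ _ (logMinor_zero T) (logDetMinor_zero T S), realIntegrand,
    Complex.exp_sum]
  have hdet : ∀ {p : ℕ} (M : Matrix (Fin p) (Fin p) ℝ), M.det = reDet M := fun _ => rfl
  congr 1
  · refine Finset.prod_congr rfl fun j _ => ?_
    rw [hdet, ofReal_cpow_eq_exp (reDet_pos (hT.leadingBlock _ _)), detBipow,
      leadingBlock_one_add_complexOfPair, ← Complex.exp_add, ← Complex.exp_sub, logMinor,
      dif_pos (show (j : ℕ) + 1 ≤ n from j.isLt), logDetMinor,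
      dif_pos (show (j : ℕ) + 1 ≤ n from j.isLt)]
    congr 1
    ring
  · rw [hdet, ofReal_zpow_eq_exp (reDet_pos hT), logMinor_self]
    congr 1
    push_cast
    ring

/-- Over `ℝ` conjugation is trivial and `i` satisfies the only relation of `j` that the elimination
uses, so `solFst + i solSnd` solves the column equation. -/
theorem det_one_add_complexOfPair_border {A B : Matrix (Fin n) (Fin n) ℝ} (hA : A.PosDef)
    (hB : B.IsSymm) (b y : Fin n → ℝ) (c s : ℝ) :
    (1 + complexOfPair (border A b (star b) c) (border B y y s)).det =
      (1 + complexOfPair A B).det *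
        (((1 + (c - quadForm A⁻¹ b) + pivotForm A B b y : ℝ) : ℂ) +
          Complex.I * (s - pivotShift A B b y : ℝ)) := by
  have h1 := mulVec_solFst hA B b y
  have h2 := mulVec_solSnd_add hA hB b y
  have h3 := pivotForm_eq hA hB b y c
  simp only [star_trivial, RCLike.ofReal_real_eq_id, id] at h1 h2 h3 ⊢
  rw [one_add_complexOfPair, one_add_border, complexOfPair_border,
    det_border (z := fun i => ((solFst A B b y i : ℝ) : ℂ) + Complex.I * ((solSnd A B b y i : ℝ) : ℂ)),
    ← one_add_complexOfPair]
  · congr 1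
    rw [h3, pivotShift]
    simp only [dotProduct, star_trivial, Complex.ofReal_add, Complex.ofReal_sub, Complex.ofReal_sum,
      Complex.ofReal_mul, Complex.ofReal_one, add_mul, mul_add, Finset.sum_add_distrib,
      Finset.mul_sum, mul_sub]
    have h4 : ∀ p q : ℂ, Complex.I * p * (Complex.I * q) = -(p * q) := fun p q => by
      linear_combination p * q * Complex.I_mul_I
    simp only [h4, Finset.sum_neg_distrib, mul_left_comm _ Complex.I, mul_assoc]
    ring
  · ext i
    have h5 := congrFun h1 i
    have h6 := congrFun h2 i
    simp only [mulVec, dotProduct, complexOfPair, Matrix.of_apply, Pi.add_apply] at h5 h6 ⊢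
    rw [← h6, eq_sub_of_add_eq h5.symm]
    push_cast
    simp only [add_mul, mul_add, Finset.sum_add_distrib, Finset.mul_sum]
    have h4 : ∀ p q : ℂ, Complex.I * p * (Complex.I * q) = -(p * q) := fun p q => by
      linear_combination p * q * Complex.I_mul_I
    simp only [h4, Finset.sum_neg_distrib, mul_left_comm _ Complex.I, mul_assoc]
    ring

theorem logDetMinor_border_last {A B : Matrix (Fin n) (Fin n) ℝ} (hA : A.PosDef)
    (hB : B.IsSymm) (b y : Fin n → ℝ) {c : ℝ} (hc : quadForm A⁻¹ b < c) (s : ℝ) :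
    logDetMinor (border A b (star b) c) (border B y y s) (n + 1) - logDetMinor A B n =
      Complex.log (((1 + (c - quadForm A⁻¹ b) + pivotForm A B b y : ℝ) : ℂ) +
          Complex.I * (s - pivotShift A B b y : ℝ)) := by
  have hP := isDissipative_one_add_complexOfPair hA hB
  have hT : (border A b (star b) c).PosDef := posDef_border_iff.2 ⟨hA, hc⟩
  have hS : (border B y y s).IsSymm := by
    rw [IsSymm, transpose_border, hB.eq]
  have hR := isDissipative_one_add_complexOfPair hT hS
  have hdet := det_one_add_complexOfPair_border hA hB b y c s
  rw [logDetMinor_self, logDetMinor_self]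
  have hb : 1 + complexOfPair (border A b (star b) c) (border B y y s) =
      border (1 + complexOfPair A B) (fun i => b i + Complex.I * y i)
        (fun i => (star b) i + Complex.I * y i) ((1 + c : ℝ) + Complex.I * s) := by
    rw [one_add_complexOfPair, one_add_border, complexOfPair_border, one_add_complexOfPair]
  rw [hb] at hR hdet ⊢
  rw [hR.logDet_border, hdet, mul_div_cancel_left₀ _ hP.det_ne_zero, add_sub_cancel_left]

/-- With `C = 1 + A` one has `C + B C⁻¹ B = (C + iB) C⁻¹ (C - iB)`, and the two outer factors are
complex conjugates. -/
theorem reDet_mul_reDet_schurPair {A B : Matrix (Fin n) (Fin n) ℝ} (hA : A.PosDef)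
    (hB : B.IsSymm) :
    reDet (1 + A) * reDet (schurPair A B) = ‖(1 + complexOfPair A B).det‖ ^ 2 := by
  have hC := posDef_one_add hA
  have hu : IsUnit (1 + A).det := hC.isUnit.map detMonoidHom
  have hCt : (1 + A)ᵀ = 1 + A := by
    have := hC.isHermitian
    rwa [IsHermitian, conjTranspose_eq_transpose_of_trivial] at this
  have hN : schurPair A B = (1 + A) + B * (1 + A)⁻¹ * B := by
    rw [schurPair, hCt, conjTranspose_eq_transpose_of_trivial, hB.eq]
  have h1 : reDet (1 + A) * reDet (schurPair A B) = ((1 + A) * schurPair A B).det := by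
    rw [det_mul]
    rfl
  let f : Matrix (Fin n) (Fin n) ℝ →+* Matrix (Fin n) (Fin n) ℂ := Complex.ofRealHom.mapMatrix
  have hf : ∀ X, ((X.det : ℝ) : ℂ) = (f X).det := fun X => 
    Complex.ofRealHom.map_det X
  have hi : f (1 + A) * f (1 + A)⁻¹ = 1 := by rw [← map_mul, mul_nonsing_inv _ hu, map_one]
  have hi' : f (1 + A)⁻¹ * f (1 + A) = 1 := by rw [← map_mul, nonsing_inv_mul _ hu, map_one]
  have hP : 1 + complexOfPair A B = f (1 + A) + Complex.I • f B := by
    rw [one_add_complexOfPair, complexOfPair_eq]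
    rfl
  have hQ : (1 + complexOfPair A B).map (starRingEnd ℂ) = f (1 + A) - Complex.I • f B := by
    rw [hP]
    ext i j
    simp [f, sub_eq_add_neg]
  have h2 : f (schurPair A B) =
      (1 + complexOfPair A B) * f (1 + A)⁻¹ * (1 + complexOfPair A B).map (starRingEnd ℂ) := by
    rw [hQ, hP, hN, map_add f (1 + A), map_mul, map_mul]
    simp only [add_mul, mul_sub, hi, one_mul, smul_mul_assoc, mul_smul_comm, mul_assoc, hi',
      mul_one, smul_add, smul_smul, Complex.I_mul_I, neg_one_smul]
    abel
  have h3 : ((1 + complexOfPair A B).map (starRingEnd ℂ)).det =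
      (starRingEnd ℂ) (1 + complexOfPair A B).det := (RingHom.map_det _ _).symm
  rw [h1]
  apply Complex.ofReal_injective
  rw [hf, map_mul, det_mul, h2, det_mul, det_mul, h3]
  have h4 : (f (1 + A)).det * (f (1 + A)⁻¹).det = 1 := by rw [← det_mul, hi, det_one]
  have h5 := Complex.mul_conj' (1 + complexOfPair A B).det
  push_cast
  linear_combination (1 + complexOfPair A B).det * (starRingEnd ℂ) (1 + complexOfPair A B).det * h4
    + h5

theorem pairWeight_real {A B : Matrix (Fin n) (Fin n) ℝ} (hA : A.PosDef) (hB : B.IsSymm) :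
    pairWeight A B =
      Real.exp (1 / 2 * Real.log (reDet A) + (logDet (1 + complexOfPair A B)).re) := by
  have hP := isDissipative_one_add_complexOfPair hA hB
  have hA0 := reDet_pos hA
  have h1 : ‖(1 + complexOfPair A B).det‖ = Real.exp (logDet (1 + complexOfPair A B)).re := by
    rw [← hP.exp_logDet, Complex.norm_exp]
  rw [pairWeight, mul_assoc, reDet_mul_reDet_schurPair hA hB, h1, Module.finrank_self,
    Real.rpow_def_of_pos (by positivity), Real.log_mul (by positivity) (by positivity), Real.log_pow,
    Real.log_exp]
  congr 1
  push_cast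
  ring

/-- The last pivots supply the power of `u` and the Cauchy kernel. The first `n` parameters are
shifted so that `pairWeight`, which equals `det A ^ (1/2) * |det (1 + A + iB)|`, is produced and
cancelled; the change of the density from `det T ^ (-(n + 2))` to `det A ^ (-(n + 1))` then turns
the shift of `lam` from `1/2` into `-1/2`. -/
theorem realIntegrand_border (lam σ τ : Fin (n + 1) → ℂ) {A B : Matrix (Fin n) (Fin n) ℝ}
    (hA : A.PosDef) (hB : B.IsSymm) (b y : Fin n → ℝ) {c : ℝ} (hc : quadForm A⁻¹ b < c) (s : ℝ) :
    realIntegrand lam σ τ (border A b (star b) c, border B y y s) =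
      realIntegrand (fun j : Fin n => lam j.castSucc - 1 / 2) (fun j => σ j.castSucc - 1 / 2)
          (fun j => τ j.castSucc - 1 / 2) (A, B) * (pairWeight A B : ℂ)⁻¹ *
        (((c - quadForm A⁻¹ b : ℝ) : ℂ) ^ (lam (Fin.last n) - (n + 1) - 1) *
          cauchyKernel (σ (Fin.last n)) (τ (Fin.last n))
            (1 + (c - quadForm A⁻¹ b) + pivotForm A B b y, s - pivotShift A B b y)) := by
  have hT : (border A b (star b) c).PosDef := posDef_border_iff.2 ⟨hA, hc⟩
  have hu := sub_pos.2 hc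
  have hw : 0 < 1 + (c - quadForm A⁻¹ b) + pivotForm A B b y := by
    linarith [pivotForm_nonneg hA B b y]
  have h1 := logMinor_border_last hA b hc
  simp only [RCLike.ofReal_real_eq_id, id] at h1
  rw [realIntegrand_eq_pivotExp _ _ _ hT, realIntegrand_eq_pivotExp _ _ _ hA,
    pivotExp_succ _ _ _ (fun p hp => logMinor_border A b (star b) c hp)
      (fun p hp => logDetMinor_border A B b (star b) y y c s hp), h1,
    logDetMinor_border_last hA hB b y hc]
  have h2 := pivotExp_shift (fun j : Fin n => lam j.castSucc + -(((n + 1 : ℕ) : ℂ) + 1))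
    (fun j => σ j.castSucc) (fun j => τ j.castSucc) (logMinor_zero A) (logDetMinor_zero A B)
    (1 / 2) (-(1 / 2)) (-(1 / 2))
  -- Equal shifts in `σ` and `τ` give half the sum of `logDet` and its conjugate, the logarithm of
  -- the modulus of the determinant.
  have h3 : Complex.exp (1 / 2 * logMinor A n - -(1 / 2) * logDetMinor A B n -
      -(1 / 2) * (starRingEnd ℂ) (logDetMinor A B n)) = pairWeight A B := by
    rw [pairWeight_real hA hB, logMinor_self, logDetMinor_self, Complex.ofReal_exp]
    congr 1
    have := Complex.add_conj (logDet (1 + complexOfPair A B))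
    push_cast at this ⊢
    linear_combination (1 / 2) * this
  rw [h3] at h2
  have h4 : pivotExp (fun j : Fin n => lam j.castSucc - 1 / 2 + -((n : ℂ) + 1))
      (fun j => σ j.castSucc - 1 / 2) (fun j => τ j.castSucc - 1 / 2) (logMinor A)
      (logDetMinor A B) = pivotExp (fun j : Fin n => lam j.castSucc + -(((n + 1 : ℕ) : ℂ) + 1))
        (fun j => σ j.castSucc) (fun j => τ j.castSucc) (logMinor A) (logDetMinor A B) *
          pairWeight A B := by
    rw [← h2]
    congr 1
    ext j
    push_cast
    ring
  have h5 : (pairWeight A B : ℂ) ≠ 0 := by exact_mod_cast (pairWeight_pos hA B).ne'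
  rw [h4, mul_inv_cancel_right₀ h5]
  congr 1
  set z : ℂ := ((1 + (c - quadForm A⁻¹ b) + pivotForm A B b y : ℝ) : ℂ) +
    Complex.I * (s - pivotShift A B b y : ℝ) with hz
  have hzre : 0 < z.re := by simpa [hz, -Complex.ofReal_add, -Complex.ofReal_sub] using hw
  have hz0 : z ≠ 0 := by rintro h; simp [h] at hzre
  have hzc : (starRingEnd ℂ) z = ((1 + (c - quadForm A⁻¹ b) + pivotForm A B b y : ℝ) : ℂ) -
    Complex.I * (s - pivotShift A B b y : ℝ) := by
    rw [hz, map_add, map_mul, Complex.conj_ofReal, Complex.conj_ofReal, Complex.conj_I]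
    ring
  have hzc0 : (starRingEnd ℂ) z ≠ 0 := by simpa using hz0
  rw [cauchyKernel]
  simp only
  rw [← hzc, ← hz, ofReal_cpow_eq_exp hu, Complex.cpow_def_of_ne_zero hz0,
    -- The logarithm commutes with conjugation here because the pivot has positive real part and so
    -- avoids the branch cut.
    Complex.cpow_def_of_ne_zero hzc0, Complex.log_conj _ (fun h => by
      have := (Complex.arg_eq_pi_iff.1 h).1
      linarith), ← Complex.exp_add, ← Complex.exp_add]
  congr 1
  push_cast
  ring

end RealCase

/-! ### The quaternionic determinant through pivots -/

section QuatDet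

variable {n : ℕ}

theorem quatRealification_mul (g h : Matrix (Fin n) (Fin n) ℍ[ℝ]) :
    quatRealification (g * h) = quatRealification g ∘ₗ quatRealification h :=
  LinearMap.ext fun v => (mulVec_mulVec v g h).symm

theorem quatRealification_one :
    quatRealification (1 : Matrix (Fin n) (Fin n) ℍ[ℝ]) = LinearMap.id :=
  LinearMap.ext fun v => one_mulVec v

/-- The determinant of the realification of a quaternionic matrix. -/
def realDet (g : Matrix (Fin n) (Fin n) ℍ[ℝ]) : ℝ := LinearMap.det (quatRealification g)

theorem realDet_mul (g h : Matrix (Fin n) (Fin n) ℍ[ℝ]) :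
    realDet (g * h) = realDet g * realDet h := by
  rw [realDet, quatRealification_mul, LinearMap.det_comp, realDet, realDet]

theorem realDet_one : realDet (1 : Matrix (Fin n) (Fin n) ℍ[ℝ]) = 1 := by
  rw [realDet, quatRealification_one, LinearMap.det_id]

theorem realDet_fin_zero (g : Matrix (Fin 0) (Fin 0) ℍ[ℝ]) : realDet g = 1 := by
  rw [Subsingleton.elim g 1, realDet_one]

/-- A unipotent `g` is conjugate to its square by a real matrix, whence the determinant. -/
theorem realDet_eq_one_of_conj {g h d d' : Matrix (Fin n) (Fin n) ℍ[ℝ]} (hd : d * d' = 1)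
    (hg : g * h = 1) (hc : d * g * d' = g * g) : realDet g = 1 := by
  have h1 : realDet d * realDet d' = 1 := by rw [← realDet_mul, hd, realDet_one]
  have h2 : realDet g * realDet h = 1 := by rw [← realDet_mul, hg, realDet_one]
  have h3 : realDet d * realDet g * realDet d' = realDet g * realDet g := by
    rw [← realDet_mul, ← realDet_mul, hc, realDet_mul]
  have h4 : realDet g ≠ 0 := left_ne_zero_of_mul_eq_one h2
  exact mul_right_cancel₀ h4 (by linear_combination realDet g * h1 - h3)

theorem border_one : border (1 : Matrix (Fin n) (Fin n) ℍ[ℝ]) 0 0 1 = 1 := by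
  symm
  rw [eq_border (1 : Matrix (Fin (n + 1)) (Fin (n + 1)) ℍ[ℝ])]
  congr 1
  · ext i j : 1
    simp [Matrix.one_apply]
  · ext i : 1
    simp [(Fin.castSucc_lt_last _).ne]
  · ext i : 1
    simp [(Fin.castSucc_lt_last _).ne']
  · exact one_apply_eq _

theorem border_one_col_mul (z z' : Fin n → ℍ[ℝ]) :
    border 1 z 0 1 * border 1 z' 0 1 = border 1 (z + z') 0 1 := by
  rw [border_mul]
  congr 1
  · ext i j : 1
    simp
  · ext i : 1
    simp [add_comm]
  · ext i : 1
    simp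
  · simp

theorem border_one_row_mul (z z' : Fin n → ℍ[ℝ]) :
    border 1 0 z 1 * border 1 0 z' 1 = border 1 0 (z + z') 1 := by
  rw [border_mul]
  congr 1
  · ext i j : 1
    simp
  · ext i : 1
    simp
  · ext i : 1
    simp
  · simp

theorem border_diag_mul_diag {t t' : ℍ[ℝ]} (h : t * t' = 1) :
    border (1 : Matrix (Fin n) (Fin n) ℍ[ℝ]) 0 0 t * border 1 0 0 t' = 1 := by
  rw [border_mul, ← border_one]
  congr 1
  · ext i j : 1
    simp
  · ext i : 1
    simp
  · ext i : 1
    simp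
  · simp [h]

/-- Conjugation by `diag(1, …, 1, 1/2)` doubles the last column `z`, and so does squaring. -/
theorem realDet_border_one_col (z : Fin n → ℍ[ℝ]) : realDet (border 1 z 0 1) = 1 := by
  refine realDet_eq_one_of_conj (h := border 1 (-z) 0 1) (d := border 1 0 0 (((2⁻¹ : ℝ) : ℍ[ℝ])))
    (d' := border 1 0 0 ((2 : ℝ) : ℍ[ℝ])) (border_diag_mul_diag (by rw [← Quaternion.coe_mul]; norm_num)) ?_ ?_
  · rw [border_one_col_mul, add_neg_cancel, border_one]
  · rw [border_one_col_mul, border_mul, border_mul]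
    congr 1
    · ext i j : 1
      simp
    · ext i : 1
      simp [Quaternion.mul_coe_eq_smul, two_smul]
    · ext i : 1
      simp
    · simp only [dotProduct_zero, zero_dotProduct, mul_one, zero_add, ← Quaternion.coe_mul]
      norm_num

theorem realDet_border_one_row (ζ : Fin n → ℍ[ℝ]) : realDet (border 1 0 ζ 1) = 1 := by
  refine realDet_eq_one_of_conj (h := border 1 0 (-ζ) 1) (d := border 1 0 0 ((2 : ℝ) : ℍ[ℝ]))
    (d' := border 1 0 0 (((2⁻¹ : ℝ) : ℍ[ℝ]))) (border_diag_mul_diag (by rw [← Quaternion.coe_mul]; norm_num)) ?_ ?_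
  · rw [border_one_row_mul, add_neg_cancel, border_one]
  · rw [border_one_row_mul, border_mul, border_mul]
    congr 1
    · ext i j : 1
      simp
    · ext i : 1
      simp
    · ext i : 1
      simp [Quaternion.coe_mul_eq_smul, two_smul]
    · simp only [dotProduct_zero, mul_one, zero_add, ← Quaternion.coe_mul]
      norm_num

@[simp] theorem quatJ_re : quatJ.re = 0 := rfl

@[simp] theorem quatJ_imI : quatJ.imI = 0 := rfl

@[simp] theorem quatJ_imJ : quatJ.imJ = 1 := rfl

@[simp] theorem quatJ_imK : quatJ.imK = 0 := rfl

/-- The quaternion `a + b j`. -/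
def quatMk (a b : ℂ) : ℍ[ℝ] := (a : ℍ[ℝ]) + (b : ℍ[ℝ]) * quatJ

@[simp] theorem quatMk_re (a b : ℂ) : (quatMk a b).re = a.re := by simp [quatMk]

@[simp] theorem quatMk_imI (a b : ℂ) : (quatMk a b).imI = a.im := by simp [quatMk]

@[simp] theorem quatMk_imJ (a b : ℂ) : (quatMk a b).imJ = b.re := by simp [quatMk]

@[simp] theorem quatMk_imK (a b : ℂ) : (quatMk a b).imK = b.im := by simp [quatMk]

theorem det_mulLeft_quaternion (r : ℍ[ℝ]) : LinearMap.det (LinearMap.mulLeft ℝ r) = ‖r‖ ^ 4 := by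
  let B : Module.Basis (Fin 4) ℝ ℍ[ℝ] := QuaternionAlgebra.basisOneIJK (-1 : ℝ) 0 (-1)
  have h : ‖r‖ ^ 4 = (r.re ^ 2 + r.imI ^ 2 + r.imJ ^ 2 + r.imK ^ 2) ^ 2 := by
    rw [← Quaternion.normSq_def', Quaternion.normSq_eq_norm_mul_self]
    ring
  have hr : ∀ q : ℍ[ℝ], (B.repr q : Fin 4 → ℝ) = ![q.re, q.imI, q.imJ, q.imK] :=
    fun q => QuaternionAlgebra.coe_basisOneIJK_repr _ _ _ q
  have hB : ∀ i, B i = (![quatMk 1 0, quatMk Complex.I 0, quatMk 0 1, quatMk 0 Complex.I] :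
      Fin 4 → ℍ[ℝ]) i := fun i => by
    apply B.repr.injective
    rw [B.repr_self]
    ext j
    rw [hr]
    fin_cases i <;> fin_cases j <;> simp
  have hM : LinearMap.toMatrix B B (LinearMap.mulLeft ℝ r) =
      !![r.re, -r.imI, -r.imJ, -r.imK; r.imI, r.re, -r.imK, r.imJ; r.imJ, r.imK, r.re, -r.imI;
        r.imK, -r.imJ, r.imI, r.re] := by
    ext i j
    rw [LinearMap.toMatrix_apply, hB, LinearMap.mulLeft_apply, hr]
    fin_cases i <;> fin_cases j <;> simp
  rw [← LinearMap.det_toMatrix B, h, hM]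
  simp [Matrix.det_succ_row_zero, Fin.sum_univ_succ,
    show Fin.succAbove (1 : Fin 4) 2 = 3 from rfl, show Fin.succAbove (2 : Fin 4) 2 = 3 from rfl,
    show Fin.succAbove (3 : Fin 4) 2 = 2 from rfl]
  ring

theorem realDet_border_diag (P : Matrix (Fin n) (Fin n) ℍ[ℝ]) (r : ℍ[ℝ]) :
    realDet (border P 0 0 r) = realDet P * ‖r‖ ^ 4 := by
  let e : ((Fin n → ℍ[ℝ]) × ℍ[ℝ]) ≃ₗ[ℝ] (Fin (n + 1) → ℍ[ℝ]) :=
    { toFun := fun p => Fin.snoc (α := fun _ => ℍ[ℝ]) p.1 p.2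
      invFun := fun v => (Fin.init v, v (Fin.last n))
      left_inv := fun p => by simp
      right_inv := fun v => by simp
      map_add' := fun p q => by
        ext i : 1
        refine Fin.lastCases ?_ (fun i => ?_) i <;> simp
      map_smul' := fun t p => by
        ext i : 1
        refine Fin.lastCases ?_ (fun i => ?_) i <;> simp }
  have h : quatRealification (border P 0 0 r) =
      (e : _ →ₗ[ℝ] _) ∘ₗ ((quatRealification P).prodMap (LinearMap.mulLeft ℝ r)) ∘ₗ
        (e.symm : _ →ₗ[ℝ] _) := by
    refine LinearMap.ext fun v => ?_
    obtain ⟨p, rfl⟩ := e.surjective v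
    simp only [LinearMap.comp_apply, LinearEquiv.coe_coe, LinearEquiv.symm_apply_apply]
    change border P 0 0 r *ᵥ (Fin.snoc p.1 p.2 : Fin (n + 1) → ℍ[ℝ]) =
      (Fin.snoc (P *ᵥ p.1) (r * p.2) : Fin (n + 1) → ℍ[ℝ])
    rw [border_mulVec]
    simp
    rfl
  rw [realDet, h, LinearMap.det_conj, LinearMap.det_prodMap, det_mulLeft_quaternion, realDet]

/-- The LDU decomposition with unipotent outer factors. Since the entries do not commute, the row
and the column have to be eliminated separately, by `ζ` and `z`. -/
theorem realDet_border {P : Matrix (Fin n) (Fin n) ℍ[ℝ]} {q q' z ζ : Fin n → ℍ[ℝ]} (r : ℍ[ℝ])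
    (hz : P *ᵥ z = q) (hζ : ζ ᵥ* P = q') :
    realDet (border P q q' r) = realDet P * ‖r - q' ⬝ᵥ z‖ ^ 4 := by
  rw [border_eq_mul_mul _ hz hζ, realDet_mul, realDet_mul, realDet_border_one_row,
    realDet_border_one_col, realDet_border_diag, one_mul, mul_one]

theorem quatDet_eq (g : Matrix (Fin n) (Fin n) ℍ[ℝ]) : quatDet g = realDet g ^ (1 / 4 : ℝ) := rfl

theorem pow_four_rpow {x : ℝ} (hx : 0 ≤ x) : (x ^ 4) ^ (1 / 4 : ℝ) = x := by
  rw [← Real.rpow_natCast, ← Real.rpow_mul hx]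
  norm_num

/-- The complex matrices as quaternionic matrices. -/
def toQuat : Matrix (Fin n) (Fin n) ℂ →+* Matrix (Fin n) (Fin n) ℍ[ℝ] :=
  Quaternion.ofComplex.toRingHom.mapMatrix

theorem toQuat_apply (M : Matrix (Fin n) (Fin n) ℂ) (i j : Fin n) : toQuat M i j = M i j := rfl

theorem quatMk_add (a b c d : ℂ) : quatMk a b + quatMk c d = quatMk (a + c) (b + d) := by
  ext <;> simp

theorem quatMk_sub (a b c d : ℂ) : quatMk a b - quatMk c d = quatMk (a - c) (b - d) := by
  ext <;> simp

theorem quatMk_mul (a b c d : ℂ) : quatMk a b * quatMk c d =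
    quatMk (a * c - b * (starRingEnd ℂ) d) (a * d + b * (starRingEnd ℂ) c) := by
  ext <;> simp <;> ring

theorem quatMk_zero_zero : quatMk 0 0 = 0 := by
  ext <;> simp

theorem quatMk_one_zero : quatMk 1 0 = 1 := by
  ext <;> simp

theorem quatMk_sum {ι : Type*} (s : Finset ι) (a b : ι → ℂ) :
    ∑ i ∈ s, quatMk (a i) (b i) = quatMk (∑ i ∈ s, a i) (∑ i ∈ s, b i) := by
  classical
  induction s using Finset.induction_on with
  | empty => simp [quatMk_zero_zero]
  | insert i s hi ih => rw [Finset.sum_insert hi, Finset.sum_insert hi, Finset.sum_insert hi, ih,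
      quatMk_add]

theorem norm_quatMk_sq (a b : ℂ) : ‖quatMk a b‖ ^ 2 = ‖a‖ ^ 2 + ‖b‖ ^ 2 := by
  rw [sq, ← Quaternion.normSq_eq_norm_mul_self, Quaternion.normSq_def', ← Complex.normSq_eq_norm_sq,
    ← Complex.normSq_eq_norm_sq, Complex.normSq_apply, Complex.normSq_apply]
  simp
  ring

theorem quatOfPair_apply (T S : Matrix (Fin n) (Fin n) ℂ) (i j : Fin n) :
    quatOfPair T S i j = quatMk (T i j) (S i j) := rfl

theorem one_add_quatOfPair (T S : Matrix (Fin n) (Fin n) ℂ) :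
    1 + quatOfPair T S = quatOfPair (1 + T) S := by
  refine Matrix.ext fun i j => ?_
  rw [Matrix.add_apply, quatOfPair_apply, quatOfPair_apply, Matrix.add_apply]
  by_cases h : i = j
  · rw [h, one_apply_eq, one_apply_eq, ← quatMk_one_zero, quatMk_add, zero_add]
  · simp [h]

theorem leadingBlock_one_add_quatOfPair (T S : Matrix (Fin n) (Fin n) ℂ) (p : ℕ) (hp : p ≤ n) :
    leadingBlock (1 + quatOfPair T S) p hp =
      1 + quatOfPair (leadingBlock T p hp) (leadingBlock S p hp) := by
  refine Matrix.ext fun i j => ?_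
  simp [quatOfPair_apply, leadingBlock, Matrix.one_apply]

theorem quatOfPair_border (A B : Matrix (Fin n) (Fin n) ℂ) (b b' y y' : Fin n → ℂ) (c s : ℂ) :
    quatOfPair (border A b b' c) (border B y y' s) =
      border (quatOfPair A B) (fun i => quatMk (b i) (y i)) (fun i => quatMk (b' i) (y' i))
        (quatMk c s) :=
  border_ext _ _ _ _ (by simp [quatOfPair_apply]) (by simp [quatOfPair_apply])
    (by simp [quatOfPair_apply]) (by simp [quatOfPair_apply])

theorem realDet_one_add_quatOfPair_border {A B : Matrix (Fin n) (Fin n) ℂ} (hA : A.PosDef)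
    (hB : B.IsSymm) (b y : Fin n → ℂ) (c : ℝ) (s : ℂ) :
    realDet (1 + quatOfPair (border A b (star b) (c : ℂ)) (border B y y s)) =
      realDet (1 + quatOfPair A B) *
        ‖quatMk ((1 + (c - quadForm A⁻¹ b) + pivotForm A B b y : ℝ) : ℂ)
          (s - pivotShift A B b y)‖ ^ 4 := by
  have h1 := mulVec_solFst hA B b y
  have h2 := mulVec_solSnd_add hA hB b y
  have h3 := pivotForm_eq hA hB b y c
  have hC := (posDef_one_add hA).isHermitian
  set z1 := solFst A B b y
  set z2 := solSnd A B b y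
  have hz : quatOfPair (1 + A) B *ᵥ (fun i => quatMk (z1 i) (z2 i)) =
      fun i => quatMk (b i) (y i) := by
    ext i : 1
    have h4 := congrFun h1 i
    have h5 := congrFun h2 i
    simp only [mulVec, dotProduct, Pi.add_apply, Pi.star_apply] at h4 h5
    simp only [mulVec, dotProduct, quatOfPair_apply, quatMk_mul, quatMk_sum,
      Finset.sum_sub_distrib, Finset.sum_add_distrib]
    congr 1
    rw [h4]
    exact add_sub_cancel_right _ _
  -- The map `a + b j ↦ conj a + b j` is an anti-automorphism of the quaternions. Combined with
  -- transposition it fixes `1 + A + B j`, so it carries the column solution to a row solution.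
  have hζ : (fun i => quatMk (star (z1 i)) (z2 i)) ᵥ* quatOfPair (1 + A) B =
      fun i => quatMk (star b i) (y i) := by
    ext i : 1
    have h4 := congrArg star (congrFun h1 i)
    have h5 := congrFun h2 i
    simp only [mulVec, dotProduct, Pi.add_apply, Pi.star_apply, star_add, star_sum, star_mul',
      star_star] at h4 h5
    simp only [vecMul, dotProduct, quatOfPair_apply, quatMk_mul, quatMk_sum,
      Finset.sum_sub_distrib, Finset.sum_add_distrib, starRingEnd_apply]
    have h6 : ∀ j, star ((1 + A) i j) = (1 + A) j i := fun j => hC.apply j i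
    have h7 : ∀ j, B i j = B j i := fun j => hB.apply j i
    congr 1
    · simp only [h6, h7] at h4
      rw [Pi.star_apply, sub_eq_of_eq_add]
      simpa only [mul_comm] using h4
    · rw [← h5, add_comm]
      simp only [← h6, h7, star_star, mul_comm]
  rw [one_add_quatOfPair, one_add_border, quatOfPair_border, realDet_border _ hz hζ,
    ← one_add_quatOfPair]
  congr 3
  simp only [dotProduct, quatMk_mul, quatMk_sum, quatMk_sub, Finset.sum_sub_distrib,
      Finset.sum_add_distrib]
  rw [pivotShift]
  congr 1
  simpa [dotProduct] using h3.symm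

theorem Matrix.IsHermitian.exists_eq_border {𝕜 : Type*} [RCLike 𝕜]
    {M : Matrix (Fin (n + 1)) (Fin (n + 1)) 𝕜} (hM : M.IsHermitian) :
    ∃ (A : Matrix (Fin n) (Fin n) 𝕜) (b : Fin n → 𝕜) (c : ℝ), M = border A b (star b) (c : 𝕜) := by
  refine ⟨M.submatrix Fin.castSucc Fin.castSucc, fun i => M i.castSucc (Fin.last n),
    RCLike.re (M (Fin.last n) (Fin.last n)), (eq_border M).trans ?_⟩
  congr 1
  · ext i
    exact (hM.apply _ _).symm
  · exact (RCLike.conj_eq_iff_re.1 (hM.apply _ _)).symm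

theorem Matrix.IsSymm.exists_eq_border {α : Type*} {M : Matrix (Fin (n + 1)) (Fin (n + 1)) α}
    (hM : M.IsSymm) :
    ∃ (B : Matrix (Fin n) (Fin n) α) (y : Fin n → α) (s : α), M = border B y y s := by
  refine ⟨M.submatrix Fin.castSucc Fin.castSucc, fun i => M i.castSucc (Fin.last n),
    M (Fin.last n) (Fin.last n), (eq_border M).trans ?_⟩
  congr 1
  ext i
  exact hM.apply _ _

/-- Every pivot is nonzero, since its real part is at least `1`. Positivity is needed to take fourth
roots factor by factor. -/
theorem realDet_one_add_quatOfPair_pos : ∀ {n : ℕ} {T S : Matrix (Fin n) (Fin n) ℂ},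
    T.PosDef → S.IsSymm → 0 < realDet (1 + quatOfPair T S)
  | 0, T, S, _, _ => by rw [realDet_fin_zero]; exact one_pos
  | n + 1, T, S, hT, hS => by
    obtain ⟨A, b, c, rfl⟩ := hT.isHermitian.exists_eq_border
    obtain ⟨B, y, s, rfl⟩ := hS.exists_eq_border
    have hA := (posDef_border_iff.1 hT).1
    have hB : B.IsSymm := by
      have := hS.submatrix Fin.castSucc
      rwa [show (border B y y s).submatrix Fin.castSucc Fin.castSucc = B by ext; simp] at this
    refine (realDet_one_add_quatOfPair_border hA hB b y c s).symm ▸ ?_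
    refine mul_pos (realDet_one_add_quatOfPair_pos hA hB) (pow_pos (norm_pos_iff.2 fun h => ?_) 4)
    have h1 := congrArg QuaternionAlgebra.re h
    rw [quatMk_re, Complex.ofReal_re] at h1
    have h2 := pivotForm_nonneg hA B b y
    have h3 := (posDef_border_iff.1 hT).2
    have h4 : 1 + (c - quadForm A⁻¹ b) + pivotForm A B b y = 0 := h1
    linarith

theorem quatDet_one_add_quatOfPair_pos {T S : Matrix (Fin n) (Fin n) ℂ} (hT : T.PosDef)
    (hS : S.IsSymm) : 0 < quatDet (1 + quatOfPair T S) :=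
  Real.rpow_pos_of_pos (realDet_one_add_quatOfPair_pos hT hS) _

theorem quatDet_one_add_quatOfPair_border {A B : Matrix (Fin n) (Fin n) ℂ} (hA : A.PosDef)
    (hB : B.IsSymm) (b y : Fin n → ℂ) (c : ℝ) (s : ℂ) :
    quatDet (1 + quatOfPair (border A b (star b) (c : ℂ)) (border B y y s)) =
      quatDet (1 + quatOfPair A B) *
        ‖quatMk ((1 + (c - quadForm A⁻¹ b) + pivotForm A B b y : ℝ) : ℂ)
          (s - pivotShift A B b y)‖ := by
  rw [quatDet_eq, realDet_one_add_quatOfPair_border hA hB,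
    Real.mul_rpow (realDet_one_add_quatOfPair_pos hA hB).le (by positivity),
    pow_four_rpow (norm_nonneg _), quatDet_eq]

theorem realDet_toQuat : ∀ {n : ℕ} {M : Matrix (Fin n) (Fin n) ℂ}, M.PosDef →
    realDet (toQuat M) = reDet M ^ 4
  | 0, M, _ => by rw [realDet_fin_zero]; simp [reDet]
  | n + 1, M, hM => by
    obtain ⟨A, b, c, rfl⟩ := hM.isHermitian.exists_eq_border
    obtain ⟨hA, hc⟩ := posDef_border_iff.1 hM
    have h0 : 0 < c - quadForm A⁻¹ b := sub_pos.2 hc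
    have hz := hA.mulVec_inv_mulVec b
    have hq : ((quadForm A⁻¹ b : ℝ) : ℂ) = star b ⬝ᵥ A⁻¹ *ᵥ b :=
      ofReal_quadForm (𝕜 := ℂ) hA.inv.isHermitian b
    set z := A⁻¹ *ᵥ b
    have hζ : star z ᵥ* A = star b := by
      conv_rhs => rw [← hz, star_mulVec, hA.isHermitian.eq]
    have h1 : toQuat (border A b (star b) (RCLike.ofReal c : ℂ)) = border (toQuat A)
        (fun i => Quaternion.ofComplex (b i)) (fun i => Quaternion.ofComplex (star b i))
        (Quaternion.ofComplex c) := border_map _ _ _ _ _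
    rw [h1, realDet_border (z := fun i => Quaternion.ofComplex (z i))
      (ζ := fun i => Quaternion.ofComplex (star z i)) , realDet_toQuat hA, reDet_border hA, mul_pow]
    · have h2 : Quaternion.ofComplex (c : ℂ) - (fun i => Quaternion.ofComplex (star b i)) ⬝ᵥ
          (fun i => Quaternion.ofComplex (z i)) = ((c - quadForm A⁻¹ b : ℝ) : ℍ[ℝ]) := by
        rw [← Quaternion.coeComplex_coe, ← Quaternion.coe_ofComplex]
        push_cast
        rw [hq, map_sub, dotProduct, dotProduct, map_sum]
        simp only [map_mul]
      rw [h2, Quaternion.norm_coe, Real.norm_of_nonneg h0.le]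
    · rw [← hz]
      ext i : 1
      simp only [mulVec, dotProduct, map_sum, map_mul]
      rfl
    · rw [← hζ]
      ext i : 1
      simp only [vecMul, dotProduct, map_sum, map_mul]
      rfl

theorem quatOfPair_eq (T S : Matrix (Fin n) (Fin n) ℂ) :
    quatOfPair T S = toQuat T + toQuat S * scalar (Fin n) quatJ := by
  refine Matrix.ext fun i j => ?_
  rw [quatOfPair_apply, Matrix.add_apply, toQuat_apply, scalar_apply, mul_diagonal, toQuat_apply]
  rfl

theorem scalar_quatJ_mul_toQuat (M : Matrix (Fin n) (Fin n) ℂ) :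
    scalar (Fin n) quatJ * toQuat M = toQuat (M.map (starRingEnd ℂ)) * scalar (Fin n) quatJ := by
  refine Matrix.ext fun i j => ?_
  rw [scalar_apply, mul_diagonal, diagonal_mul, toQuat_apply, toQuat_apply, map_apply]
  ext <;> simp

theorem scalar_quatJ_mul_self : scalar (Fin n) quatJ * scalar (Fin n) quatJ = -1 := by
  rw [← map_mul, show quatJ * quatJ = -1 by ext <;> simp, map_neg, map_one]

/-- Conjugation by the scalar `i` changes the sign of `j` and commutes with complex matrices. -/
theorem realDet_quatOfPair_neg (T S : Matrix (Fin n) (Fin n) ℂ) :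
    realDet (quatOfPair T (-S)) = realDet (quatOfPair T S) := by
  let u : Matrix (Fin n) (Fin n) ℍ[ℝ] := scalar (Fin n) (quatMk Complex.I 0)
  let u' : Matrix (Fin n) (Fin n) ℍ[ℝ] := scalar (Fin n) (quatMk (-Complex.I) 0)
  have h1 : u * u' = 1 := by
    rw [← map_mul, show quatMk Complex.I 0 * quatMk (-Complex.I) 0 = 1 by ext <;> simp, map_one]
  have h2 : u * quatOfPair T S * u' = quatOfPair T (-S) := by
    refine Matrix.ext fun i j => ?_
    simp only [u, u', scalar_apply, mul_diagonal, diagonal_mul, quatOfPair_apply]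
    ext <;> simp
  have h3 : realDet u * realDet u' = 1 := by rw [← realDet_mul, h1, realDet_one]
  rw [← h2, realDet_mul, realDet_mul]
  linear_combination realDet (quatOfPair T S) * h3

/-- With `C = 1 + A` one has `N = (C + B j) C⁻¹ (C - B j)` for `N = schurPair A B`, because `j M =
conj M j` and `conj B = Bᴴ`. The outer factors have equal determinants by `realDet_quatOfPair_neg`.
-/
theorem reDet_mul_reDet_schurPair_eq_quatDet {A B : Matrix (Fin n) (Fin n) ℂ} (hA : A.PosDef)
    (hB : B.IsSymm) :
    reDet (1 + A) * reDet (schurPair A B) = quatDet (1 + quatOfPair A B) ^ 2 := by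
  have hC := posDef_one_add hA
  have hN := posDef_schurPair hA B
  have hu : IsUnit (1 + A).det := hC.isUnit.map detMonoidHom
  have hi : toQuat (1 + A)⁻¹ * toQuat (1 + A) = 1 := by rw [← map_mul, nonsing_inv_mul _ hu, map_one]
  have hi' : toQuat (1 + A) * toQuat (1 + A)⁻¹ = 1 := by
    rw [← map_mul, mul_nonsing_inv _ hu, map_one]
  have hconj : ((1 + A)⁻¹).map (starRingEnd ℂ) = ((1 + A)ᵀ)⁻¹ := by
    rw [← transpose_nonsing_inv]
    refine Matrix.ext fun i j => ?_
    exact hC.inv.isHermitian.apply j i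
  have hconj' : B.map (starRingEnd ℂ) = Bᴴ := by
    rw [conjTranspose, hB.eq]
    rfl
  have h1 : toQuat (schurPair A B) =
      quatOfPair (1 + A) B * toQuat (1 + A)⁻¹ * quatOfPair (1 + A) (-B) := by
    have h2 : toQuat B * scalar (Fin n) quatJ * toQuat (1 + A)⁻¹ *
        (toQuat B * scalar (Fin n) quatJ) = -toQuat (B * ((1 + A)ᵀ)⁻¹ * Bᴴ) := by
      rw [mul_assoc (toQuat B), scalar_quatJ_mul_toQuat, hconj, mul_assoc, mul_assoc,
        ← mul_assoc _ (toQuat B), scalar_quatJ_mul_toQuat, hconj', mul_assoc,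
        scalar_quatJ_mul_self, map_mul, map_mul]
      noncomm_ring
    rw [quatOfPair_eq, quatOfPair_eq, map_neg, schurPair, map_add toQuat (1 + A), add_mul, hi',
      neg_mul, ← sub_eq_add_neg, mul_sub, add_mul, add_mul, h2, mul_assoc _ (toQuat (1 + A)⁻¹), hi]
    noncomm_ring
  have h3 : realDet (toQuat (1 + A)) * realDet (toQuat (1 + A)⁻¹) = 1 := by
    rw [← realDet_mul, hi', realDet_one]
  have h4 : (reDet (1 + A) * reDet (schurPair A B)) ^ 4 = realDet (1 + quatOfPair A B) ^ 2 := by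
    rw [mul_pow, ← realDet_toQuat hC, ← realDet_toQuat hN, h1, realDet_mul, realDet_mul,
      realDet_quatOfPair_neg, one_add_quatOfPair]
    linear_combination realDet (quatOfPair (1 + A) B) ^ 2 * h3
  have h5 := realDet_one_add_quatOfPair_pos hA hB
  rw [← pow_four_rpow (mul_nonneg (reDet_pos hC).le (reDet_pos hN).le), h4, quatDet_eq,
    ← Real.rpow_natCast, ← Real.rpow_natCast, ← Real.rpow_mul h5.le, ← Real.rpow_mul h5.le,
    mul_comm]

end QuatDet

/-! ### The integrand for `T + S j` and its recursion -/

section QuatCase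

variable {n : ℕ}

/-- The logarithms of the leading principal minors of `1 + T + S j`. -/
def logQuatDetMinor (T S : Matrix (Fin n) (Fin n) ℂ) (p : ℕ) : ℂ :=
  if h : p ≤ n then
    (Real.log (quatDet (1 + quatOfPair (leadingBlock T p h) (leadingBlock S p h))) : ℂ)
  else 0

theorem logQuatDetMinor_zero (T S : Matrix (Fin n) (Fin n) ℂ) : logQuatDetMinor T S 0 = 0 := by
  simp [logQuatDetMinor, quatDet_eq, realDet_fin_zero]

theorem logQuatDetMinor_self (T S : Matrix (Fin n) (Fin n) ℂ) :
    logQuatDetMinor T S n = Real.log (quatDet (1 + quatOfPair T S)) := by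
  rw [logQuatDetMinor, dif_pos le_rfl, leadingBlock_self, leadingBlock_self]

theorem logQuatDetMinor_border (A B : Matrix (Fin n) (Fin n) ℂ) (b b' y y' : Fin n → ℂ) (c s : ℂ)
    {p : ℕ} (hp : p ≤ n) :
    logQuatDetMinor (border A b b' c) (border B y y' s) p = logQuatDetMinor A B p := by
  rw [logQuatDetMinor, logQuatDetMinor, dif_pos hp, dif_pos (hp.trans n.le_succ),
    leadingBlock_border _ _ _ _ p hp, leadingBlock_border _ _ _ _ p hp]

theorem quatIntegrand_eq_pivotExp (lam σ : Fin n → ℂ) {T S : Matrix (Fin n) (Fin n) ℂ}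
    (hT : T.PosDef) (hS : S.IsSymm) :
    quatIntegrand lam σ (T, S) =
      pivotExp (fun j => lam j + -(2 * (n : ℂ) + 1)) σ 0 (logMinor T) (logQuatDetMinor T S) := by
  have h := pivotExp_shift lam σ 0 (logMinor_zero T) (logQuatDetMinor_zero T S)
    (-(2 * (n : ℂ) + 1)) 0 0
  simp only [add_zero] at h
  change _ = pivotExp _ σ (fun j => (0 : Fin n → ℂ) j) _ _
  rw [h, pivotExp_eq_exp_paramDiff _ _ _ (logMinor_zero T) (logQuatDetMinor_zero T S),
    quatIntegrand, Complex.exp_sum]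
  have hdet : ∀ {p : ℕ} {M : Matrix (Fin p) (Fin p) ℂ}, M.PosDef → M.det = (reDet M : ℝ) :=
    fun hM => (ofReal_reDet hM).symm
  have h0 : ∀ j, paramDiff (0 : Fin n → ℂ) j = 0 := fun j => by simp [paramDiff]
  congr 1
  · refine Finset.prod_congr rfl fun j _ => ?_
    have hj : (j : ℕ) + 1 ≤ n := j.isLt
    have hTj := hT.leadingBlock _ hj
    rw [hdet hTj, ofReal_cpow_eq_exp (reDet_pos hTj), leadingBlock_one_add_quatOfPair,
      ofReal_cpow_eq_exp (quatDet_one_add_quatOfPair_pos hTj (leadingBlock_isSymm hS _ hj)),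
      ← Complex.exp_sub, logMinor, dif_pos hj, logQuatDetMinor, dif_pos hj, h0]
    congr 1
    ring
  · rw [hdet hT, ofReal_zpow_eq_exp (reDet_pos hT), logMinor_self]
    congr 1
    push_cast
    ring

theorem pairWeight_complex {A B : Matrix (Fin n) (Fin n) ℂ} (hA : A.PosDef) (hB : B.IsSymm) :
    pairWeight A B =
      Real.exp (Real.log (reDet A) + 2 * Real.log (quatDet (1 + quatOfPair A B))) := by
  have hP := quatDet_one_add_quatOfPair_pos hA hB
  have hA0 := reDet_pos hA
  rw [pairWeight, mul_assoc, reDet_mul_reDet_schurPair_eq_quatDet hA hB, Complex.finrank_real_complex,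
    Real.exp_add, Real.exp_log hA0, two_mul, Real.exp_add, Real.exp_log hP,
    show ((2 : ℕ) : ℝ) / 2 = 1 by norm_num, Real.rpow_one, sq]

/-- Here `pairWeight` is `det A` times the square of the quaternionic determinant. The shift of
`lam` by `-1` combines this factor `det A` with the change of the density exponent from `-(2 n + 3)`
to `-(2 n + 1)`; the shift of `σ` by `-2` accounts for the square. -/
theorem quatIntegrand_border (lam σ : Fin (n + 1) → ℂ) {A B : Matrix (Fin n) (Fin n) ℂ}
    (hA : A.PosDef) (hB : B.IsSymm) (b y : Fin n → ℂ) {c : ℝ} (hc : quadForm A⁻¹ b < c) (s : ℂ) :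
    quatIntegrand lam σ (border A b (star b) (c : ℂ), border B y y s) =
      quatIntegrand (fun j : Fin n => lam j.castSucc - 1) (fun j => σ j.castSucc - 2) (A, B) *
          (pairWeight A B : ℂ)⁻¹ *
        (((c - quadForm A⁻¹ b : ℝ) : ℂ) ^ (lam (Fin.last n) - (2 * n + 2) - 1) *
          quatKernel (σ (Fin.last n))
            (1 + (c - quadForm A⁻¹ b) + pivotForm A B b y, s - pivotShift A B b y)) := by
  have hT : (border A b (star b) (c : ℂ)).PosDef := posDef_border_iff.2 ⟨hA, hc⟩
  have hS : (border B y y s).IsSymm := by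
    rw [IsSymm, transpose_border, hB.eq]
  have hu := sub_pos.2 hc
  have hw : 0 < 1 + (c - quadForm A⁻¹ b) + pivotForm A B b y := by
    linarith [pivotForm_nonneg hA B b y]
  set w := 1 + (c - quadForm A⁻¹ b) + pivotForm A B b y with hw_def
  have hP := quatDet_one_add_quatOfPair_pos hA hB
  have hN2 : 0 < w ^ 2 + ‖s - pivotShift A B b y‖ ^ 2 := by positivity
  have hnorm : ‖quatMk (w : ℂ) (s - pivotShift A B b y)‖ ^ 2 =
      w ^ 2 + ‖s - pivotShift A B b y‖ ^ 2 := by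
    rw [norm_quatMk_sq, Complex.norm_real, Real.norm_eq_abs, sq_abs]
  have hpos : 0 < ‖quatMk (w : ℂ) (s - pivotShift A B b y)‖ := by
    refine lt_of_le_of_ne (norm_nonneg _) fun h => ?_
    rw [← h] at hnorm
    simp only [ne_eq, OfNat.ofNat_ne_zero, not_false_eq_true, zero_pow] at hnorm
    exact hN2.ne hnorm
  have h1 : logMinor (border A b (star b) (c : ℂ)) (n + 1) - logMinor A n =
      Real.log (c - quadForm A⁻¹ b) := logMinor_border_last hA b hc
  have h1' : logQuatDetMinor (border A b (star b) (c : ℂ)) (border B y y s) (n + 1) -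
      logQuatDetMinor A B n = (1 / 2 * Real.log (w ^ 2 + ‖s - pivotShift A B b y‖ ^ 2) : ℝ) := by
    rw [logQuatDetMinor_self, logQuatDetMinor_self, quatDet_one_add_quatOfPair_border hA hB,
      ← hw_def, Real.log_mul hP.ne' hpos.ne', ← hnorm, Real.log_pow]
    push_cast
    ring
  rw [quatIntegrand_eq_pivotExp _ _ hT hS, quatIntegrand_eq_pivotExp _ _ hA hB,
    pivotExp_succ _ _ _ (fun p hp => logMinor_border A b (star b) (c : ℂ) hp)
      (fun p hp => logQuatDetMinor_border A B b (star b) y y (c : ℂ) s hp), h1, h1']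
  have h2 := pivotExp_shift (fun j : Fin n => lam j.castSucc + -(2 * ((n + 1 : ℕ) : ℂ) + 1))
    (fun j => σ j.castSucc) 0 (logMinor_zero A) (logQuatDetMinor_zero A B) 1 (-2) 0
  have h3 : Complex.exp (1 * logMinor A n - (-2) * logQuatDetMinor A B n -
      0 * (starRingEnd ℂ) (logQuatDetMinor A B n)) = pairWeight A B := by
    rw [pairWeight_complex hA hB, logMinor_self, logQuatDetMinor_self, Complex.ofReal_exp]
    congr 1
    push_cast
    ring
  rw [h3] at h2
  have h4 : pivotExp (fun j : Fin n => lam j.castSucc - 1 + -(2 * (n : ℂ) + 1))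
      (fun j => σ j.castSucc - 2) 0 (logMinor A) (logQuatDetMinor A B) =
        pivotExp (fun j : Fin n => lam j.castSucc + -(2 * ((n + 1 : ℕ) : ℂ) + 1))
        (fun j => σ j.castSucc) 0 (logMinor A) (logQuatDetMinor A B) * pairWeight A B := by
    rw [← h2]
    congr 1
    · ext j
      push_cast
      ring
    · ext j
      simp
  have h5 : (pairWeight A B : ℂ) ≠ 0 := by exact_mod_cast (pairWeight_pos hA B).ne'
  rw [h4, mul_inv_cancel_right₀ h5]
  congr 1
  rw [quatKernel, ofReal_cpow_eq_exp hu, ofReal_cpow_eq_exp hN2, ← Complex.exp_add]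
  congr 1
  simp only [Pi.zero_apply]
  push_cast
  ring

end QuatCase

/-! ### Lebesgue measures under bordering -/

section Bordering

theorem measurePreserving_prodProdProdComm {α β γ δ : Type*} [MeasurableSpace α]
    [MeasurableSpace β] [MeasurableSpace γ] [MeasurableSpace δ] (μa : Measure α) (μb : Measure β)
    (μc : Measure γ) (μd : Measure δ) [SFinite μa] [SFinite μb] [SFinite μc] [SFinite μd] :
    MeasurePreserving (fun p : (α × β) × (γ × δ) => ((p.1.1, p.2.1), (p.1.2, p.2.2)))
      ((μa.prod μb).prod (μc.prod μd)) ((μa.prod μc).prod (μb.prod μd)) := by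
  have h1 := measurePreserving_prodAssoc μa μb (μc.prod μd)
  have h2 := (measurePreserving_prodAssoc μb μc μd).symm
  have h3 := (Measure.measurePreserving_swap (μ := μb) (ν := μc)).prod (MeasurePreserving.id μd)
  have h4 := measurePreserving_prodAssoc μc μb μd
  have h5 := (measurePreserving_prodAssoc μa μc (μb.prod μd)).symm
  exact h5.comp (((MeasurePreserving.id μa).prod (h4.comp (h3.comp h2))).comp h1)

/-- The index set of the upper triangle of a matrix of size `n + 1`. -/
def upperIndex (n : ℕ) :
    {p : Fin n × Fin n // p.1 ≤ p.2} ⊕ (Fin n ⊕ Unit) →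
      {p : Fin (n + 1) × Fin (n + 1) // p.1 ≤ p.2} :=
  Sum.elim (fun p => ⟨(p.1.1.castSucc, p.1.2.castSucc), p.2⟩)
    (Sum.elim (fun i => ⟨(i.castSucc, Fin.last n), i.castSucc_lt_last.le⟩)
      fun _ => ⟨(Fin.last n, Fin.last n), le_rfl⟩)

theorem upperIndex_bijective (n : ℕ) : Function.Bijective (upperIndex n) := by
  constructor
  · rintro (⟨⟨i, j⟩, h⟩ | i | _) (⟨⟨i', j'⟩, h'⟩ | i' | _) <;>
      simp [upperIndex, Fin.ext_iff] <;> omega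
  · rintro ⟨⟨i, j⟩, h⟩
    induction j using Fin.lastCases with
    | last =>
      induction i using Fin.lastCases with
      | last => exact ⟨Sum.inr (Sum.inr ()), rfl⟩
      | cast i => exact ⟨Sum.inr (Sum.inl i), rfl⟩
    | cast j =>
      induction i using Fin.lastCases with
      | last => exact absurd h (not_le.2 j.castSucc_lt_last)
      | cast i => exact ⟨Sum.inl ⟨(i, j), h⟩, rfl⟩

/-- The index set of the strict upper triangle of a matrix of size `n + 1`. -/
def strictUpperIndex (n : ℕ) :
    {p : Fin n × Fin n // p.1 < p.2} ⊕ Fin n → {p : Fin (n + 1) × Fin (n + 1) // p.1 < p.2} :=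
  Sum.elim (fun p => ⟨(p.1.1.castSucc, p.1.2.castSucc), p.2⟩)
    fun i => ⟨(i.castSucc, Fin.last n), i.castSucc_lt_last⟩

theorem strictUpperIndex_bijective (n : ℕ) : Function.Bijective (strictUpperIndex n) := by
  constructor
  · rintro (⟨⟨i, j⟩, h⟩ | i) (⟨⟨i', j'⟩, h'⟩ | i') <;>
      simp [strictUpperIndex, Fin.ext_iff] <;> omega
  · rintro ⟨⟨i, j⟩, h⟩
    induction i using Fin.lastCases with
    | last => exact absurd h (not_lt.2 j.le_last)
    | cast i =>
      induction j using Fin.lastCases with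
      | last => exact ⟨Sum.inr i, rfl⟩
      | cast j => exact ⟨Sum.inl ⟨(i, j), h⟩, rfl⟩

/-- Only the values of the reindexing on the two kinds of indices matter later, so the map itself
stays existential. -/
theorem exists_measurePreserving_sum {ι ι' κ α : Type*} [Fintype ι] [Fintype ι'] [Fintype κ]
    [MeasureSpace α] [SigmaFinite (volume : Measure α)] {e : ι ⊕ ι' → κ}
    (he : Function.Bijective e) :
    ∃ G : (ι → α) × (ι' → α) → κ → α, MeasurePreserving G ∧
      (∀ p i, G p (e (Sum.inl i)) = p.1 i) ∧ ∀ p i, G p (e (Sum.inr i)) = p.2 i := by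
  let f := Equiv.ofBijective e he
  have h1 := volume_measurePreserving_sumPiEquivProdPi_symm (fun _ : ι ⊕ ι' => α)
  have h2 := volume_measurePreserving_piCongrLeft (fun _ : κ => α) f
  refine ⟨_, h2.comp h1, fun p i => ?_, fun p i => ?_⟩
  · exact Equiv.piCongrLeft_apply_apply (fun _ : κ => α) f _ (Sum.inl i)
  · exact Equiv.piCongrLeft_apply_apply (fun _ : κ => α) f _ (Sum.inr i)

instance {𝕜 : Type*} [MeasureSpace 𝕜] [SigmaFinite (volume : Measure 𝕜)] (n : ℕ) :
    SFinite (symmLebesgue 𝕜 n) := by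
  unfold symmLebesgue
  infer_instance

instance (n : ℕ) : SFinite (hermLebesgue n) := by
  unfold hermLebesgue
  infer_instance

theorem measurable_border {α β : Type*} [MeasurableSpace α] [MeasurableSpace β] {n : ℕ}
    {A : β → Matrix (Fin n) (Fin n) α} {b b' : β → Fin n → α} {c : β → α} (hA : Measurable A)
    (hb : Measurable b) (hb' : Measurable b') (hc : Measurable c) :
    Measurable fun x => border (A x) (b x) (b' x) (c x) := by
  refine measurable_pi_lambda _ fun i => measurable_pi_lambda _ fun j => ?_
  refine Fin.lastCases ?_ (fun i => ?_) i <;> refine Fin.lastCases ?_ (fun j => ?_) j <;>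
    simp only [border_castSucc_castSucc, border_castSucc_last, border_last_castSucc,
      border_last_last]
  · exact hc
  · exact (measurable_pi_apply j).comp hb'
  · exact (measurable_pi_apply i).comp hb
  · exact (measurable_pi_apply j).comp ((measurable_pi_apply i).comp hA)

theorem measurePreserving_border_symm {𝕜 : Type*} [MeasureSpace 𝕜]
    [SigmaFinite (volume : Measure 𝕜)] (n : ℕ) :
    MeasurePreserving
      (fun q : Matrix (Fin n) (Fin n) 𝕜 × ((Fin n → 𝕜) × 𝕜) => border q.1 q.2.1 q.2.1 q.2.2)
      ((symmLebesgue 𝕜 n).prod (volume.prod volume)) (symmLebesgue 𝕜 (n + 1)) := by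
  obtain ⟨G, hG, hG1, hG2⟩ := exists_measurePreserving_sum (α := 𝕜) (upperIndex_bijective n)
  obtain ⟨H, hH, hH1, hH2⟩ := exists_measurePreserving_sum (α := 𝕜) (ι := Fin n) (ι' := Unit)
    (e := id) Function.bijective_id
  have hu := (volume_preserving_funUnique Unit 𝕜).symm
  have h1 : MeasurePreserving (fun x => (symmOfCoords x : Matrix (Fin (n + 1)) (Fin (n + 1)) 𝕜))
      volume (symmLebesgue 𝕜 (n + 1)) := ⟨measurable_symmOfCoords, rfl⟩
  have h2 : MeasurePreserving (fun x => (symmOfCoords x : Matrix (Fin n) (Fin n) 𝕜))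
      volume (symmLebesgue 𝕜 n) := ⟨measurable_symmOfCoords, rfl⟩
  have h3 := h1.comp (hG.comp ((MeasurePreserving.id volume).prod
    (hH.comp ((MeasurePreserving.id volume).prod hu))))
  have h4 := h2.prod (MeasurePreserving.id ((volume : Measure (Fin n → 𝕜)).prod
    (volume : Measure 𝕜)))
  have h5 : Measurable
      (fun q : Matrix (Fin n) (Fin n) 𝕜 × ((Fin n → 𝕜) × 𝕜) => border q.1 q.2.1 q.2.1 q.2.2) :=
    measurable_border (by fun_prop) (by fun_prop) (by fun_prop) (by fun_prop)
  let e := (MeasurableEquiv.funUnique Unit 𝕜).symm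
  have hv1 : ∀ (p : ({p : Fin n × Fin n // p.1 ≤ p.2} → 𝕜) × ((Fin n → 𝕜) × 𝕜)) i,
      G (p.1, H (p.2.1, e p.2.2)) (upperIndex n (Sum.inl i)) = p.1 i := fun p i => hG1 _ i
  have hv2 : ∀ (p : ({p : Fin n × Fin n // p.1 ≤ p.2} → 𝕜) × ((Fin n → 𝕜) × 𝕜)) i,
      G (p.1, H (p.2.1, e p.2.2)) (upperIndex n (Sum.inr (Sum.inl i))) = p.2.1 i :=
    fun p i => (hG2 _ _).trans (hH1 _ i)
  have hv3 : ∀ p : ({p : Fin n × Fin n // p.1 ≤ p.2} → 𝕜) × ((Fin n → 𝕜) × 𝕜),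
      G (p.1, H (p.2.1, e p.2.2)) (upperIndex n (Sum.inr (Sum.inr ()))) = p.2.2 :=
    fun p => (hG2 _ _).trans (hH2 _ ())
  refine ⟨h5, ?_⟩
  rw [← h4.map_eq, Measure.map_map h5 h4.measurable, ← h3.map_eq]
  congr 1
  ext p : 1
  symm
  refine border_ext _ _ _ _ (fun i j => ?_) (fun i => ?_) (fun j => ?_) ?_
  all_goals
    simp only [Function.comp_apply, Prod.map, id, symmOfCoords, Matrix.of_apply]
  · refine Eq.trans (congrArg (G _) (Subtype.ext (Prod.ext ?_ ?_))) (hv1 p _)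
    · exact (Fin.strictMono_castSucc.monotone.map_min).symm
    · exact (Fin.strictMono_castSucc.monotone.map_max).symm
  · refine Eq.trans (congrArg (G _) (Subtype.ext (Prod.ext ?_ ?_))) (hv2 p i)
    · exact min_eq_left i.castSucc_lt_last.le
    · exact max_eq_right i.castSucc_lt_last.le
  · refine Eq.trans (congrArg (G _) (Subtype.ext (Prod.ext ?_ ?_))) (hv2 p j)
    · exact min_eq_right j.castSucc_lt_last.le
    · exact max_eq_left j.castSucc_lt_last.le
  · exact Eq.trans (congrArg (G _) (Subtype.ext (Prod.ext (min_self _) (max_self _)))) (hv3 p)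

theorem measurePreserving_border_herm (n : ℕ) :
    MeasurePreserving
      (fun q : Matrix (Fin n) (Fin n) ℂ × ((Fin n → ℂ) × ℝ) =>
        border q.1 q.2.1 (star q.2.1) (q.2.2 : ℂ))
      ((hermLebesgue n).prod (volume.prod volume)) (hermLebesgue (n + 1)) := by
  obtain ⟨G, hG, hG1, hG2⟩ := exists_measurePreserving_sum (α := ℂ) (strictUpperIndex_bijective n)
  have h1 : MeasurePreserving (fun x => (hermOfCoords x : Matrix (Fin (n + 1)) (Fin (n + 1)) ℂ))
      volume (hermLebesgue (n + 1)) := ⟨measurable_hermOfCoords, rfl⟩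
  have h2 : MeasurePreserving (fun x => (hermOfCoords x : Matrix (Fin n) (Fin n) ℂ))
      volume (hermLebesgue n) := ⟨measurable_hermOfCoords, rfl⟩
  have hsw := Measure.measurePreserving_swap (μ := (volume : Measure (Fin n → ℂ)))
    (ν := (volume : Measure ℝ))
  have hsw' := Measure.measurePreserving_swap (μ := (volume : Measure (Fin n → ℝ)))
    (ν := (volume : Measure ℝ))
  have hc := measurePreserving_prodProdProdComm (volume : Measure (Fin n → ℝ))
    (volume : Measure ({p : Fin n × Fin n // p.1 < p.2} → ℂ)) (volume : Measure ℝ)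
    (volume : Measure (Fin n → ℂ))
  -- The last real entry is appended to the diagonal and the last column to the strict upper
  -- triangle; the interchange of factors brings the coordinates into that order.
  have h3 := h1.comp ((((measurePreserving_snoc (α := ℝ) n).comp hsw').prod hG).comp
    (hc.comp ((MeasurePreserving.id volume).prod hsw)))
  have h4 := h2.prod (MeasurePreserving.id ((volume : Measure (Fin n → ℂ)).prod
    (volume : Measure ℝ)))
  have h5 : Measurable (fun q : Matrix (Fin n) (Fin n) ℂ × ((Fin n → ℂ) × ℝ) =>
        border q.1 q.2.1 (star q.2.1) (q.2.2 : ℂ)) :=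
    measurable_border (by fun_prop) (by fun_prop) (by fun_prop) (by fun_prop)
  refine ⟨h5, ?_⟩
  rw [← h4.map_eq, Measure.map_map h5 h4.measurable, ← h3.map_eq]
  congr 1
  ext p : 1
  symm
  refine border_ext _ _ _ _ (fun i j => ?_) (fun i => ?_) (fun j => ?_) ?_
  all_goals
    simp only [Function.comp_apply, Prod.map, id, hermOfCoords, Matrix.of_apply, Prod.swap]
  · rcases lt_trichotomy i j with h | h | h
    · simp only [Fin.castSucc_lt_castSucc_iff, h, dif_pos]
      exact hG1 _ ⟨(i, j), h⟩
    · subst h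
      simp
    · simp only [Fin.castSucc_lt_castSucc_iff, h, h.not_gt, dif_pos, dif_neg, not_false_eq_true]
      exact congrArg _ (hG1 _ ⟨(j, i), h⟩)
  · simp only [i.castSucc_lt_last, dif_pos]
    exact hG2 _ i
  · simp only [j.castSucc_lt_last, j.castSucc_lt_last.not_gt, dif_pos, dif_neg, not_false_eq_true]
    exact congrArg _ (hG2 _ j)
  · simp

end Bordering

/-! ### Measurability of matrix expressions -/

section MatrixMeasurability

variable {α X : Type*} [MeasurableSpace α] [MeasurableSpace X] {n : ℕ}

theorem measurable_matrix {f : X → Matrix (Fin n) (Fin n) α}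
    (h : ∀ i j, Measurable fun x => f x i j) : Measurable f :=
  measurable_pi_lambda _ fun i => measurable_pi_lambda _ fun j => h i j

theorem Measurable.matrix_elem {f : X → Matrix (Fin n) (Fin n) α} (h : Measurable f)
    (i j : Fin n) : Measurable fun x => f x i j :=
  (measurable_pi_apply j).comp ((measurable_pi_apply i).comp h)

theorem Measurable.matrix_transpose {f : X → Matrix (Fin n) (Fin n) α} (hf : Measurable f) :
    Measurable fun x => (f x)ᵀ :=
  measurable_matrix fun i j => hf.matrix_elem j i

instance [TopologicalSpace α] [SecondCountableTopology α] [BorelSpace α] :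
    BorelSpace (Matrix (Fin n) (Fin n) α) :=
  inferInstanceAs (BorelSpace (Fin n → Fin n → α))

instance [StandardBorelSpace α] : StandardBorelSpace (Matrix (Fin n) (Fin n) α) :=
  inferInstanceAs (StandardBorelSpace (Fin n → Fin n → α))

variable {𝕜 : Type*} [RCLike 𝕜] [MeasurableSpace 𝕜] [BorelSpace 𝕜]
  {f g : X → Matrix (Fin n) (Fin n) 𝕜} {v w : X → Fin n → 𝕜}

theorem Measurable.star_rclike {f : X → 𝕜} (hf : Measurable f) : Measurable fun x => star (f x) :=
  continuous_star.measurable.comp hf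

theorem Measurable.star_pi (hv : Measurable v) : Measurable fun x => star (v x) :=
  measurable_pi_lambda _ fun i => ((measurable_pi_apply i).comp hv).star_rclike

theorem Measurable.matrix_conjTranspose (hf : Measurable f) : Measurable fun x => (f x)ᴴ :=
  measurable_matrix fun i j => (hf.matrix_elem j i).star_rclike

variable [SecondCountableTopology 𝕜]

theorem Measurable.matrix_mul (hf : Measurable f) (hg : Measurable g) :
    Measurable fun x => f x * g x := by
  refine measurable_matrix fun i j => ?_
  simp only [Matrix.mul_apply]
  exact Finset.measurable_fun_sum _ fun k _ => (hf.matrix_elem i k).mul (hg.matrix_elem k j)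

theorem Measurable.matrix_add (hf : Measurable f) (hg : Measurable g) :
    Measurable fun x => f x + g x :=
  measurable_matrix fun i j => (hf.matrix_elem i j).add (hg.matrix_elem i j)

theorem Measurable.matrix_mulVec (hf : Measurable f) (hv : Measurable v) :
    Measurable fun x => f x *ᵥ v x := by
  refine measurable_pi_lambda _ fun i => ?_
  simp only [mulVec, dotProduct]
  exact Finset.measurable_fun_sum _ fun k _ =>
    (hf.matrix_elem i k).mul ((measurable_pi_apply k).comp hv)

theorem Measurable.matrix_dotProduct (hv : Measurable v) (hw : Measurable w) :
    Measurable fun x => v x ⬝ᵥ w x := by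
  simp only [dotProduct]
  exact Finset.measurable_fun_sum _ fun k _ =>
    ((measurable_pi_apply k).comp hv).mul ((measurable_pi_apply k).comp hw)

theorem Measurable.matrix_det (hf : Measurable f) : Measurable fun x => (f x).det :=
  (continuous_id.matrix_det (A := fun M : Matrix (Fin n) (Fin n) 𝕜 => M)).measurable.comp hf

theorem Measurable.matrix_inv (hf : Measurable f) : Measurable fun x => (f x)⁻¹ := by
  refine Measurable.comp (g := fun M : Matrix (Fin n) (Fin n) 𝕜 => M⁻¹) ?_ hf
  simp only [Matrix.inv_def, Ring.inverse_eq_inv']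
  refine measurable_matrix fun i j => ?_
  simp only [Matrix.smul_apply, smul_eq_mul]
  refine (measurable_id.matrix_det).inv.mul (Measurable.matrix_elem ?_ i j)
  exact (continuous_id.matrix_adjugate (A := fun M : Matrix (Fin n) (Fin n) 𝕜 => M)).measurable

theorem Measurable.quadForm (hf : Measurable f) (hv : Measurable v) :
    Measurable fun x => quadForm (f x) (v x) :=
  RCLike.continuous_re.measurable.comp (hv.star_pi.matrix_dotProduct (hf.matrix_mulVec hv))

theorem Measurable.reDet (hf : Measurable f) : Measurable fun x => reDet (f x) :=
  RCLike.continuous_re.measurable.comp hf.matrix_det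

theorem Measurable.schurPair (hf : Measurable f) (hg : Measurable g) :
    Measurable fun x => schurPair (f x) (g x) :=
  (measurable_const.matrix_add hf).matrix_add
    ((hg.matrix_mul (measurable_const.matrix_add hf).matrix_transpose.matrix_inv).matrix_mul
      hg.matrix_conjTranspose)

theorem Measurable.pairWeight (hf : Measurable f) (hg : Measurable g) :
    Measurable fun x => pairWeight (f x) (g x) :=
  ((hf.reDet.mul (measurable_const.matrix_add hf).reDet).mul (hf.schurPair hg).reDet).pow_const _

theorem Measurable.shiftVec (hf : Measurable f) (hg : Measurable g) (hv : Measurable v) :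
    Measurable fun x => shiftVec (f x) (g x) (v x) :=
  hg.matrix_mulVec ((measurable_const.matrix_add hf).matrix_transpose.matrix_inv.matrix_mulVec
    hv.star_pi)

theorem Measurable.solSnd (hf : Measurable f) (hg : Measurable g) (hv : Measurable v)
    (hw : Measurable w) : Measurable fun x => solSnd (f x) (g x) (v x) (w x) :=
  (hf.schurPair hg).matrix_inv.matrix_mulVec (hw.sub (hf.shiftVec hg hv))

theorem Measurable.solFst (hf : Measurable f) (hg : Measurable g) (hv : Measurable v)
    (hw : Measurable w) : Measurable fun x => solFst (f x) (g x) (v x) (w x) :=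
  (measurable_const.matrix_add hf).matrix_inv.matrix_mulVec
    (hv.add (hg.matrix_mulVec (hf.solSnd hg hv hw).star_pi))

theorem Measurable.pivotShift (hf : Measurable f) (hg : Measurable g) (hv : Measurable v)
    (hw : Measurable w) : Measurable fun x => pivotShift (f x) (g x) (v x) (w x) :=
  (hv.star_pi.matrix_dotProduct (hf.solSnd hg hv hw)).add
    (hw.matrix_dotProduct (hf.solFst hg hv hw).star_pi)

theorem Measurable.pivotForm (hf : Measurable f) (hg : Measurable g) (hv : Measurable v)
    (hw : Measurable w) : Measurable fun x => pivotForm (f x) (g x) (v x) (w x) :=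
  ((hf.matrix_add (hf.matrix_mul hf)).matrix_inv.quadForm hv).add
    ((hf.schurPair hg).matrix_inv.quadForm (hw.sub (hf.shiftVec hg hv)))

end MatrixMeasurability

/-! ### Bordering pairs and the recursion of integrands -/

section PairStep

variable {𝕜 : Type*} [RCLike 𝕜] {n : ℕ}

/-- Pairs `(T, S)` of matrices with `T` hermitian positive definite and `S` symmetric. -/
def posSymmPairs (𝕜 : Type*) [RCLike 𝕜] (n : ℕ) :
    Set (Matrix (Fin n) (Fin n) 𝕜 × Matrix (Fin n) (Fin n) 𝕜) :=
  {p | p.1.PosDef ∧ p.2.IsSymm}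

/-- The pair of matrices with given leading blocks, last columns and last diagonal entries. -/
def borderPair (x : (Matrix (Fin n) (Fin n) 𝕜 × Matrix (Fin n) (Fin n) 𝕜) ×
    (((Fin n → 𝕜) × (Fin n → 𝕜)) × (ℝ × 𝕜))) :
    Matrix (Fin (n + 1)) (Fin (n + 1)) 𝕜 × Matrix (Fin (n + 1)) (Fin (n + 1)) 𝕜 :=
  (border x.1.1 x.2.1.1 (star x.2.1.1) (x.2.2.1 : 𝕜), border x.1.2 x.2.1.2 x.2.1.2 x.2.2.2)

theorem Matrix.IsSymm.of_border {α : Type*} {B : Matrix (Fin n) (Fin n) α} {y y' : Fin n → α}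
    {s : α} (h : (border B y y' s).IsSymm) : B.IsSymm := by
  have := h.submatrix Fin.castSucc
  rwa [show (border B y y' s).submatrix Fin.castSucc Fin.castSucc = B by ext; simp] at this

theorem Matrix.IsSymm.border {α : Type*} {B : Matrix (Fin n) (Fin n) α} (h : B.IsSymm)
    (y : Fin n → α) (s : α) : (border B y y s).IsSymm := by
  rw [IsSymm, transpose_border, h.eq]

theorem borderPair_mem_iff (x : (Matrix (Fin n) (Fin n) 𝕜 × Matrix (Fin n) (Fin n) 𝕜) ×
    (((Fin n → 𝕜) × (Fin n → 𝕜)) × (ℝ × 𝕜))) :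
    borderPair x ∈ posSymmPairs 𝕜 (n + 1) ↔
      x.1 ∈ posSymmPairs 𝕜 n ∧ quadForm x.1.1⁻¹ x.2.1.1 < x.2.2.1 := by
  constructor
  · rintro ⟨h1, h2⟩
    exact ⟨⟨(posDef_border_iff.1 h1).1, h2.of_border⟩, (posDef_border_iff.1 h1).2⟩
  · rintro ⟨⟨h1, h2⟩, h3⟩
    exact ⟨posDef_border_iff.2 ⟨h1, h3⟩, h2.border _ _⟩

theorem posSymmPairs_subset_range :
    posSymmPairs 𝕜 (n + 1) ⊆ Set.range (borderPair (𝕜 := 𝕜) (n := n)) := by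
  rintro ⟨T, S⟩ ⟨hT, hS⟩
  obtain ⟨A, b, c, rfl⟩ := Matrix.IsHermitian.exists_eq_border hT.isHermitian
  obtain ⟨B, y, s, rfl⟩ := Matrix.IsSymm.exists_eq_border hS
  exact ⟨((A, B), ((b, y), (c, s))), rfl⟩

theorem borderPair_injective : Function.Injective (borderPair (𝕜 := 𝕜) (n := n)) := by
  rintro ⟨⟨A, B⟩, ⟨⟨b, y⟩, ⟨c, s⟩⟩⟩ ⟨⟨A', B'⟩, ⟨⟨b', y'⟩, ⟨c', s'⟩⟩⟩ h
  obtain ⟨h1, h2⟩ := Prod.mk.inj h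
  obtain ⟨rfl, rfl, -, hc⟩ := border_injective h1
  obtain ⟨rfl, rfl, -, rfl⟩ := border_injective h2
  have hc' : c = c' := RCLike.ofReal_inj.1 hc
  rw [hc']

/-- The recursion satisfied by the integrands `I` and `I'` on pairs of matrices of sizes `n` and
`n + 1`. -/
def PairRecursion (I : Matrix (Fin n) (Fin n) 𝕜 × Matrix (Fin n) (Fin n) 𝕜 → ℂ)
    (I' : Matrix (Fin (n + 1)) (Fin (n + 1)) 𝕜 × Matrix (Fin (n + 1)) (Fin (n + 1)) 𝕜 → ℂ)
    (a : ℂ) (g : ℝ × 𝕜 → ℂ) : Prop :=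
  ∀ (A B : Matrix (Fin n) (Fin n) 𝕜), A.PosDef → B.IsSymm → ∀ (b y : Fin n → 𝕜) (c : ℝ) (s : 𝕜),
    quadForm A⁻¹ b < c → I' (borderPair ((A, B), ((b, y), (c, s)))) =
      I (A, B) * (pairWeight A B : ℂ)⁻¹ * (((c - quadForm A⁻¹ b : ℝ) : ℂ) ^ (a - 1) *
        g (1 + (c - quadForm A⁻¹ b) + pivotForm A B b y, s - pivotShift A B b y))

variable {I : Matrix (Fin n) (Fin n) 𝕜 × Matrix (Fin n) (Fin n) 𝕜 → ℂ}
    {I' : Matrix (Fin (n + 1)) (Fin (n + 1)) 𝕜 × Matrix (Fin (n + 1)) (Fin (n + 1)) 𝕜 → ℂ}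
    {a : ℂ} {g : ℝ × 𝕜 → ℂ}

theorem PairRecursion.indicator_borderPair (hI : PairRecursion I I' a g)
    (x : (Matrix (Fin n) (Fin n) 𝕜 × Matrix (Fin n) (Fin n) 𝕜) ×
      (((Fin n → 𝕜) × (Fin n → 𝕜)) × (ℝ × 𝕜))) :
    (posSymmPairs 𝕜 (n + 1)).indicator I' (borderPair x) =
      stepFun ((posSymmPairs 𝕜 n).indicator I) (fun p => pairWeight p.1 p.2) a g
        (fun p v => quadForm p.1⁻¹ v.1) (fun p v => pivotForm p.1 p.2 v.1 v.2)
        (fun p v => pivotShift p.1 p.2 v.1 v.2) x := by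
  classical
  rw [Set.indicator_apply, borderPair_mem_iff, stepFun, pivotFun, Set.indicator_apply]
  by_cases h1 : x.1 ∈ posSymmPairs 𝕜 n
  · by_cases h2 : quadForm x.1.1⁻¹ x.2.1.1 < x.2.2.1
    · rw [if_pos ⟨h1, h2⟩, if_pos h1, if_pos h2]
      exact hI _ _ h1.1 h1.2 _ _ _ _ h2
    · rw [if_neg fun h => h2 h.2, if_neg h2, mul_zero]
  · rw [if_neg fun h => h1 h.1, if_neg h1, zero_mul, zero_mul]

variable [MeasureSpace 𝕜] [BorelSpace 𝕜]

theorem measurable_borderPair : Measurable (borderPair (𝕜 := 𝕜) (n := n)) := by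
  refine Measurable.prodMk ?_ ?_
  · exact measurable_border (by fun_prop)
      (by fun_prop) (Measurable.star_pi (by fun_prop))
      (RCLike.continuous_ofReal.measurable.comp (measurable_snd.comp measurable_snd).fst)
  · exact measurable_border (by fun_prop) (by fun_prop) (by fun_prop) (by fun_prop)

/-- An injective measurable map between standard Borel spaces is a measurable embedding
(Lusin–Souslin). -/
theorem measurableEmbedding_borderPair [StandardBorelSpace 𝕜] :
    MeasurableEmbedding (borderPair (𝕜 := 𝕜) (n := n)) :=
  measurable_borderPair.measurableEmbedding borderPair_injective

/-- Measurability is propagated through the recursion, so that `logDet` and the quaternionic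
determinant need not be shown measurable. The indicator vanishes off the range of the embedding, and
on the range it is given by `stepFun`. -/
theorem PairRecursion.measurable [SecondCountableTopology 𝕜] [StandardBorelSpace 𝕜] (hI : PairRecursion I I' a g)
    (hg : Measurable g) (h : Measurable ((posSymmPairs 𝕜 n).indicator I)) :
    Measurable ((posSymmPairs 𝕜 (n + 1)).indicator I') := by
  have h1 : Measurable fun x => (posSymmPairs 𝕜 (n + 1)).indicator I' (borderPair x) := by
    simp_rw [hI.indicator_borderPair]
    exact measurable_stepFun h (measurable_fst.pairWeight measurable_snd) hg
      (measurable_fst.fst.matrix_inv.quadForm measurable_snd.fst)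
      (measurable_fst.fst.pivotForm measurable_fst.snd measurable_snd.fst measurable_snd.snd)
      (measurable_fst.fst.pivotShift measurable_fst.snd measurable_snd.fst measurable_snd.snd)
  have h2 := (measurableEmbedding_borderPair (𝕜 := 𝕜) (n := n)).measurable_extend h1
    (measurable_const (a := (0 : ℂ)))
  convert h2 using 1
  ext p
  by_cases hp : p ∈ Set.range (borderPair (𝕜 := 𝕜) (n := n))
  · obtain ⟨x, rfl⟩ := hp
    rw [borderPair_injective.extend_apply]
  · rw [Function.extend_apply' _ _ _ hp,
      Set.indicator_of_notMem fun h => hp (posSymmPairs_subset_range h)]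

end PairStep

/-! ### The recursion of integrals -/

section PairIntegral

open Real ENNReal

theorem measurePreserving_borderPair {𝕜 : Type*} [RCLike 𝕜] {n : ℕ} [MeasureSpace 𝕜]
    [SigmaFinite (volume : Measure 𝕜)]
    {μ₁ μ₂ : Measure (Matrix (Fin n) (Fin n) 𝕜)}
    {μ₁' μ₂' : Measure (Matrix (Fin (n + 1)) (Fin (n + 1)) 𝕜)} [SFinite μ₁] [SFinite μ₂]
    [SFinite μ₁'] [SFinite μ₂']
    (h₁ : MeasurePreserving (fun q : Matrix (Fin n) (Fin n) 𝕜 × ((Fin n → 𝕜) × ℝ) =>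
      border q.1 q.2.1 (star q.2.1) (q.2.2 : 𝕜)) (μ₁.prod (volume.prod volume)) μ₁')
    (h₂ : MeasurePreserving (fun q : Matrix (Fin n) (Fin n) 𝕜 × ((Fin n → 𝕜) × 𝕜) =>
      border q.1 q.2.1 q.2.1 q.2.2) (μ₂.prod (volume.prod volume)) μ₂') :
    MeasurePreserving borderPair ((μ₁.prod μ₂).prod (volume.prod (volume.prod volume)))
      (μ₁'.prod μ₂') := by
  have h3 := measurePreserving_prodProdProdComm (volume : Measure (Fin n → 𝕜))
    (volume : Measure (Fin n → 𝕜)) (volume : Measure ℝ) (volume : Measure 𝕜)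
  have h4 := measurePreserving_prodProdProdComm μ₁ μ₂
    ((volume : Measure (Fin n → 𝕜)).prod (volume : Measure ℝ))
    ((volume : Measure (Fin n → 𝕜)).prod (volume : Measure 𝕜))
  exact (h₁.prod h₂).comp (h4.comp ((MeasurePreserving.id (μ₁.prod μ₂)).prod h3))

theorem symmLebesgue_zero_univ (𝕜 : Type*) [MeasureSpace 𝕜] [SigmaFinite (volume : Measure 𝕜)] :
    symmLebesgue 𝕜 0 Set.univ = 1 := by
  rw [symmLebesgue, Measure.map_apply measurable_symmOfCoords MeasurableSet.univ, Set.preimage_univ,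
    ← Set.pi_univ Set.univ, volume_pi_pi]
  simp

theorem hermLebesgue_zero_univ : hermLebesgue 0 Set.univ = 1 := by
  rw [hermLebesgue, Measure.map_apply measurable_hermOfCoords MeasurableSet.univ, Set.preimage_univ,
    ← Set.univ_prod_univ, Measure.volume_eq_prod, Measure.prod_prod, ← Set.pi_univ Set.univ,
    ← Set.pi_univ Set.univ, volume_pi_pi, volume_pi_pi]
  simp

theorem mem_posSymmPairs_zero {𝕜 : Type*} [RCLike 𝕜]
    (p : Matrix (Fin 0) (Fin 0) 𝕜 × Matrix (Fin 0) (Fin 0) 𝕜) :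
    p ∈ posSymmPairs 𝕜 0 :=
  ⟨by rw [Subsingleton.elim p.1 1]; exact PosDef.one, Subsingleton.elim _ _⟩

variable {𝕜 : Type*} [RCLike 𝕜] {n : ℕ} [MeasureSpace 𝕜] [BorelSpace 𝕜]
  [SecondCountableTopology 𝕜] [StandardBorelSpace 𝕜] [SigmaFinite (volume : Measure 𝕜)]
  [GaussianVolume 𝕜] [(volume : Measure 𝕜).IsAddHaarMeasure]
  {I : Matrix (Fin n) (Fin n) 𝕜 × Matrix (Fin n) (Fin n) 𝕜 → ℂ}
  {I' : Matrix (Fin (n + 1)) (Fin (n + 1)) 𝕜 × Matrix (Fin (n + 1)) (Fin (n + 1)) 𝕜 → ℂ}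
  {a κ Kc : ℂ} {g : ℝ × 𝕜 → ℂ} {K : ℝ≥0∞}
  {μ : Measure (Matrix (Fin n) (Fin n) 𝕜 × Matrix (Fin n) (Fin n) 𝕜)}
  {μ' : Measure (Matrix (Fin (n + 1)) (Fin (n + 1)) 𝕜 × Matrix (Fin (n + 1)) (Fin (n + 1)) 𝕜)}

theorem PairRecursion.lintegral (hI : PairRecursion I I' a g) (hg : Measurable g)
    (h : Measurable ((posSymmPairs 𝕜 n).indicator I))
    (hμ : MeasurePreserving borderPair (μ.prod (volume.prod (volume.prod volume))) μ')
    (hK : ∀ w : ℝ, 0 < w →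
      ∫⁻ s, ‖g (w, s)‖ₑ = K * ENNReal.ofReal (w ^ (-κ.re))) :
    ∫⁻ p, ‖(posSymmPairs 𝕜 (n + 1)).indicator I' p‖ₑ ∂μ' =
      (∫⁻ p, ‖(posSymmPairs 𝕜 n).indicator I p‖ₑ ∂μ) *
        (K * betaConst a.re κ.re (Module.finrank ℝ 𝕜 * n)) := by
  have hx : ∀ x, (posSymmPairs 𝕜 n).indicator I x ≠ 0 → x ∈ posSymmPairs 𝕜 n := fun x hx => by
    by_contra h
    exact hx (Set.indicator_of_notMem h _)
  rw [← hμ.map_eq, measurableEmbedding_borderPair.lintegral_map]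
  simp_rw [hI.indicator_borderPair]
  exact lintegral_stepFun h (measurable_fst.pairWeight measurable_snd) hg
    (measurable_fst.fst.matrix_inv.quadForm measurable_snd.fst)
    (measurable_fst.fst.pivotForm measurable_fst.snd measurable_snd.fst measurable_snd.snd)
    (measurable_fst.fst.pivotShift measurable_fst.snd measurable_snd.fst measurable_snd.snd)
    (fun x h v => pivotForm_nonneg (hx x h).1 _ _ _) (fun x h => pairWeight_pos (hx x h).1 _)
    (fun x h t ht => lintegral_exp_pivotForm (hx x h).1 _ ht) (by positivity) hK

theorem PairRecursion.integral [SFinite μ] (hI : PairRecursion I I' a g) (hg : Measurable g)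
    (h : Measurable ((posSymmPairs 𝕜 n).indicator I))
    (hμ : MeasurePreserving borderPair (μ.prod (volume.prod (volume.prod volume))) μ')
    (hK : ∀ w : ℝ, 0 < w →
      ∫⁻ s, ‖g (w, s)‖ₑ = K * ENNReal.ofReal (w ^ (-κ.re)))
    (hK' : K ≠ ∞) (ha : 0 < a.re) (hb : 0 < κ.re - (Module.finrank ℝ 𝕜 * n : ℝ) - a.re)
    (hKc : ∀ w : ℝ, 0 < w → ∫ s, g (w, s) = Kc * (w : ℂ) ^ (-κ))
    (hfi : ∫⁻ p, ‖(posSymmPairs 𝕜 n).indicator I p‖ₑ ∂μ ≠ ∞) :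
    ∫ p, (posSymmPairs 𝕜 (n + 1)).indicator I' p ∂μ' =
      (∫ p, (posSymmPairs 𝕜 n).indicator I p ∂μ) *
        (Kc * ((π : ℂ) ^ ((Module.finrank ℝ 𝕜 * n : ℝ) : ℂ) * Complex.Gamma a *
          Complex.Gamma (κ - (Module.finrank ℝ 𝕜 * n : ℝ) - a) / Complex.Gamma κ)) := by
  have hx : ∀ x, (posSymmPairs 𝕜 n).indicator I x ≠ 0 → x ∈ posSymmPairs 𝕜 n := fun x hx => by
    by_contra h
    exact hx (Set.indicator_of_notMem h _)
  rw [← hμ.map_eq, measurableEmbedding_borderPair.integral_map]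
  simp_rw [hI.indicator_borderPair]
  exact integral_stepFun h (measurable_fst.pairWeight measurable_snd) hg
    (measurable_fst.fst.matrix_inv.quadForm measurable_snd.fst)
    (measurable_fst.fst.pivotForm measurable_fst.snd measurable_snd.fst measurable_snd.snd)
    (measurable_fst.fst.pivotShift measurable_fst.snd measurable_snd.fst measurable_snd.snd)
    (fun x h v => pivotForm_nonneg (hx x h).1 _ _ _) (fun x h => pairWeight_pos (hx x h).1 _)
    (fun x h t ht => lintegral_exp_pivotForm (hx x h).1 _ ht) (by positivity) hK hK' ha hb hKc hfi

/-- A product of nonzero elements of `[0, ∞]` is finite exactly when all factors are. Finiteness of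
the kernel constant `K` gives no extra condition, since a finite beta factor already forces `0 < κ`.
-/
theorem mul_betaConst_ne_top_iff {L : ℝ≥0∞} {a κ m : ℝ} (hL : L ≠ 0) (hK0 : K ≠ 0)
    (hK : 0 < κ → K ≠ ∞) (hm : 0 ≤ m) :
    L * (K * betaConst a κ m) ≠ ∞ ↔ L ≠ ∞ ∧ 0 < a ∧ 0 < κ - m - a := by
  have hβ := betaConst_ne_zero (a := a) (κ := κ) hm
  rw [← betaConst_lt_top_iff, lt_top_iff_ne_top]
  constructor
  · intro h
    refine ⟨fun h1 => h ?_, fun h1 => h ?_⟩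
    · rw [h1, ENNReal.top_mul (mul_ne_zero hK0 hβ)]
    · rw [h1, ENNReal.mul_top hK0, ENNReal.mul_top hL]
  · rintro ⟨h1, h2⟩
    have h3 := betaConst_lt_top_iff.1 h2.lt_top
    exact ENNReal.mul_ne_top h1 (ENNReal.mul_ne_top (hK (by linarith [h3.1, h3.2])) h2)

end PairIntegral

/-! ### Induction in the real case -/

section MainReal

open Real ENNReal

/-- The measure on pairs of real symmetric matrices. -/
def realPairMeasure (n : ℕ) : Measure (Matrix (Fin n) (Fin n) ℝ × Matrix (Fin n) (Fin n) ℝ) :=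
  (symmLebesgue ℝ n).prod (symmLebesgue ℝ n)

instance (n : ℕ) : SFinite (realPairMeasure n) := by
  unfold realPairMeasure
  infer_instance

theorem measurePreserving_borderPair_real (n : ℕ) :
    MeasurePreserving borderPair
      ((realPairMeasure n).prod (volume.prod (volume.prod volume))) (realPairMeasure (n + 1)) :=
  measurePreserving_borderPair (𝕜 := ℝ) (by simpa using measurePreserving_border_symm (𝕜 := ℝ) n)
    (measurePreserving_border_symm n)

theorem pairRecursion_realIntegrand {n : ℕ} (lam σ τ : Fin (n + 1) → ℂ) :
    PairRecursion (realIntegrand (fun j : Fin n => lam j.castSucc - 1 / 2)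
        (fun j => σ j.castSucc - 1 / 2) (fun j => τ j.castSucc - 1 / 2))
      (realIntegrand lam σ τ) (lam (Fin.last n) - (n + 1))
      (cauchyKernel (σ (Fin.last n)) (τ (Fin.last n))) :=
  fun _ _ hA hB b y _ s hc => realIntegrand_border lam σ τ hA hB b y hc s

/-- The conditions of convergence in the real case. -/
def RealConvergent {n : ℕ} (lam σ τ : Fin n → ℂ) : Prop :=
  ∀ k : Fin n, ((n : ℝ) + ((k : ℕ) + 1)) / 2 < (lam k).re ∧
    ((n : ℝ) - ((k : ℕ) + 1)) / 2 < (σ k + τ k - lam k).re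

/-- The half-integer shifts compensate the passage from `n + 1` to `n` in the conditions with
smaller index; the last condition is that of the beta integral with `κ = σ + τ - 1`, `m = n` and `a
= lam - (n + 1)`. -/
theorem realConvergent_succ_iff {n : ℕ} (lam σ τ : Fin (n + 1) → ℂ) :
    RealConvergent lam σ τ ↔
      RealConvergent (fun j : Fin n => lam j.castSucc - 1 / 2) (fun j => σ j.castSucc - 1 / 2)
          (fun j => τ j.castSucc - 1 / 2) ∧
        0 < (lam (Fin.last n) - (n + 1)).re ∧
        0 < (σ (Fin.last n) + τ (Fin.last n) - 1).re - n - (lam (Fin.last n) - (n + 1)).re := by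
  rw [RealConvergent, RealConvergent, Fin.forall_fin_succ']
  refine and_congr (forall_congr' fun k => and_congr ?_ ?_) (and_congr ?_ ?_) <;>
    simp <;> constructor <;> intro h <;> linarith

/-- The value of the integral in the real case. -/
def realValue {n : ℕ} (lam σ τ : Fin n → ℂ) : ℂ :=
  ∏ k : Fin n,
    (2 : ℂ) ^ (2 - σ k - τ k + n - ((k : ℕ) + 1)) * (Real.pi : ℂ) ^ ((k : ℕ) + 1) *
      Complex.Gamma (lam k - (n + ((k : ℕ) + 1)) / 2) *
      Complex.Gamma (σ k + τ k - lam k - (n - ((k : ℕ) + 1)) / 2) /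
      (Complex.Gamma (σ k - (n - ((k : ℕ) + 1)) / 2) *
        Complex.Gamma (τ k - (n - ((k : ℕ) + 1)) / 2))

theorem realValue_succ {n : ℕ} (lam σ τ : Fin (n + 1) → ℂ)
    (h : 1 < (σ (Fin.last n) + τ (Fin.last n)).re) :
    realValue lam σ τ =
      realValue (fun j : Fin n => lam j.castSucc - 1 / 2) (fun j => σ j.castSucc - 1 / 2)
          (fun j => τ j.castSucc - 1 / 2) *
        (cauchyVal (σ (Fin.last n)) (τ (Fin.last n)) * ((π : ℂ) ^ n *
          Complex.Gamma (lam (Fin.last n) - (n + 1)) *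
          Complex.Gamma (σ (Fin.last n) + τ (Fin.last n) - 1 - n - (lam (Fin.last n) - (n + 1))) /
          Complex.Gamma (σ (Fin.last n) + τ (Fin.last n) - 1))) := by
  -- This factor occurs in the numerator of Cauchy's integral and in the denominator of the beta
  -- integral, and cancels.
  have hG : Complex.Gamma (σ (Fin.last n) + τ (Fin.last n) - 1) ≠ 0 :=
    Complex.Gamma_ne_zero_of_re_pos (by rw [Complex.sub_re, Complex.one_re]; linarith)
  rw [realValue, realValue, Fin.prod_univ_castSucc]
  congr 1
  · refine Finset.prod_congr rfl fun k _ => ?_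
    rw [Fin.val_castSucc]
    push_cast
    congr 1
    · congr 1
      · congr 1
        · congr 2
          ring
        · congr 1
          ring
      · congr 1
        ring
    · congr 2 <;> ring
  · rw [cauchyVal, Fin.val_last]
    have e1 : (2 : ℂ) - σ (Fin.last n) - τ (Fin.last n) + ((n + 1 : ℕ) : ℂ) - ((n : ℂ) + 1) =
      2 - σ (Fin.last n) - τ (Fin.last n) := by push_cast; ring
    have e2 : (((n + 1 : ℕ) : ℂ) - ((n : ℂ) + 1)) / 2 = 0 := by push_cast; ring
    have e3 : (((n + 1 : ℕ) : ℂ) + ((n : ℂ) + 1)) / 2 = n + 1 := by push_cast; ring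
    have e4 : σ (Fin.last n) + τ (Fin.last n) - 1 - n - (lam (Fin.last n) - (n + 1)) =
      σ (Fin.last n) + τ (Fin.last n) - lam (Fin.last n) := by ring
    rw [e1, e2, e3, e4, sub_zero, sub_zero, sub_zero]
    -- At the poles `Complex.Gamma` takes the value zero and division by zero gives zero, which
    -- agrees with the convention `1/Γ = 0`.
    by_cases h1 : Complex.Gamma (σ (Fin.last n)) = 0
    · simp [h1]
    by_cases h2 : Complex.Gamma (τ (Fin.last n)) = 0
    · simp [h2]
    field_simp
    ring

/-- The four assertions are carried through one induction. Nonvanishing of the norm integral is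
included because a zero factor would hide the divergence of the others. -/
theorem realIntegral_eq (n : ℕ) : ∀ lam σ τ : Fin n → ℂ,
    Measurable ((posSymmPairs ℝ n).indicator (realIntegrand lam σ τ)) ∧
    ∫⁻ p, ‖(posSymmPairs ℝ n).indicator (realIntegrand lam σ τ) p‖ₑ ∂realPairMeasure n ≠ 0 ∧
    (∫⁻ p, ‖(posSymmPairs ℝ n).indicator (realIntegrand lam σ τ) p‖ₑ ∂realPairMeasure n ≠ ∞ ↔
      RealConvergent lam σ τ) ∧
    (RealConvergent lam σ τ →
      ∫ p, (posSymmPairs ℝ n).indicator (realIntegrand lam σ τ) p ∂realPairMeasure n =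
        realValue lam σ τ) := by
  induction n with
  | zero =>
    intro lam σ τ
    have h1 : (posSymmPairs ℝ 0).indicator (realIntegrand lam σ τ) = fun _ => 1 := by
      ext p
      rw [Set.indicator_of_mem (mem_posSymmPairs_zero p)]
      simp [realIntegrand]
    have h2 : realPairMeasure 0 Set.univ = 1 := by
      rw [realPairMeasure, ← Set.univ_prod_univ, Measure.prod_prod, symmLebesgue_zero_univ, one_mul]
    rw [h1]
    refine ⟨measurable_const, ?_, ?_, fun _ => ?_⟩
    · simp [h2]
    · simp [h2, RealConvergent]
    · simp [Measure.real, h2, realValue]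
  | succ n ih =>
    intro lam σ τ
    obtain ⟨i1, i2, i3, i4⟩ := ih (fun j : Fin n => lam j.castSucc - 1 / 2)
      (fun j => σ j.castSucc - 1 / 2) (fun j => τ j.castSucc - 1 / 2)
    have hI := pairRecursion_realIntegrand lam σ τ
    set s := σ (Fin.last n) with hs
    set t := τ (Fin.last n) with ht
    set l := lam (Fin.last n) with hl
    have hg := measurable_cauchyKernel s t
    have hK : ∀ w : ℝ, 0 < w → ∫⁻ x, ‖cauchyKernel s t (w, x)‖ₑ =
        (∫⁻ x, ‖cauchyKernel s t (1, x)‖ₑ) * ENNReal.ofReal (w ^ (-(s + t - 1).re)) := by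
      intro w hw
      simpa using lintegral_kernel (volume : Measure ℝ) hg (cauchyKernel_hom s t) hw
    have hμ := measurePreserving_borderPair_real n
    have hL := hI.lintegral hg i1 hμ hK
    have hK0 : ∫⁻ x, ‖cauchyKernel s t (1, x)‖ₑ ≠ 0 :=
      lintegral_enorm_ne_zero volume (NeZero.ne _) (hg.comp measurable_prodMk_left)
        (cauchyKernel_ne_zero s t)
    have hK1 : 0 < (s + t - 1).re → ∫⁻ x, ‖cauchyKernel s t (1, x)‖ₑ ≠ ∞ := fun h =>
      lintegral_cauchyKernel_ne_top (by rw [Complex.sub_re, Complex.one_re] at h; linarith)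
    have hm : ((Module.finrank ℝ ℝ : ℝ) * n) = n := by simp
    have hm0 : (0 : ℝ) ≤ n := by positivity
    rw [hm] at hL
    have hiff : ∫⁻ p, ‖(posSymmPairs ℝ (n + 1)).indicator (realIntegrand lam σ τ) p‖ₑ
        ∂realPairMeasure (n + 1) ≠ ∞ ↔ RealConvergent lam σ τ := by
      rw [hL, mul_betaConst_ne_top_iff i2 hK0 hK1 hm0, i3, realConvergent_succ_iff]
    refine ⟨hI.measurable hg i1, ?_, hiff, fun hc => ?_⟩
    · rw [hL]
      exact mul_ne_zero i2 (mul_ne_zero hK0 (betaConst_ne_zero hm0))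
    · obtain ⟨c1, c2, c3⟩ := (realConvergent_succ_iff lam σ τ).1 hc
      have hst : 0 < (s + t - 1).re := by linarith
      have hst' : 1 < (s + t).re := by
        rw [Complex.sub_re, Complex.one_re] at hst
        linarith
      have := hI.integral (Kc := cauchyVal s t) hg i1 hμ hK (hK1 hst) c2 (by rw [hm]; exact c3)
        (fun w hw => integral_cauchyKernel hst' hw) (i3.2 c1)
      rw [this, i4 c1, realValue_succ lam σ τ hst', hm]
      simp only [Complex.ofReal_natCast, Complex.cpow_natCast, ← hs, ← ht, ← hl]

end MainReal

/-! ### Induction in the quaternionic case -/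

section MainQuat

open Real ENNReal

/-- The measure on pairs of a hermitian and a complex symmetric matrix. -/
def complexPairMeasure (n : ℕ) : Measure (Matrix (Fin n) (Fin n) ℂ × Matrix (Fin n) (Fin n) ℂ) :=
  (hermLebesgue n).prod (symmLebesgue ℂ n)

instance (n : ℕ) : SFinite (complexPairMeasure n) := by
  unfold complexPairMeasure
  infer_instance

theorem measurePreserving_borderPair_complex (n : ℕ) :
    MeasurePreserving borderPair
      ((complexPairMeasure n).prod (volume.prod (volume.prod volume)))
      (complexPairMeasure (n + 1)) :=
  measurePreserving_borderPair (𝕜 := ℂ) (measurePreserving_border_herm n)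
    (measurePreserving_border_symm n)

theorem pairRecursion_quatIntegrand {n : ℕ} (lam σ : Fin (n + 1) → ℂ) :
    PairRecursion (quatIntegrand (fun j : Fin n => lam j.castSucc - 1)
        (fun j => σ j.castSucc - 2))
      (quatIntegrand lam σ) (lam (Fin.last n) - (2 * n + 2)) (quatKernel (σ (Fin.last n))) :=
  fun _ _ hA hB b y _ s hc => quatIntegrand_border lam σ hA hB b y hc s

/-- The conditions of convergence in the quaternionic case. -/
def QuatConvergent {n : ℕ} (lam σ : Fin n → ℂ) : Prop :=
  ∀ k : Fin n, (n : ℝ) + ((k : ℕ) + 1) < (lam k).re ∧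
    (n : ℝ) - ((k : ℕ) + 1) < (σ k - lam k).re

theorem quatConvergent_succ_iff {n : ℕ} (lam σ : Fin (n + 1) → ℂ) :
    QuatConvergent lam σ ↔
      QuatConvergent (fun j : Fin n => lam j.castSucc - 1) (fun j => σ j.castSucc - 2) ∧
        0 < (lam (Fin.last n) - (2 * n + 2)).re ∧
        0 < (σ (Fin.last n) - 2).re - 2 * n - (lam (Fin.last n) - (2 * n + 2)).re := by
  rw [QuatConvergent, QuatConvergent, Fin.forall_fin_succ']
  refine and_congr (forall_congr' fun k => and_congr ?_ ?_) (and_congr ?_ ?_) <;>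
    simp <;> constructor <;> intro h <;> linarith

/-- The value of the integral in the quaternionic case. -/
def quatValue {n : ℕ} (lam σ : Fin n → ℂ) : ℂ :=
  ∏ k : Fin n,
    2 * (Real.pi : ℂ) ^ (2 * ((k : ℕ) + 1) - 1) *
      Complex.Gamma (lam k - (n + ((k : ℕ) + 1))) *
      Complex.Gamma (σ k - lam k - (n - ((k : ℕ) + 1))) /
      Complex.Gamma (σ k - 2 * (n - ((k : ℕ) + 1)) - 1)

/-- The factor `1/(σ - 2)` of the kernel integral joins the `1/Γ(σ - 2)` of the beta integral to
give `1/Γ(σ - 1)`. -/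
theorem quatValue_succ {n : ℕ} (lam σ : Fin (n + 1) → ℂ) (h : 2 < (σ (Fin.last n)).re) :
    quatValue lam σ =
      quatValue (fun j : Fin n => lam j.castSucc - 1) (fun j => σ j.castSucc - 2) *
        (2 * π / (σ (Fin.last n) - 2) * ((π : ℂ) ^ (2 * n) *
          Complex.Gamma (lam (Fin.last n) - (2 * n + 2)) *
          Complex.Gamma (σ (Fin.last n) - 2 - 2 * n - (lam (Fin.last n) - (2 * n + 2))) /
          Complex.Gamma (σ (Fin.last n) - 2))) := by
  have h2 : 0 < (σ (Fin.last n) - 2).re := by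
    rw [Complex.sub_re, Complex.re_ofNat]
    linarith
  have hG : Complex.Gamma (σ (Fin.last n) - 2) ≠ 0 := Complex.Gamma_ne_zero_of_re_pos h2
  have h0 : σ (Fin.last n) - 2 ≠ 0 := fun h => by simp [h] at h2
  rw [quatValue, quatValue, Fin.prod_univ_castSucc]
  congr 1
  · refine Finset.prod_congr rfl fun k _ => ?_
    rw [Fin.val_castSucc]
    push_cast
    congr 1
    · congr 1
      · congr 2
        ring
      · congr 1
        ring
    · congr 1
      ring
  · rw [Fin.val_last]
    have e1 : lam (Fin.last n) - (((n + 1 : ℕ) : ℂ) + ((n : ℂ) + 1)) =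
      lam (Fin.last n) - (2 * n + 2) := by push_cast; ring
    have e2 : σ (Fin.last n) - lam (Fin.last n) - (((n + 1 : ℕ) : ℂ) - ((n : ℂ) + 1)) =
      σ (Fin.last n) - lam (Fin.last n) := by push_cast; ring
    have e3 : σ (Fin.last n) - 2 * (((n + 1 : ℕ) : ℂ) - ((n : ℂ) + 1)) - 1 =
      (σ (Fin.last n) - 2) + 1 := by push_cast; ring
    have e4 : σ (Fin.last n) - 2 - 2 * n - (lam (Fin.last n) - (2 * n + 2)) =
      σ (Fin.last n) - lam (Fin.last n) := by ring
    have e5 : 2 * (n + 1) - 1 = 2 * n + 1 := by omega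
    rw [e1, e2, e3, e4, e5, Complex.Gamma_add_one _ h0]
    field_simp
    ring

theorem quatIntegral_eq (n : ℕ) : ∀ lam σ : Fin n → ℂ,
    Measurable ((posSymmPairs ℂ n).indicator (quatIntegrand lam σ)) ∧
    ∫⁻ p, ‖(posSymmPairs ℂ n).indicator (quatIntegrand lam σ) p‖ₑ ∂complexPairMeasure n ≠ 0 ∧
    (∫⁻ p, ‖(posSymmPairs ℂ n).indicator (quatIntegrand lam σ) p‖ₑ ∂complexPairMeasure n ≠ ∞ ↔
      QuatConvergent lam σ) ∧
    (QuatConvergent lam σ →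
      ∫ p, (posSymmPairs ℂ n).indicator (quatIntegrand lam σ) p ∂complexPairMeasure n =
        quatValue lam σ) := by
  induction n with
  | zero =>
    intro lam σ
    have h1 : (posSymmPairs ℂ 0).indicator (quatIntegrand lam σ) = fun _ => 1 := by
      ext p
      rw [Set.indicator_of_mem (mem_posSymmPairs_zero p)]
      simp [quatIntegrand]
    have h2 : complexPairMeasure 0 Set.univ = 1 := by
      rw [complexPairMeasure, ← Set.univ_prod_univ, Measure.prod_prod, symmLebesgue_zero_univ,
        hermLebesgue_zero_univ, one_mul]
    rw [h1]
    refine ⟨measurable_const, ?_, ?_, fun _ => ?_⟩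
    · simp [h2]
    · simp [h2, QuatConvergent]
    · simp [Measure.real, h2, quatValue]
  | succ n ih =>
    intro lam σ
    obtain ⟨i1, i2, i3, i4⟩ := ih (fun j : Fin n => lam j.castSucc - 1)
      (fun j => σ j.castSucc - 2)
    have hI := pairRecursion_quatIntegrand lam σ
    set s := σ (Fin.last n) with hs
    set l := lam (Fin.last n) with hl
    have hg := measurable_quatKernel s
    have hK : ∀ w : ℝ, 0 < w → ∫⁻ x, ‖quatKernel s (w, x)‖ₑ =
        (∫⁻ x, ‖quatKernel s (1, x)‖ₑ) * ENNReal.ofReal (w ^ (-(s - 2).re)) := by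
      intro w hw
      simpa using lintegral_kernel (volume : Measure ℂ) hg (quatKernel_hom s) hw
    have hμ := measurePreserving_borderPair_complex n
    have hL := hI.lintegral hg i1 hμ hK
    have hK0 : ∫⁻ x, ‖quatKernel s (1, x)‖ₑ ≠ 0 :=
      lintegral_enorm_ne_zero volume (NeZero.ne _) (hg.comp measurable_prodMk_left)
        (quatKernel_ne_zero s)
    have hre : (s - 2).re = s.re - 2 := by rw [Complex.sub_re, Complex.re_ofNat]
    have hK1 : 0 < (s - 2).re → ∫⁻ x, ‖quatKernel s (1, x)‖ₑ ≠ ∞ := fun h =>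
      lintegral_quatKernel_ne_top (by linarith)
    have hm : ((Module.finrank ℝ ℂ : ℝ) * n) = 2 * n := by simp [Complex.finrank_real_complex]
    have hm0 : (0 : ℝ) ≤ 2 * n := by positivity
    rw [hm] at hL
    have hiff : ∫⁻ p, ‖(posSymmPairs ℂ (n + 1)).indicator (quatIntegrand lam σ) p‖ₑ
        ∂complexPairMeasure (n + 1) ≠ ∞ ↔ QuatConvergent lam σ := by
      rw [hL, mul_betaConst_ne_top_iff i2 hK0 hK1 hm0, i3, quatConvergent_succ_iff]
    refine ⟨hI.measurable hg i1, ?_, hiff, fun hc => ?_⟩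
    · rw [hL]
      exact mul_ne_zero i2 (mul_ne_zero hK0 (betaConst_ne_zero hm0))
    · obtain ⟨c1, c2, c3⟩ := (quatConvergent_succ_iff lam σ).1 hc
      have hst : 0 < (s - 2).re := by linarith
      have hst' : 2 < s.re := by linarith
      have := hI.integral (Kc := 2 * π / (s - 2)) hg i1 hμ hK (hK1 hst) c2
        (by rw [hm]; exact c3) (fun w hw => integral_quatKernel hst' hw) (i3.2 c1)
      rw [this, i4 c1, quatValue_succ lam σ hst', hm,
        show ((2 * n : ℝ) : ℂ) = ((2 * n : ℕ) : ℂ) by push_cast; rfl, Complex.cpow_natCast]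
      push_cast
      rfl

end MainQuat

/-! ### Integrability on the domains -/

section Main

open ENNReal

/-- The domain is where the indicator function is nonzero, so its measurability comes with that of
the integrand; any choice of parameters will do. -/
theorem measurableSet_of_measurable_indicator {X : Type*} [MeasurableSpace X] {s : Set X}
    {f : X → ℂ} (h : Measurable (s.indicator f)) (h0 : ∀ x ∈ s, f x ≠ 0) : MeasurableSet s := by
  have : s = (s.indicator f) ⁻¹' {0}ᶜ := by
    ext x
    by_cases hx : x ∈ s <;> simp [hx, h0]
  rw [this]
  exact h (measurableSet_singleton 0).compl

theorem measurableSet_realPairs (n : ℕ) : MeasurableSet (realPairs n) :=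
  measurableSet_of_measurable_indicator (realIntegral_eq n 0 0 0).1 fun p hp => by
    rw [realIntegrand_eq_pivotExp 0 0 0 hp.1 p.2]
    exact pivotExp_ne_zero _ _ _ _ _

theorem measurableSet_complexPairs (n : ℕ) : MeasurableSet (complexPairs n) :=
  measurableSet_of_measurable_indicator (quatIntegral_eq n 0 0).1 fun p hp => by
    rw [quatIntegrand_eq_pivotExp 0 0 hp.1 hp.2]
    exact pivotExp_ne_zero _ _ _ _ _

theorem integrableOn_iff_lintegral_indicator_ne_top {X : Type*} [MeasurableSpace X] {μ : Measure X}
    {s : Set X} (hs : MeasurableSet s) {f : X → ℂ} (h : Measurable (s.indicator f)) :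
    IntegrableOn f s μ ↔ ∫⁻ x, ‖s.indicator f x‖ₑ ∂μ ≠ ∞ := by
  rw [← integrable_indicator_iff hs, ← lt_top_iff_ne_top]
  exact ⟨fun h1 => h1.2, fun h1 => ⟨h.aestronglyMeasurable, h1⟩⟩

end Main

end

theorem mainTheorem5 (n : ℕ) :
    (∀ lam σ τ : Fin n → ℂ,
      (IntegrableOn (realIntegrand lam σ τ) (realPairs n)
          ((symmLebesgue ℝ n).prod (symmLebesgue ℝ n)) ↔
        ∀ k : Fin n,
          ((n : ℝ) + ((k : ℕ) + 1)) / 2 < (lam k).re ∧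
          ((n : ℝ) - ((k : ℕ) + 1)) / 2 < (σ k + τ k - lam k).re) ∧
      (IntegrableOn (realIntegrand lam σ τ) (realPairs n)
          ((symmLebesgue ℝ n).prod (symmLebesgue ℝ n)) →
        ∫ p in realPairs n, realIntegrand lam σ τ p
            ∂((symmLebesgue ℝ n).prod (symmLebesgue ℝ n)) =
          ∏ k : Fin n,
            (2 : ℂ) ^ (2 - σ k - τ k + n - ((k : ℕ) + 1)) * (Real.pi : ℂ) ^ ((k : ℕ) + 1) *
              Complex.Gamma (lam k - (n + ((k : ℕ) + 1)) / 2) *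
              Complex.Gamma (σ k + τ k - lam k - (n - ((k : ℕ) + 1)) / 2) /
              (Complex.Gamma (σ k - (n - ((k : ℕ) + 1)) / 2) *
                Complex.Gamma (τ k - (n - ((k : ℕ) + 1)) / 2)))) ∧
    (∀ lam σ : Fin n → ℂ,
      (IntegrableOn (quatIntegrand lam σ) (complexPairs n)
          ((hermLebesgue n).prod (symmLebesgue ℂ n)) ↔
        ∀ k : Fin n,
          (n : ℝ) + ((k : ℕ) + 1) < (lam k).re ∧
          (n : ℝ) - ((k : ℕ) + 1) < (σ k - lam k).re) ∧
      (IntegrableOn (quatIntegrand lam σ) (complexPairs n)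
          ((hermLebesgue n).prod (symmLebesgue ℂ n)) →
        ∫ p in complexPairs n, quatIntegrand lam σ p
            ∂((hermLebesgue n).prod (symmLebesgue ℂ n)) =
          ∏ k : Fin n,
            2 * (Real.pi : ℂ) ^ (2 * ((k : ℕ) + 1) - 1) *
              Complex.Gamma (lam k - (n + ((k : ℕ) + 1))) *
              Complex.Gamma (σ k - lam k - (n - ((k : ℕ) + 1))) /
              Complex.Gamma (σ k - 2 * (n - ((k : ℕ) + 1)) - 1))) := by
  refine ⟨fun lam σ τ => ?_, fun lam σ => ?_⟩
  · obtain ⟨h1, -, h3, h4⟩ := realIntegral_eq n lam σ τ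
    have hs := measurableSet_realPairs n
    have h5 : IntegrableOn (realIntegrand lam σ τ) (realPairs n)
        ((symmLebesgue ℝ n).prod (symmLebesgue ℝ n)) ↔ RealConvergent lam σ τ :=
      (integrableOn_iff_lintegral_indicator_ne_top hs h1).trans h3
    exact ⟨h5, fun h => (integral_indicator hs).symm.trans (h4 (h5.1 h))⟩
  · obtain ⟨h1, -, h3, h4⟩ := quatIntegral_eq n lam σ
    have hs := measurableSet_complexPairs n
    have h5 : IntegrableOn (quatIntegrand lam σ) (complexPairs n)
        ((hermLebesgue n).prod (symmLebesgue ℂ n)) ↔ QuatConvergent lam σ :=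
      (integrableOn_iff_lintegral_indicator_ne_top hs h1).trans h3
    exact ⟨h5, fun h => (integral_indicator hs).symm.trans (h4 (h5.1 h))⟩
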